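/- Let $q$ be a prime power. Let $\mathbb S$ be a regular $2$-spread of $\mathrm{PG}(8,q)$ with conjugate transversal planes $\Gamma,\Gamma^q,\Gamma^{q^2}$ in $\mathrm{PG}(8,q^3)$ (three planes spanning $\mathrm{PG}(8,q^3)$, where $X\mapsto X^q$ raises coordinates to the power $q$). Identify $\mathrm{PG}(2,q^3)$ with $\Gamma$, $\bar X\leftrightarrow X$, so that $\bar X$ is represented by the spread plane $\langle X,X^q,X^{q^2}\rangle\cap \mathrm{PG}(8,q)$. Let $\ell_\infty$ be a line of $\mathrm{PG}(2,q^3)$, $g$ the corresponding line of $\Gamma$, $\Sigma_\infty=\langle g,g^q,g^{q^2}\rangle\cap \mathrm{PG}(8,q)$, and let $\Sigma_{6,q}$ be a $6$-space of $\mathrm{PG}(8,q)$ containing $\Sigma_\infty$. Intersecting the spread planes with $\Sigma_{6,q}\cong\mathrm{PG}(6,q)$ gives the (exact-at-infinity) Bruck-Bose representation; $[\mathcal K]$ denotes the set of points of $\Sigma_{6,q}$ on the spread planes representing the points of $\bar{\mathcal K}\subseteq \mathrm{PG}(2,q^3)$. Write $\mathcal V^{*}$ and $\mathcal V^{**}$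 for the extensions of a variety or subspace $\mathcal V$ to coordinates in $\mathbb F_{q^3}$ and $\mathbb F_{q^6}$ (same equations over $\mathbb F_q$; for an object defined over $\mathbb F_{q^3}$ such as $g$, $g^{**}$ is its extension to $\mathbb F_{q^6}$). An $r$-dimensional normal rational curve ($r$-dim nrc) is the image of $\{(1,\theta,\dots,\theta^r)\mid\theta\in\mathbb F_q\}\cup\{(0,\dots,0,1)\}$ under an injective linear map defined over $\mathbb F_q$; its extensions are obtained from the same parametrisation over $\mathbb F_{q^3}$ and $\mathbb F_{q^6}$. A T-line of $\Sigma_\infty^{*}$ is a line of $\Sigma_\infty^*$ meeting two of $g,g^q,g^{q^2}$. Let $\bar\pi$ be an $\mathbb F_q$-subplane of $\mathrm{PG}(2,q^3)$ exterior to $\ell_\infty$ (an image of $\mathrm{PG}(2,q)$ under $\mathrm{PGL}(3,q^3)$ with no point on $\ell_\infty$), let $\mathsf c:\bar X\mapsto B\bar X^q$ be the collineation fixing $\bar\pi$ pointwise, and let $\bar{\mathcal C}$ be an $\mathbb F_q$-conic (non-degenerate conic) of $\bar\pi$. Let $\bar{\mathcal C}^{+}$ and $\bar{\mathcal C}^{++}$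 be the conics of $\mathrm{PG}(2,q^3)$ and $\mathrm{PG}(2,q^6)$ with the same equation as $\bar{\mathcal C}$, and $\ell_\infty^{++}$ the extension of $\ell_\infty$ to $\mathrm{PG}(2,q^6)$. Let $\mathcal V([\mathcal C])$ be the section by $\Sigma_{6,q}$ of the intersection of the quadrics of $\mathrm{PG}(8,q)$ that express, for a point $P$ of the spread plane representing $\bar Y$, that $\bar Y\in\bar\pi$ and that $\bar Y$ satisfies the equation of $\bar{\mathcal C}$ (namely, with $y$ the coordinates of $\bar Y$ in a frame of $\bar\pi$ obtained by $\mathbb F_q$-linear projection of $P$ and $f=0$ the equation of $\bar{\mathcal C}$ in this frame, the $\mathbb F_q$-components of $y_iy_j^q=y_jy_i^q$ and $f(y)=0$). Then the set of $\mathbb F_q$-points of $\mathcal V([\mathcal C])$ is $[\mathcal C]$. The carriers of $(\bar\pi,\ell_\infty)$ on $\ell_\infty$ (the points of $\ell_\infty$ fixed by every element of $\mathrm{PGL}(3,q^3)$ fixing $\bar\pi$ and $\ell_\infty$) are exactly two distinct points $\bar E,\bar E^{\mathsf c}$, and either $\mathcal V([\mathcal C])$ is a $6$-dim nrc (and its extensions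 to $\mathbb F_{q^3}$, $\mathbb F_{q^6}$ are the extended nrc), or $\mathcal V([\mathcal C])$ is a $3$-dim nrc and $\mathcal V([\mathcal C])^{*}$ (and likewise $\mathcal V([\mathcal C])^{**}$) consists of the extended $3$-dim nrc and three distinct (extended) T-lines of $\Sigma_\infty^{*}$. The second case occurs if and only if $\bar{\mathcal C}^{+}\cap\ell_\infty=\{\bar E,\bar E^{\mathsf c}\}$, and the first if and only if $\bar{\mathcal C}^{+}\cap\ell_\infty\neq\{\bar E,\bar E^{\mathsf c}\}$. More precisely: 1. If $\bar{\mathcal C}^{+}\cap\ell_\infty=\{\bar E,\bar E^{\mathsf c}\}$, then $\mathcal V([\mathcal C])$ is a $3$-dim nrc $\mathcal N_3$, and $\mathcal V([\mathcal C])^{*}\cap\Sigma_\infty^{*}$ is the union of the three T-lines $h=E\,(E^{\mathsf c})^{q^2}$, $h^q$, $h^{q^2}$, which are the three lines above. Further $\mathcal N_3^{*}\cap\Sigma_\infty^{*}=\{R,R^q,R^{q^2}\}$ (each point counted once) for some $R\in h$, and $R$ lies in no extended plane of the spread $\mathbb S\cap\Sigma_\infty$. 2. If $\bar{\mathcal C}^{+}\cap\ell_\infty\ne\{\bar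 E,\bar E^{\mathsf c}\}$, then $\mathcal V([\mathcal C])$ is a $6$-dim nrc $\mathcal N_6$. Further $\bar{\mathcal C}^{++}\cap\ell_\infty^{++}=\{\bar P,\bar Q\}$ for some points $\bar P,\bar Q$, possibly equal, neither of which is $\bar E$ or $\bar E^{\mathsf c}$, and $\mathcal N_6^{**}$ meets $\Sigma_\infty^{**}$, counted with multiplicity, in the six points $P,P^q,P^{q^2},Q,Q^q,Q^{q^2}$, where $P,Q\in g^{**}$ correspond to $\bar P,\bar Q$. Either $P,Q\in g$, or $P,Q\in g^{**}\setminus g$ and $Q=P^{q^3}$. -/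

import Mathlib

namespace BruckBose

noncomputable section

/-! ### Projective spaces, extension of scalars and conjugation -/

/-- Coordinate vectors of `PG(n,F)`. -/
abbrev Vec (n : ℕ) (F : Type*) : Type _ := Fin (n + 1) → F

/-- The projective space `PG(n,F)`. -/
abbrev PG (n : ℕ) (F : Type*) [Field F] : Type _ := Projectivization F (Vec n F)

/-- A field homomorphism applied to every coordinate of a vector. -/
def coordMap {F F' : Type*} [Field F] [Field F'] {n : ℕ} (σ : F →+* F') :
    Vec n F →ₛₗ[σ] Vec n F' where
  toFun v i := σ (v i)
  map_add' v w := by ext i; simp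
  map_smul' a v := by ext i; simp

theorem coordMap_injective {F F' : Type*} [Field F] [Field F'] {n : ℕ} (σ : F →+* F') :
    Function.Injective (coordMap (n := n) σ) := by
  intro v w h
  ext i
  exact σ.injective (congrFun h i)

/-- A field homomorphism applied to the coordinates of a point. -/
def ptMap {F F' : Type*} [Field F] [Field F'] {n : ℕ} (σ : F →+* F') : PG n F → PG n F' :=
  Projectivization.map (coordMap σ) (coordMap_injective σ)

/-- The subspace spanned by the images of the points of `W` under a field homomorphism. -/
def subMap {F F' : Type*} [Field F] [Field F'] {n : ℕ} (σ : F →+* F')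
    (W : Submodule F (Vec n F)) : Submodule F' (Vec n F') :=
  Submodule.span F' (coordMap σ '' (W : Set (Vec n F)))

/-- The set of points of a linear subspace. -/
def pts {F : Type*} [Field F] {n : ℕ} (W : Submodule F (Vec n F)) : Set (PG n F) :=
  {P | P.submodule ≤ W}

/-- The automorphism `x ↦ x ^ q` of an extension field `F` of `k = 𝔽_q`. -/
def frob (k F : Type*) [Field k] [Fintype k] [Field F] [Algebra k F] : F →+* F :=
  (FiniteField.frobeniusAlgHom k F).toRingHom

/-- The map `X ↦ X^q` on points of `PG(n,F)`. -/
def conjPt (k : Type*) {F : Type*} [Field k] [Fintype k] [Field F] [Algebra k F] {n : ℕ} :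
    PG n F → PG n F :=
  ptMap (frob k F)

/-- The map `W ↦ W^q` on subspaces of `PG(n,F)`. -/
def conj (k : Type*) {F : Type*} [Field k] [Fintype k] [Field F] [Algebra k F] {n : ℕ}
    (W : Submodule F (Vec n F)) : Submodule F (Vec n F) :=
  subMap (frob k F) W

/-- A point of `PG(n,F)` regarded as a point of `PG(n,F')`. -/
def extPt {F : Type*} (F' : Type*) [Field F] [Field F'] [Algebra F F'] {n : ℕ} :
    PG n F → PG n F' :=
  ptMap (algebraMap F F')

/-- The extension of a subspace of `PG(n,F)` to `PG(n,F')`. -/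
def ext {F : Type*} (F' : Type*) [Field F] [Field F'] [Algebra F F'] {n : ℕ}
    (W : Submodule F (Vec n F)) : Submodule F' (Vec n F') :=
  subMap (algebraMap F F') W

/-- The subspace of `PG(n,F)` formed by the `F`-rational points of a subspace of `PG(n,F')`. -/
def rat (F : Type*) {F' : Type*} [Field F] [Field F'] [Algebra F F'] {n : ℕ}
    (W : Submodule F' (Vec n F')) : Submodule F (Vec n F) where
  carrier := {v | coordMap (algebraMap F F') v ∈ W}
  add_mem' {v w} hv hw := by
    simp only [Set.mem_ofPred_eq, map_add] at *
    exact W.add_mem hv hw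
  zero_mem' := by simp
  smul_mem' a v hv := by
    simp only [Set.mem_ofPred_eq, map_smulₛₗ] at *
    exact W.smul_mem _ hv

/-- The `F'`-linear map with the same matrix as the `F`-linear map `T`. -/
def extLin {F : Type*} (F' : Type*) [Field F] [Field F'] [Algebra F F'] {m n : ℕ}
    (T : Vec m F →ₗ[F] Vec n F) : Vec m F' →ₗ[F'] Vec n F' :=
  Matrix.toLin' ((LinearMap.toMatrix' T).map (algebraMap F F'))

theorem extLin_injective {F : Type*} (F' : Type*) [Field F] [Field F'] [Algebra F F'] {m n : ℕ}
    (T : Vec m F →ₗ[F] Vec n F) (hT : Function.Injective T) :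
    Function.Injective (extLin F' T) := by
  obtain ⟨S, hS⟩ := T.exists_leftInverse_of_injective (LinearMap.ker_eq_bot.mpr hT)
  have h : (extLin F' S).comp (extLin F' T) = LinearMap.id := by
    unfold extLin
    rw [← Matrix.toLin'_mul, ← Matrix.map_mul, ← LinearMap.toMatrix'_comp, hS,
      LinearMap.toMatrix'_id, Matrix.map_one _ (map_zero _) (map_one _), Matrix.toLin'_one]
  exact Function.LeftInverse.injective (g := extLin F' S) fun v => LinearMap.congr_fun h v

/-! ### Varieties -/

/-- The points of `PG(n,F)` satisfying a set of homogeneous equations over `k`.  For `F = k` this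
is the variety itself; for a larger field `F` it is its variety-extension. -/
def locus {k : Type*} (F : Type*) [Field k] [Field F] [Algebra k F] {n : ℕ}
    (S : Set (MvPolynomial (Fin (n + 1)) k)) : Set (PG n F) :=
  {P | ∀ f ∈ S, MvPolynomial.aeval P.rep f = 0}

/-- A linear functional as a linear form in the coordinates. -/
def linForm {F : Type*} [Field F] {n : ℕ} (φ : Vec n F →ₗ[F] F) :
    MvPolynomial (Fin (n + 1)) F :=
  ∑ a, MvPolynomial.C (φ (Pi.single a 1)) * MvPolynomial.X a

/-- A `k`-linear functional of `K` applied to the coefficients of a polynomial.  If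
`P = ∑ b_i P_i` for a basis `b_i` of `K` over `k`, with dual basis `τ_i`, then
`descend τ_i P = P_i`; a point of `PG(n,k)` satisfies `P = 0` if and only if it satisfies all
equations `P_i = 0`. -/
def descend {k K : Type*} [Field k] [Field K] [Algebra k K] {n : ℕ} (τ : K →ₗ[k] k)
    (P : MvPolynomial (Fin (n + 1)) K) : MvPolynomial (Fin (n + 1)) k :=
  ∑ m ∈ P.support, MvPolynomial.monomial m (τ (P.coeff m))

/-! ### Subplanes, conics and carriers in `PG(2,K)` -/

/-- A linear bijection acting on points. -/
def ptLin {F : Type*} [Field F] {n : ℕ} (T : Vec n F ≃ₗ[F] Vec n F) : PG n F → PG n F :=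
  Projectivization.map T.toLinearMap T.injective

/-- The `𝔽_q`-subplane of `PG(2,K)` which is the image of `PG(2,k)` under `M`. -/
def subplane (k : Type*) {K : Type*} [Field k] [Field K] [Algebra k K]
    (M : Vec 2 K ≃ₗ[K] Vec 2 K) : Set (PG 2 K) :=
  Set.range fun x : PG 2 k => ptLin M (extPt K x)

/-- The collineation `X ↦ B X^q`, with `B = M (M^(q))⁻¹`, which fixes the subplane
`subplane k M` pointwise. -/
def planeConj (k : Type*) {K : Type*} [Field k] [Fintype k] [Field K] [Algebra k K]
    (M : Vec 2 K ≃ₗ[K] Vec 2 K) : PG 2 K → PG 2 K :=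
  fun X => ptLin M (conjPt k (ptLin M.symm X))

/-- `f` is a non-degenerate ternary quadratic form: the curve `f = 0` has no singular point over
the algebraic closure. -/
def IsNondegenerateConic {k : Type*} [Field k] (f : MvPolynomial (Fin 3) k) : Prop :=
  f.IsHomogeneous 2 ∧ ∀ v : Vec 2 (AlgebraicClosure k), v ≠ 0 → MvPolynomial.aeval v f = 0 →
    ∃ i, MvPolynomial.aeval v (MvPolynomial.pderiv i f) ≠ 0

/-- The `𝔽_q`-conic of `subplane k M` with equation `f = 0` in the coordinates of the subplane. -/
def fqConic {k K : Type*} [Field k] [Field K] [Algebra k K] (M : Vec 2 K ≃ₗ[K] Vec 2 K)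
    (f : MvPolynomial (Fin 3) k) : Set (PG 2 K) :=
  (fun x : PG 2 k => ptLin M (extPt K x)) '' locus k {f}

/-- The equation over `K` of the conic `f = 0`, in the coordinates of `PG(2,K)`. -/
def conicEq {k K : Type*} [Field k] [Field K] [Algebra k K] (M : Vec 2 K ≃ₗ[K] Vec 2 K)
    (f : MvPolynomial (Fin 3) k) : MvPolynomial (Fin 3) K :=
  MvPolynomial.aeval
    (fun i : Fin 3 => linForm ((LinearMap.proj i : Vec 2 K →ₗ[K] K) ∘ₗ M.symm.toLinearMap)) f

/-- The conic of `PG(2,F)`, for `F ⊇ K`, which extends `fqConic M f`. -/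
def conicExt {k K : Type*} (F : Type*) [Field k] [Field K] [Field F] [Algebra k K] [Algebra K F]
    (M : Vec 2 K ≃ₗ[K] Vec 2 K) (f : MvPolynomial (Fin 3) k) : Set (PG 2 F) :=
  locus F {conicEq M f}

/-- The carriers of a subplane `π` and a line `ℓ`: the points fixed by every element of
`PGL(3,K)` that fixes `π` and `ℓ`. -/
def IsCarrier {K : Type*} [Field K] (π : Set (PG 2 K)) (ℓ : Submodule K (Vec 2 K))
    (P : PG 2 K) : Prop :=
  ∀ T : Vec 2 K ≃ₗ[K] Vec 2 K, ptLin T '' π = π → ℓ.map T.toLinearMap = ℓ → ptLin T P = P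

/-! ### The Bose representation -/

/-- The regular 2-spread of `PG(8,k)` with transversal planes `Γ`, `Γ^q`, `Γ^(q^2)`, together with
an identification of `PG(2,K)` with `Γ`. -/
structure Bose (k K : Type*) [Field k] [Fintype k] [Field K] [Algebra k K] where
  Γ : Submodule K (Vec 8 K)
  coord : Vec 2 K ≃ₗ[K] Γ
  spans : Γ ⊔ conj k Γ ⊔ conj k (conj k Γ) = ⊤

theorem finrank_subMap_le {F F' : Type*} [Field F] [Field F'] {n : ℕ} (σ : F →+* F')
    (W : Submodule F (Vec n F)) :
    Module.finrank F' (subMap σ W) ≤ Module.finrank F W := by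
  let b := Module.finBasis F W
  have h : subMap σ W ≤ Submodule.span F' (Set.range fun i => coordMap σ (b i : Vec n F)) := by
    refine Submodule.span_le.mpr ?_
    rintro _ ⟨w, hw, rfl⟩
    have hs : w = ∑ i, b.repr ⟨w, hw⟩ i • (b i : Vec n F) := by
      have := congrArg Subtype.val (b.sum_repr ⟨w, hw⟩).symm
      rw [AddSubmonoidClass.coe_finsetSum] at this
      exact this
    rw [hs, map_sum]
    refine Submodule.sum_mem _ fun i _ => ?_
    rw [map_smulₛₗ]
    exact Submodule.smul_mem _ _ (Submodule.subset_span ⟨i, rfl⟩)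
  refine (Submodule.finrank_mono h).trans ?_
  refine (finrank_range_le_card (R := F') fun i => coordMap σ (b i : Vec n F)).trans ?_
  simp

theorem Bose.isCompl {k K : Type*} [Field k] [Fintype k] [Field K] [Algebra k K]
    (m : Bose k K) : IsCompl m.Γ (conj k m.Γ ⊔ conj k (conj k m.Γ)) := by
  have hs : m.Γ ⊔ (conj k m.Γ ⊔ conj k (conj k m.Γ)) = ⊤ := by
    rw [← sup_assoc]; exact m.spans
  have h0 : Module.finrank K m.Γ = 3 := by
    rw [← m.coord.finrank_eq]; simp
  have h1 : Module.finrank K (conj k m.Γ) ≤ 3 := h0 ▸ finrank_subMap_le _ _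
  have h2 : Module.finrank K (conj k (conj k m.Γ)) ≤ 3 := (finrank_subMap_le _ _).trans h1
  have h3 := Submodule.finrank_add_le_finrank_add_finrank (conj k m.Γ) (conj k (conj k m.Γ))
  have h4 := Submodule.finrank_sup_add_finrank_inf_eq m.Γ (conj k m.Γ ⊔ conj k (conj k m.Γ))
  rw [hs, finrank_top, Module.finrank_fin_fun] at h4
  refine ⟨disjoint_iff.mpr ?_, codisjoint_iff.mpr hs⟩
  exact Submodule.finrank_eq_zero.mp (by omega)

section

variable {k K : Type*} [Field k] [Fintype k] [Field K] [Algebra k K] (m : Bose k K)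

/-- The identification of the plane `PG(2,K)` with `Γ`, as a map into the ambient space. -/
def Bose.toVec : Vec 2 K →ₗ[K] Vec 8 K := m.Γ.subtype ∘ₗ m.coord.toLinearMap

theorem Bose.toVec_injective : Function.Injective m.toVec :=
  m.Γ.injective_subtype.comp m.coord.injective

/-- The point of `Γ`, extended to `F ⊇ K`, that corresponds to a point of `PG(2,F)`. -/
def Bose.toΓ {F : Type*} [Field F] [Algebra K F] : PG 2 F → PG 8 F :=
  Projectivization.map (extLin F m.toVec) (extLin_injective F _ m.toVec_injective)

/-- The transversal planes `Γ`, `Γ^q`, `Γ^(q^2)`. -/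
def Bose.transversal (i : Fin 3) : Submodule K (Vec 8 K) := (conj k)^[(i : ℕ)] m.Γ

/-- The plane `⟨X, X^q, X^(q^2)⟩ ∩ PG(8,k)` of the spread that represents a point of `PG(2,K)`. -/
def Bose.plane (X : PG 2 K) : Submodule k (Vec 8 k) :=
  rat k ((m.toΓ X).submodule ⊔ (conjPt k (m.toΓ X)).submodule ⊔
    (conjPt k (conjPt k (m.toΓ X))).submodule)

/-- The coordinates in `PG(2,K)` of the component in `Γ` of a vector, with respect to the
decomposition of the space into `Γ`, `Γ^q` and `Γ^(q^2)`. -/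
def Bose.component : Vec 8 K →ₗ[K] Vec 2 K :=
  m.coord.symm.toLinearMap ∘ₗ m.Γ.projectionOnto _ m.isCompl

/-- The linear form giving the `i`-th coordinate, in the frame `M`, of the component in `Γ`. -/
def Bose.form (M : Vec 2 K ≃ₗ[K] Vec 2 K) (i : Fin 3) : MvPolynomial (Fin 9) K :=
  linForm (n := 8) ((LinearMap.proj i : Vec 2 K →ₗ[K] K) ∘ₗ M.symm.toLinearMap ∘ₗ m.component)

/-- The conjugate linear form (all coefficients are raised to the power `q`). -/
def Bose.formConj (M : Vec 2 K ≃ₗ[K] Vec 2 K) (i : Fin 3) : MvPolynomial (Fin 9) K :=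
  MvPolynomial.map (frob k K) (m.form M i)

/-- The quadrics of `PG(8,k)` whose intersection is the set of points on the spread planes that
represent the points of `fqConic M f`.  With `y` the coordinates in the frame `M` of the point of
`PG(2,K)` whose spread plane contains a given point of `PG(8,k)`, they are the `𝔽_q`-components of
`y_i y_j^q = y_j y_i^q` (the point is in the subplane) and of `f(y) = 0`. -/
def Bose.conicQuadrics (M : Vec 2 K ≃ₗ[K] Vec 2 K) (f : MvPolynomial (Fin 3) k) :
    Set (MvPolynomial (Fin 9) k) :=
  {Q | ∃ τ : K →ₗ[k] k,
    (∃ i j, Q = descend (n := 8) τ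
      (m.form M i * m.formConj M j - m.form M j * m.formConj M i)) ∨
    Q = descend (n := 8) τ (MvPolynomial.aeval (m.form M) f)}

/-! ### The Bruck-Bose representation inside the Bose representation -/

/-- The hyperplane at infinity `⟨g, g^q, g^(q^2)⟩ ∩ PG(8,k)`, where `g` is the line of `Γ`
corresponding to the line `ℓ` of `PG(2,K)`. -/
def Bose.infinity (ℓ : Submodule K (Vec 2 K)) : Submodule k (Vec 8 k) :=
  rat k (ℓ.map m.toVec ⊔ conj k (ℓ.map m.toVec) ⊔ conj k (conj k (ℓ.map m.toVec)))

/-- The exact-at-infinity Bruck-Bose representation, in the 6-space `S6`, of a set of points. -/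
def Bose.bruckBose (S6 : Submodule k (Vec 8 k)) (C : Set (PG 2 K)) : Set (PG 8 k) :=
  {P | ∃ X ∈ C, P ∈ pts (m.plane X ⊓ S6)}

/-- The points over `F` of the variety in the 6-space `S6` that represents `fqConic M f`, that is,
of the section by `S6` of the variety of spread planes representing the points of the conic. -/
def Bose.conicVariety (S6 : Submodule k (Vec 8 k)) (M : Vec 2 K ≃ₗ[K] Vec 2 K)
    (f : MvPolynomial (Fin 3) k) (F : Type*) [Field F] [Algebra k F] : Set (PG 8 F) :=
  locus (n := 8) F (m.conicQuadrics M f) ∩ pts (ext F S6)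

/-- A T-line of the extended hyperplane at infinity: a line meeting two of its transversal lines
`g`, `g^q`, `g^(q^2)`. -/
def Bose.IsTLine (ℓ : Submodule K (Vec 2 K)) (h : Submodule K (Vec 8 K)) : Prop :=
  Module.finrank K h = 2 ∧ h ≤ ext K (m.infinity ℓ) ∧ ∃ i j : Fin 3, i ≠ j ∧
    ¬ Disjoint h ((conj k)^[(i : ℕ)] (ℓ.map m.toVec)) ∧
    ¬ Disjoint h ((conj k)^[(j : ℕ)] (ℓ.map m.toVec))

/-- The line joining the points `X` of `Γ` and `Y^(q^2)` of `Γ^(q^2)`. -/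
def Bose.joinLine (X Y : PG 2 K) : Submodule K (Vec 8 K) :=
  (m.toΓ X).submodule ⊔ (conjPt k (conjPt k (m.toΓ Y))).submodule

end

/-! ### Normal rational curves -/

/-- The vector `(s^r, s^(r-1) t, …, t^r)`. -/
def veronese {F : Type*} [Field F] (r : ℕ) (s t : F) : Vec r F :=
  fun i => s ^ (r - (i : ℕ)) * t ^ (i : ℕ)

/-- The points over `F` of the normal rational curve which is the image under `A` of the standard
curve `{(1, θ, …, θ^r)} ∪ {(0, …, 0, 1)}` of `PG(r,k)`.  For injective `A` and `F = k` this is an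
`r`-dimensional normal rational curve; for larger `F` it is its extension. -/
def nrc {k : Type*} (F : Type*) [Field k] [Field F] [Algebra k F] {r n : ℕ}
    (A : Vec r k →ₗ[k] Vec n k) : Set (PG n F) :=
  {P | ∃ s t : F, (s ≠ 0 ∨ t ≠ 0) ∧
    P.submodule = Submodule.span F {extLin F A (veronese r s t)}}

/-- Over `F`, the `r`-dimensional normal rational curve `nrc F A` in the space `S` meets the
hyperplane `H` of `S` in the points `p 0, …, p (r-1)`, counted with multiplicity: the pullback to
the curve of an equation of `H` is the product of the linear factors vanishing at the parameters
of these points. -/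
def MeetsIn {k : Type*} (F : Type*) [Field k] [Field F] [Algebra k F] {r n : ℕ}
    (A : Vec r k →ₗ[k] Vec n k) (S H : Submodule k (Vec n k)) (p : Fin r → PG n F) : Prop :=
  ∃ a b : Fin r → F,
    (∀ j, (a j ≠ 0 ∨ b j ≠ 0) ∧
      (p j).submodule = Submodule.span F {extLin F A (veronese r (a j) (b j))}) ∧
    ∃ φ : Vec n F →ₗ[F] F, ext F S ⊓ LinearMap.ker φ = ext F H ∧
      ∃ c : F, c ≠ 0 ∧ ∀ s t : F,
        φ (extLin F A (veronese r s t)) = c * ∏ j, (s * b j - t * a j)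

/-! ### The two types of curves -/

section

variable {k K : Type*} [Field k] [Fintype k] [Field K] [Algebra k K] (m : Bose k K)

/-- `A` exhibits the variety representing the conic as an `r`-dimensional normal rational curve
without further components, over `k` and over the extensions `K` and `L`. -/
def Bose.IsNRC (L : Type*) [Field L] [Algebra k L] (S6 : Submodule k (Vec 8 k))
    (M : Vec 2 K ≃ₗ[K] Vec 2 K) (f : MvPolynomial (Fin 3) k) {r : ℕ}
    (A : Vec r k →ₗ[k] Vec 8 k) : Prop :=
  Function.Injective A ∧ m.conicVariety S6 M f k = nrc k A ∧
    m.conicVariety S6 M f K = nrc K A ∧ m.conicVariety S6 M f L = nrc L A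

/-- `A` exhibits the variety representing the conic as an `r`-dimensional normal rational curve
over `k`, whose extension to `K` (and `L`) consists of the extended curve and the (extended)
three distinct lines `h₁`, `h₂`, `h₃`. -/
def Bose.IsNRCWithLines (L : Type*) [Field L] [Algebra k L] [Algebra K L]
    (S6 : Submodule k (Vec 8 k)) (M : Vec 2 K ≃ₗ[K] Vec 2 K) (f : MvPolynomial (Fin 3) k) {r : ℕ}
    (A : Vec r k →ₗ[k] Vec 8 k) (h₁ h₂ h₃ : Submodule K (Vec 8 K)) : Prop :=
  Function.Injective A ∧ h₁ ≠ h₂ ∧ h₂ ≠ h₃ ∧ h₁ ≠ h₃ ∧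
    m.conicVariety S6 M f k = nrc k A ∧
    m.conicVariety S6 M f K = nrc K A ∪ (pts h₁ ∪ pts h₂ ∪ pts h₃) ∧
    m.conicVariety S6 M f L =
      nrc L A ∪ (pts (ext L h₁) ∪ pts (ext L h₂) ∪ pts (ext L h₃))

end

end

end BruckBose

/-! Write `K` for the cubic extension of `k`. Over a field `F` containing `K`, a vector of the
9-dimensional space is a triple of components `Y_0, Y_1, Y_2` in the three transversal planes. The
components over `k` of an equation vanish exactly when its three conjugates vanish
(`forall_aeval_descend_iff`: trace form and independence of embeddings). So the quadrics say that
the `Y_j` are pairwise proportional and that each satisfies the conic equation. In a frame where the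
conic is `x z = y²` (`exists_conic_normal_form`) this means `Y_j = α_j (s², st, t²)` with one common
parameter `(s, t)`. If the equation `a · u = 0` of the line at infinity is scaled to take values in
`k` on the 6-space, the section by the 6-space is the condition that `α_j Q_j(s, t)` does not depend
on `j`, where `Q_j` is the binary quadratic form cut out on the conic by the `j`-th conjugate of the
line (`Bose.IsLineEq.mem_conicVariety_iff`).

The dichotomy is whether the `Q_j` have common zeros. The resultant of `Q_0` and `Q_1` is, up to
sign, the conic equation at the intersection of the two lines. The line is exterior to the subplane,
so its three conjugates form a triangle, and the two vertices on the line itself are the carriers.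
Maps diagonal in this triangle with conjugate eigenvalues preserve the subplane and fix no other
point of the line. Conversely, a map preserving subplane and line commutes with Frobenius up to a
scalar, so it preserves all three sides.

If the resultant is non-zero, at most one `Q_j` vanishes at any parameter, and the condition forces
`α_j` to be proportional to `Q_{j+1} Q_{j+2}`. The variety is then the curve `Q_{j+1} Q_{j+2} (s²,
st, t²)` of degree six (`Bose.IsLineEq.conicVariety_eq_sextic`); two rounds of Sylvester elimination
show that it spans a 6-space (`sextic_eq_zero`). On it the equation of infinity is `Q_0 Q_1 Q_2`,
and at a zero of `Q_0` only the component in `Γ` survives.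

If the resultant is zero, the vertices lie on the conic and `Q_j = d_j L_{j+1} L_{j+2}` with
conjugate linear forms `L_j`. Where no `L_j` vanishes, `α_j` is proportional to `d_{j+1} d_{j+2}
L_j`, which gives a cubic. At a zero of `L_i` only `α_i = 0` is forced, so the other two
coefficients are free and sweep out a T-line (`Bose.IsLineEq.conicVariety_eq_cubic`). The two cases
exclude each other because a 6-dimensional normal rational curve contains no line. -/

namespace BruckBose

noncomputable section

set_option linter.unusedSectionVars false

/-! ### Conjugate embeddings of a cubic extension of a finite field -/

section Embeddings

variable (k K F : Type*) [Field k] [Fintype k] [Field K] [Field F]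
  [Algebra k K] [Algebra k F] [Algebra K F]

/-- The embedding `x ↦ x ^ (q ^ j)` of `K` into an extension field `F`. -/
def conjEmb (j : ℕ) : K →+* F := (algebraMap K F).comp (frob k K ^ j)

variable {k K F}

theorem frob_apply (x : F) : frob k F x = x ^ Fintype.card k := rfl

theorem frob_algebraMap (x : k) : frob k F (algebraMap k F x) = algebraMap k F x :=
  (FiniteField.frobeniusAlgHom k F).commutes x

theorem frob_pow_algebraMap (j : ℕ) (x : k) :
    (frob k F ^ j) (algebraMap k F x) = algebraMap k F x := by
  induction j with
  | zero => rfl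
  | succ j ih => rw [pow_succ, RingHom.mul_def, RingHom.comp_apply, frob_algebraMap, ih]

theorem frob_pow_apply (j : ℕ) (x : F) : (frob k F ^ j) x = x ^ (Fintype.card k ^ j) := by
  induction j with
  | zero => simp
  | succ j ih =>
    rw [pow_succ', RingHom.mul_def, RingHom.comp_apply, ih, frob_apply, ← pow_mul, pow_succ]

theorem conjEmb_apply (j : ℕ) (x : K) :
    conjEmb k K F j x = algebraMap K F ((frob k K ^ j) x) := rfl

theorem frob_conjEmb (j : ℕ) (x : K) :
    frob k F (conjEmb k K F j x) = conjEmb k K F (j + 1) x := by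
  rw [conjEmb_apply, conjEmb_apply, frob_apply, frob_pow_apply, frob_pow_apply, ← map_pow,
    ← pow_mul, pow_succ]

theorem conjEmb_frob (j : ℕ) (x : K) :
    conjEmb k K F j (frob k K x) = conjEmb k K F (j + 1) x := rfl

theorem conjEmb_frob_pow (i j : ℕ) (x : K) :
    conjEmb k K F j ((frob k K ^ i) x) = conjEmb k K F (j + i) x := by
  rw [conjEmb_apply, conjEmb_apply, pow_add]; rfl

theorem conjEmb_algebraMap [IsScalarTower k K F] (j : ℕ) (x : k) :
    conjEmb k K F j (algebraMap k K x) = algebraMap k F x := by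
  rw [conjEmb_apply, frob_pow_algebraMap, ← IsScalarTower.algebraMap_apply]

theorem conjEmb_self (j : ℕ) : conjEmb k K K j = frob k K ^ j := rfl

theorem finite_of_finrank {k K : Type*} [Field k] [Finite k] [Field K] [Algebra k K] {n : ℕ}
    (hn : n ≠ 0) (h : Module.finrank k K = n) : Finite K :=
  have := Module.finite_of_finrank_pos (R := k) (M := K) (by omega)
  Module.finite_of_finite k

theorem frob_pow_eq (f : ℕ) : frob k F ^ f = (FiniteField.frobeniusAlgHom k F ^ f).toRingHom := by
  ext x
  rw [frob_pow_apply]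
  simp [AlgHom.coe_pow, FiniteField.coe_frobeniusAlgHom, pow_iterate]

theorem frob_pow_finrank [Finite F] (x : F) : (frob k F ^ Module.finrank k F) x = x := by
  have := Module.Finite.of_finite (R := k) (M := F)
  rw [frob_pow_eq, ← FiniteField.orderOf_frobeniusAlgHom, pow_orderOf_eq_one]; rfl

theorem frob_pow_three (hK : Module.finrank k K = 3) (x : K) : (frob k K ^ 3) x = x := by
  have := finite_of_finrank (by norm_num) hK
  rw [← hK, frob_pow_finrank]

theorem frob_bijective [Finite F] : Function.Bijective (frob k F) :=
  Finite.injective_iff_bijective.mp (frob k F).injective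

theorem conjEmb_add_three (hK : Module.finrank k K = 3) (j : ℕ) :
    conjEmb k K F (j + 3) = conjEmb k K F j := by
  ext x
  rw [← conjEmb_frob_pow, frob_pow_three hK]

/-- The first three powers of Frobenius are the three distinct elements of the Galois group of `K`
over `k`. -/
theorem conjEmb_injOn (hK : Module.finrank k K = 3) :
    Function.Injective fun j : Fin 3 => conjEmb k K F j := by
  have := finite_of_finrank (by norm_num) hK
  have := Module.Finite.of_finite (R := k) (M := K)
  intro i j hij
  have h : Function.Injective fun n : Fin (Module.finrank k K) =>
      FiniteField.frobeniusAlgHom k K ^ n.1 := (FiniteField.bijective_frobeniusAlgHom_pow k K).1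
  have h' : FiniteField.frobeniusAlgHom k K ^ (i : ℕ) = FiniteField.frobeniusAlgHom k K ^ (j : ℕ) := by
    ext x
    have := RingHom.congr_fun hij x
    simp only [conjEmb_apply] at this
    have := (algebraMap K F).injective this
    rw [frob_pow_eq, frob_pow_eq] at this
    exact this
  have h3 := @h ⟨i, by omega⟩ ⟨j, by omega⟩ h'
  exact Fin.ext (by simpa using h3)

/-- Independence of the three conjugate embeddings. -/
theorem conjEmb_independent (hK : Module.finrank k K = 3) (z : Fin 3 → F)
    (h : ∀ b : K, ∑ j, z j * conjEmb k K F j b = 0) : z = 0 := by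
  have hli := (linearIndependent_monoidHom K F).comp
    (fun j : Fin 3 => (conjEmb k K F j : K →* F)) (by
      intro i j hij
      exact conjEmb_injOn hK (RingHom.ext fun x => DFunLike.congr_fun hij x))
  rw [Fintype.linearIndependent_iff] at hli
  ext j
  refine hli z ?_ j
  ext b
  simpa using h b

/-- Frobenius generates the Galois group, so an element fixed by it is fixed by the whole group and
lies in the base field. -/
theorem exists_algebraMap_of_frob [Finite F] {x : F} (h : frob k F x = x) :
    ∃ a, algebraMap k F a = x := by
  have := Module.Finite.of_finite (R := k) (M := F)
  have hx : x ∈ (⊥ : IntermediateField k F) := by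
    rw [IsGalois.mem_bot_iff_fixed]
    intro g
    obtain ⟨n, hn⟩ := (FiniteField.bijective_frobeniusAlgHom_pow k F).2 g.toAlgHom
    have h1 : (frob k F ^ (n : ℕ)) x = x := by
      generalize (n : ℕ) = n
      induction n with
      | zero => rfl
      | succ n ih => rw [pow_succ, RingHom.mul_def, RingHom.comp_apply, h, ih]
    rw [frob_pow_eq] at h1
    have h2 := AlgHom.congr_fun hn x
    exact h2.symm.trans h1
  exact IntermediateField.mem_bot.mp hx

/-- A linear functional of `K` over `k` in terms of the conjugate embeddings. -/
theorem exists_trace_repr [IsScalarTower k K F] (hK : Module.finrank k K = 3) (τ : K →ₗ[k] k) :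
    ∃ b : K, ∀ x, algebraMap k F (τ x) = ∑ j : Fin 3, conjEmb k K F j (b * x) := by
  have := finite_of_finrank (by norm_num) hK
  have := Module.Finite.of_finite (R := k) (M := K)
  -- The trace form is non-degenerate, so `τ` is `x ↦ Tr(b x)`, and the trace is the sum of the
  -- three conjugates.
  obtain ⟨b, hb⟩ := ((Algebra.traceForm k K).toDual (traceForm_nondegenerate k K)).surjective τ
  refine ⟨b, fun x => ?_⟩
  rw [← hb, LinearMap.BilinForm.toDual_def, Algebra.traceForm_apply,
    IsScalarTower.algebraMap_apply k K F, FiniteField.algebraMap_trace_eq_sum_pow, hK, map_sum,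
    ← Fin.sum_univ_eq_sum_range (fun i => algebraMap K F ((b * x) ^ Nat.card k ^ i)) 3]
  refine Finset.sum_congr rfl fun j _ => ?_
  rw [conjEmb_apply, frob_pow_apply, Fintype.card_eq_nat_card]

/-- Here `τ` is `x ↦ Tr(b x)`. Letting `b` run through `K` gives enough functionals to separate the
three conjugates. -/
theorem exists_functional (b : K) [IsScalarTower k K F] (hK : Module.finrank k K = 3) :
    ∃ τ : K →ₗ[k] k, ∀ x, algebraMap k F (τ x) = ∑ j : Fin 3, conjEmb k K F j (b * x) := by
  have := finite_of_finrank (by norm_num) hK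
  have := Module.Finite.of_finite (R := k) (M := K)
  refine ⟨Algebra.traceForm k K b, fun x => ?_⟩
  rw [Algebra.traceForm_apply,
    IsScalarTower.algebraMap_apply k K F, FiniteField.algebraMap_trace_eq_sum_pow, hK, map_sum,
    ← Fin.sum_univ_eq_sum_range (fun i => algebraMap K F ((b * x) ^ Nat.card k ^ i)) 3]
  refine Finset.sum_congr rfl fun j _ => ?_
  rw [conjEmb_apply, frob_pow_apply, Fintype.card_eq_nat_card]

end Embeddings

/-! ### Binary quadratic forms -/

section Quadratics

/-- The binary quadratic form with coefficients `a`. -/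
def binQuad {F : Type*} [Field F] (a : Vec 2 F) (s t : F) : F :=
  a 0 * s ^ 2 + a 1 * (s * t) + a 2 * t ^ 2

/-- Sylvester elimination for two binary quadratic forms of non-zero resultant. -/
theorem sylvester_eq_zero {F : Type*} [Field F] {a b : Vec 2 F}
    (hr : (a 1 * b 2 - a 2 * b 1) * (a 0 * b 1 - a 1 * b 0) - (a 2 * b 0 - a 0 * b 2) ^ 2 ≠ 0)
    {w : ℕ → F}
    (h1 : a 0 * w 0 + a 1 * w 1 + a 2 * w 2 = 0) (h2 : a 0 * w 1 + a 1 * w 2 + a 2 * w 3 = 0)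
    (h3 : b 0 * w 0 + b 1 * w 1 + b 2 * w 2 = 0) (h4 : b 0 * w 1 + b 1 * w 2 + b 2 * w 3 = 0) :
    w 0 = 0 ∧ w 1 = 0 ∧ w 2 = 0 ∧ w 3 = 0 := by
  -- Up to sign the resultant is the determinant of the 4 by 4 Sylvester system, so by Cramer's rule
  -- its product with each unknown is a combination of the four equations.
  refine ⟨?_, ?_, ?_, ?_⟩ <;> refine (mul_eq_zero.mp ?_).resolve_left hr <;> grind

/-- A binary quadratic form over a finite field splits over the quadratic extension. -/
theorem exists_binQuad_factor {k K L : Type*} [Field k] [Fintype k] [Field K] [Field L]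
    [Algebra k K] [Algebra k L] [Algebra K L] [IsScalarTower k K L]
    (hK : Module.finrank k K = 3) (hL : Module.finrank K L = 2) {a : Vec 2 K} (ha : a ≠ 0) :
    ∃ c p₀ p₁ q₀ q₁ : L, c ≠ 0 ∧ (p₀ ≠ 0 ∨ p₁ ≠ 0) ∧ (q₀ ≠ 0 ∨ q₁ ≠ 0) ∧
      algebraMap K L (a 0) = c * (p₁ * q₁) ∧ algebraMap K L (a 1) = - (c * (p₁ * q₀ + p₀ * q₁)) ∧
      algebraMap K L (a 2) = c * (p₀ * q₀) ∧
      (((∃ x, algebraMap K L x = p₀) ∧ (∃ x, algebraMap K L x = p₁) ∧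
          (∃ x, algebraMap K L x = q₀) ∧ (∃ x, algebraMap K L x = q₁)) ∨
        (p₁ = 1 ∧ q₁ = 1 ∧ q₀ = (frob k L ^ 3) p₀ ∧ ∀ x, algebraMap K L x ≠ p₀)) := by
  have := finite_of_finrank (by norm_num) hK
  have := finite_of_finrank (by norm_num) hL
  have := Fintype.ofFinite K
  by_cases h0 : a 0 = 0
  -- The form is `t (a₁ s + a₂ t)`, with zeros `(1, 0)` and `(-a₂, a₁)`.
  · refine ⟨-1, 1, 0, -algebraMap K L (a 2), algebraMap K L (a 1), by simp, by simp, ?_,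
      by simp [h0], by simp, by simp, Or.inl ⟨⟨1, by simp⟩, ⟨0, by simp⟩, ⟨-a 2, by simp⟩,
        ⟨a 1, rfl⟩⟩⟩
    by_contra! h
    apply ha
    ext i
    fin_cases i
    · exact h0
    · simpa using h.2
    · simpa using h.1
  have h0' : algebraMap K L (a 0) ≠ 0 := by simpa using h0
  by_cases hr : ∃ x : K, a 0 * x ^ 2 + a 1 * x + a 2 = 0
  · obtain ⟨x, hx⟩ := hr
    -- The second zero comes from Vieta's formula and is again in `K`.
    refine ⟨algebraMap K L (a 0), algebraMap K L x, 1, algebraMap K L (- (a 1 / a 0) - x), 1, h0',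
      by simp, by simp, by simp, ?_, ?_, Or.inl ⟨⟨x, rfl⟩, ⟨1, by simp⟩, ⟨_, rfl⟩, ⟨1, by simp⟩⟩⟩
    · rw [← map_one (algebraMap K L)]
      simp only [← map_mul, ← map_neg, ← map_add]
      congr 1
      field_simp
      ring
    · simp only [← map_mul]
      congr 1
      field_simp
      linear_combination hx
  push Not at hr
  obtain ⟨x, hx⟩ : ∃ x : L, algebraMap K L (a 0) * x ^ 2 + algebraMap K L (a 1) * x +
      algebraMap K L (a 2) = 0 := by
    let g : Polynomial K := Polynomial.C (a 0) * Polynomial.X ^ 2 +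
      Polynomial.C (a 1) * Polynomial.X + Polynomial.C (a 2)
    have hg : g.natDegree = 2 := Polynomial.natDegree_quadratic h0
    have hirr : Irreducible g := by
      rw [Polynomial.irreducible_iff_roots_eq_zero_of_degree_le_three (by omega) (by omega)]
      rw [Multiset.eq_zero_iff_forall_notMem]
      intro x hx
      have := Polynomial.isRoot_of_mem_roots hx
      apply hr x
      simpa [g, Polynomial.IsRoot] using this
    have := Fact.mk hirr
    have hfr : Module.finrank K (AdjoinRoot g) = 2 := by
      rw [(AdjoinRoot.powerBasis hirr.ne_zero).finrank, AdjoinRoot.powerBasis_dim, hg]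
    have := finite_of_finrank (by norm_num) hfr
    -- Without a zero in `K` the quadratic is irreducible; its root field has degree 2 over `K`, as
    -- `L` has, and therefore embeds in `L`.
    obtain ⟨φ⟩ := FiniteField.nonempty_algHom_of_finrank_dvd (F := K) (K := AdjoinRoot g) (L := L)
      (by rw [hfr, hL])
    refine ⟨φ (AdjoinRoot.root g), ?_⟩
    have h1 : Polynomial.aeval (AdjoinRoot.root g) g = 0 := by
      rw [AdjoinRoot.aeval_eq, AdjoinRoot.mk_self]
    have h2 : Polynomial.aeval (φ (AdjoinRoot.root g)) g = 0 := by
      rw [Polynomial.aeval_algHom_apply, h1, map_zero]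
    generalize φ (AdjoinRoot.root g) = z at h2 ⊢
    simpa [g] using h2
  have hnr : ∀ y, algebraMap K L y ≠ x := by
    rintro y rfl
    apply hr y
    apply (algebraMap K L).injective
    simpa using hx
  set y := (frob k L ^ 3) x with hy
  have hcomm : ∀ z : K, (frob k L ^ 3) (algebraMap K L z) = algebraMap K L z := by
    intro z
    rw [frob_pow_apply, ← map_pow, ← frob_pow_apply, frob_pow_three hK]
  -- Since `K` has `q³` elements, the third power of Frobenius is the Frobenius of `L` over `K`, and
  -- it moves the root `x` because `x` is not in `K`.
  have hxy : y ≠ x := by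
    intro h
    have hcard : Fintype.card K = Fintype.card k ^ 3 := by
      rw [← hK, ← Module.card_eq_pow_finrank]
    have : frob K L x = x := by rw [frob_apply, hcard, ← frob_pow_apply]; exact h
    obtain ⟨z, hz⟩ := exists_algebraMap_of_frob this
    exact hnr z hz
  have hx' : algebraMap K L (a 0) * y ^ 2 + algebraMap K L (a 1) * y + algebraMap K L (a 2) = 0 := by
    have := congrArg (fun z => (frob k L ^ 3) z) hx
    simpa only [map_add, map_mul, map_pow, hcomm, map_zero] using this
  have hd : y - x ≠ 0 := sub_ne_zero.mpr hxy
  have hs : algebraMap K L (a 1) = - (algebraMap K L (a 0) * (y + x)) := by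
    apply mul_left_cancel₀ hd
    linear_combination hx' - hx
  refine ⟨algebraMap K L (a 0), x, 1, y, 1, h0', by simp, by simp, by simp, ?_, ?_,
    Or.inr ⟨rfl, rfl, hy, hnr⟩⟩
  · rw [hs]; ring
  · rw [hs] at hx; linear_combination hx

end Quadratics

/-! ### Coordinate vectors of points -/

section Representatives

variable {F F' : Type*} [Field F] [Field F'] {n r : ℕ}

/-- The vector `v` represents the point `P`. -/
def IsRep (P : PG n F) (v : Vec n F) : Prop := P.submodule = Submodule.span F {v}

theorem isRep_rep (P : PG n F) : IsRep P P.rep := P.submodule_eq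

theorem isRep_mk {v : Vec n F} (hv : v ≠ 0) : IsRep (Projectivization.mk F v hv) v :=
  Projectivization.submodule_mk v hv

theorem IsRep.ne_zero {P : PG n F} {v : Vec n F} (h : IsRep P v) : v ≠ 0 := by
  rintro rfl
  have := P.finrank_submodule
  rw [show P.submodule = _ from h, Submodule.span_zero_singleton, finrank_bot] at this
  exact zero_ne_one this

theorem IsRep.eq_mk {P : PG n F} {v : Vec n F} (h : IsRep P v) :
    P = Projectivization.mk F v h.ne_zero :=
  Projectivization.submodule_injective (h.trans (Projectivization.submodule_mk v h.ne_zero).symm)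

theorem IsRep.unique {P Q : PG n F} {v : Vec n F} (h : IsRep P v) (h' : IsRep Q v) : P = Q :=
  Projectivization.submodule_injective (h.trans h'.symm)

theorem IsRep.exists_smul {P : PG n F} {v w : Vec n F} (h : IsRep P v) (h' : IsRep P w) :
    ∃ c : F, c ≠ 0 ∧ v = c • w := by
  have : v ∈ Submodule.span F {w} := by
    rw [← h', h]; exact Submodule.mem_span_singleton_self v
  obtain ⟨c, hc⟩ := Submodule.mem_span_singleton.mp this
  refine ⟨c, ?_, hc.symm⟩
  rintro rfl
  exact h.ne_zero (by simpa using hc.symm)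

theorem IsRep.smul {P : PG n F} {v : Vec n F} (h : IsRep P v) {c : F} (hc : c ≠ 0) :
    IsRep P (c • v) :=
  h.trans (Submodule.span_singleton_smul_eq (IsUnit.mk0 c hc) v).symm

theorem IsRep.of_eq_smul {P : PG n F} {v w : Vec n F} (h : IsRep P v) {c : F}
    (hv : v = c • w) : IsRep P w := by
  have hc : c ≠ 0 := by
    rintro rfl
    exact h.ne_zero (by simpa using hv)
  have := h.smul (inv_ne_zero hc)
  rwa [hv, smul_smul, inv_mul_cancel₀ hc, one_smul] at this

theorem IsRep.mem_pts {P : PG n F} {v : Vec n F} (h : IsRep P v)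
    {W : Submodule F (Vec n F)} : P ∈ pts W ↔ v ∈ W := by
  change P.submodule ≤ W ↔ _
  rw [show P.submodule = _ from h, Submodule.span_singleton_le_iff_mem]

theorem mem_pts_iff {P : PG n F} {W : Submodule F (Vec n F)} : P ∈ pts W ↔ P.rep ∈ W :=
  (isRep_rep P).mem_pts

theorem IsRep.map {P : PG n F} {v : Vec n F} (h : IsRep P v) {m : ℕ} {σ : F →+* F'}
    (T : Vec n F →ₛₗ[σ] Vec m F') (hT : Function.Injective T) :
    IsRep (Projectivization.map T hT P) (T v) := by
  rw [h.eq_mk, Projectivization.map_mk]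
  exact isRep_mk _

theorem IsRep.ptMap {P : PG n F} {v : Vec n F} (h : IsRep P v) (σ : F →+* F') :
    IsRep (ptMap σ P) (coordMap σ v) := h.map _ _

theorem IsRep.ptLin {P : PG n F} {v : Vec n F} (h : IsRep P v) (T : Vec n F ≃ₗ[F] Vec n F) :
    IsRep (ptLin T P) (T v) := h.map _ _

theorem coordMap_apply (σ : F →+* F') (v : Vec n F) (i : Fin (n + 1)) :
    coordMap σ v i = σ (v i) := rfl

theorem coordMap_smul (σ : F →+* F') (a : F) (v : Vec n F) :
    coordMap σ (a • v) = σ a • coordMap σ v := map_smulₛₗ _ _ _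

/-- The factor between two proportional vectors with coordinates in `F` is a quotient of
coordinates, hence lies in `F`. -/
theorem isRep_extPt_iff [Algebra F F'] {P : PG n F} {v : Vec n F} :
    IsRep (extPt F' P) (coordMap (algebraMap F F') v) ↔ IsRep P v := by
  refine ⟨fun h => ?_, fun h => h.ptMap _⟩
  obtain ⟨c, hc, h1⟩ := h.exists_smul ((isRep_rep P).ptMap (algebraMap F F'))
  have hne := P.rep_nonzero
  obtain ⟨i, hi⟩ := Function.ne_iff.mp hne
  have hi : P.rep i ≠ 0 := hi
  have h2 := congrFun h1 i
  simp only [coordMap_apply, Pi.smul_apply, smul_eq_mul] at h2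
  have hc' : c = algebraMap F F' (v i / P.rep i) := by
    rw [map_div₀, h2, mul_div_assoc, div_self (by simpa using hi), mul_one]
  rw [hc', ← coordMap_smul] at h1
  have h3 := coordMap_injective _ h1
  rw [h3]
  refine (isRep_rep P).smul ?_
  rintro h0
  rw [hc', h0, map_zero] at hc
  exact hc rfl

/-! ### Extension of scalars -/

theorem extLin_apply [Algebra F F'] {m : ℕ} (T : Vec m F →ₗ[F] Vec n F) (v : Vec m F')
    (i : Fin (n + 1)) :
    extLin F' T v i = ∑ j, algebraMap F F' (T (Pi.single j 1) i) * v j := by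
  simp [extLin, Matrix.mulVec, dotProduct, LinearMap.toMatrix'_apply]

theorem coordMap_single (σ : F →+* F') (j : Fin (n + 1)) :
    coordMap σ (Pi.single j 1 : Vec n F) = Pi.single j 1 := by
  ext i
  simp [coordMap_apply, Pi.single_apply, apply_ite σ]

theorem extLin_coordMap [Algebra F F'] {m : ℕ} (T : Vec m F →ₗ[F] Vec n F) (v : Vec m F) :
    extLin F' T (coordMap (algebraMap F F') v) = coordMap (algebraMap F F') (T v) := by
  ext i
  rw [extLin_apply, coordMap_apply]
  have h : ∀ x : Fin (m + 1), (fun j => if x = j then (1 : F) else 0) = Pi.single x 1 := by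
    intro x
    ext j
    simp [Pi.single_apply, eq_comm]
  rw [LinearMap.pi_apply_eq_sum_univ T v]
  simp [coordMap_apply, Finset.sum_apply, mul_comm, h]

theorem extLin_self {m : ℕ} (T : Vec m F →ₗ[F] Vec n F) : extLin F T = T := by
  refine LinearMap.ext fun v => ?_
  exact extLin_coordMap (F' := F) T v

theorem extLin_comp [Algebra F F'] {m l : ℕ} (T : Vec m F →ₗ[F] Vec n F)
    (S : Vec l F →ₗ[F] Vec m F) :
    extLin F' (T ∘ₗ S) = extLin F' T ∘ₗ extLin F' S := by
  unfold extLin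
  rw [LinearMap.toMatrix'_comp, Matrix.map_mul, Matrix.toLin'_mul]

theorem extLin_id [Algebra F F'] : extLin F' (LinearMap.id : Vec n F →ₗ[F] Vec n F) =
    LinearMap.id := by
  unfold extLin
  rw [LinearMap.toMatrix'_id, Matrix.map_one _ (map_zero _) (map_one _), Matrix.toLin'_one]

theorem coordMap_frob_extLin {k : Type*} [Field k] [Fintype k] [Algebra k F] {m : ℕ}
    (T : Vec m k →ₗ[k] Vec n k) (v : Vec m F) :
    coordMap (frob k F) (extLin F T v) = extLin F T (coordMap (frob k F) v) := by
  ext i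
  simp only [extLin_apply, coordMap_apply, map_sum, map_mul, frob_algebraMap]

theorem extLin_extLin {F'' : Type*} [Field F''] [Algebra F F'] [Algebra F F''] [Algebra F' F'']
    [IsScalarTower F F' F''] {m : ℕ} (T : Vec m F →ₗ[F] Vec n F) :
    extLin F'' (extLin F' T) = extLin F'' T := by
  refine LinearMap.ext fun v => ?_
  ext i
  rw [extLin_apply, extLin_apply]
  refine Finset.sum_congr rfl fun j _ => ?_
  rw [IsScalarTower.algebraMap_apply F F' F'', ← coordMap_single (algebraMap F F'),
    extLin_coordMap, coordMap_apply]

theorem subMap_sup (σ : F →+* F') (U W : Submodule F (Vec n F)) :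
    subMap σ (U ⊔ W) = subMap σ U ⊔ subMap σ W := by
  refine le_antisymm (Submodule.span_le.mpr ?_) (sup_le ?_ ?_)
  · rintro _ ⟨v, hv, rfl⟩
    obtain ⟨u, hu, w, hw, rfl⟩ := Submodule.mem_sup.mp hv
    rw [map_add]
    exact Submodule.add_mem_sup (Submodule.subset_span ⟨u, hu, rfl⟩)
      (Submodule.subset_span ⟨w, hw, rfl⟩)
  · exact Submodule.span_mono (Set.image_mono (SetLike.coe_subset_coe.mpr le_sup_left))
  · exact Submodule.span_mono (Set.image_mono (SetLike.coe_subset_coe.mpr le_sup_right))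

theorem subMap_top (σ : F →+* F') : subMap σ (⊤ : Submodule F (Vec n F)) = ⊤ := by
  rw [eq_top_iff, ← (Pi.basisFun F' (Fin (n + 1))).span_eq]
  refine Submodule.span_mono ?_
  rintro _ ⟨i, rfl⟩
  refine ⟨Pi.single i 1, trivial, ?_⟩
  rw [coordMap_single, Pi.basisFun_apply]

/-- The dimension cannot grow for `W` nor for a complement of `W`, while the two images still span
everything; so neither dimension drops. -/
theorem finrank_subMap (σ : F →+* F') (W : Submodule F (Vec n F)) :
    Module.finrank F' (subMap σ W) = Module.finrank F W := by
  refine le_antisymm (finrank_subMap_le σ W) ?_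
  obtain ⟨U, hU⟩ := W.exists_isCompl
  have h1 := Submodule.finrank_add_eq_of_isCompl hU
  have h2 : subMap σ W ⊔ subMap σ U = ⊤ := by rw [← subMap_sup, hU.sup_eq_top, subMap_top]
  have h3 := Submodule.finrank_add_le_finrank_add_finrank (subMap σ W) (subMap σ U)
  rw [h2, finrank_top] at h3
  have h4 := finrank_subMap_le σ U
  simp only [Module.finrank_fin_fun] at h1 h3
  omega

theorem coordMap_mem_subMap (σ : F →+* F') {W : Submodule F (Vec n F)} {v : Vec n F}
    (hv : v ∈ W) : coordMap σ v ∈ subMap σ W := Submodule.subset_span ⟨v, hv, rfl⟩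

/-- The rational part contains `W`, and its own extension lies in `ext F' W`, so its dimension is at
most that of `W`. -/
theorem rat_ext [Algebra F F'] (W : Submodule F (Vec n F)) : rat F (ext F' W) = W := by
  have h : W ≤ rat F (ext F' W) := fun v hv => coordMap_mem_subMap _ hv
  refine (Submodule.eq_of_le_of_finrank_le h ?_).symm
  rw [← finrank_subMap (algebraMap F F') (rat F (ext F' W)),
    ← finrank_subMap (algebraMap F F') W]
  refine Submodule.finrank_mono (Submodule.span_le.mpr ?_)
  rintro _ ⟨v, hv, rfl⟩
  exact hv

theorem coordMap_mem_ext_iff [Algebra F F'] {W : Submodule F (Vec n F)} {v : Vec n F} :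
    coordMap (algebraMap F F') v ∈ ext F' W ↔ v ∈ W := by
  conv_rhs => rw [← rat_ext (F' := F') W]
  rfl

theorem ext_self (W : Submodule F (Vec n F)) : ext F W = W := by
  refine le_antisymm (Submodule.span_le.mpr ?_) fun v hv => Submodule.subset_span ⟨v, hv, rfl⟩
  rintro _ ⟨v, hv, rfl⟩
  exact hv

theorem mem_subMap_iff {σ : F →+* F'} (hσ : Function.Surjective σ) {W : Submodule F (Vec n F)}
    {v : Vec n F'} : v ∈ subMap σ W ↔ ∃ w ∈ W, coordMap σ w = v := by
  refine ⟨fun h => ?_, fun ⟨w, hw, h⟩ => h ▸ coordMap_mem_subMap σ hw⟩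
  induction h using Submodule.span_induction with
  | mem x hx => exact hx
  | zero => exact ⟨0, W.zero_mem, map_zero _⟩
  | add x y _ _ hx hy =>
    obtain ⟨u, hu, rfl⟩ := hx
    obtain ⟨w, hw, rfl⟩ := hy
    exact ⟨u + w, W.add_mem hu hw, map_add _ _ _⟩
  | smul a x _ hx =>
    obtain ⟨u, hu, rfl⟩ := hx
    obtain ⟨b, rfl⟩ := hσ a
    exact ⟨b • u, W.smul_mem _ hu, coordMap_smul _ _ _⟩

end Representatives

/-! ### Conjugates of linear maps -/

section Twist

variable {k K : Type*} (F : Type*) [Field k] [Fintype k] [Field K] [Field F]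
  [Algebra k K] [Algebra k F] [Algebra K F] {l n r : ℕ}

/-- The linear map over `F` whose matrix is the `j`-th conjugate of the matrix of `T`. -/
def twist (k : Type*) {K : Type*} (F : Type*) [Field k] [Fintype k] [Field K] [Field F]
    [Algebra k K] [Algebra K F] (j : ℕ) (T : Vec l K →ₗ[K] Vec n K) : Vec l F →ₗ[F] Vec n F :=
  Matrix.toLin' ((LinearMap.toMatrix' T).map (conjEmb k K F j))

variable {F}

theorem twist_apply (j : ℕ) (T : Vec l K →ₗ[K] Vec n K) (v : Vec l F) (i : Fin (n + 1)) :
    twist k F j T v i = ∑ a, conjEmb k K F j (T (Pi.single a 1) i) * v a := by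
  simp [twist, Matrix.mulVec, dotProduct, LinearMap.toMatrix'_apply]

theorem twist_zero_left (T : Vec l K →ₗ[K] Vec n K) : twist k F 0 T = extLin F T := by
  refine LinearMap.ext fun v => ?_
  ext i
  rw [twist_apply, extLin_apply]
  rfl

theorem twist_comp (j : ℕ) (T : Vec l K →ₗ[K] Vec n K) (S : Vec r K →ₗ[K] Vec l K) :
    twist k F j (T ∘ₗ S) = twist k F j T ∘ₗ twist k F j S := by
  unfold twist
  rw [LinearMap.toMatrix'_comp, Matrix.map_mul, Matrix.toLin'_mul]

theorem twist_id (j : ℕ) : twist k F j (LinearMap.id : Vec n K →ₗ[K] Vec n K) = LinearMap.id := by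
  unfold twist
  rw [LinearMap.toMatrix'_id, Matrix.map_one _ (map_zero _) (map_one _), Matrix.toLin'_one]

theorem twist_zero (j : ℕ) : twist k F j (0 : Vec l K →ₗ[K] Vec n K) = 0 := by
  refine LinearMap.ext fun v => ?_
  ext i
  simp [twist_apply]

theorem twist_coordMap (j : ℕ) (T : Vec l K →ₗ[K] Vec n K) (v : Vec l K) :
    twist k F j T (coordMap (conjEmb k K F j) v) = coordMap (conjEmb k K F j) (T v) := by
  have h : ∀ x : Fin (l + 1), (fun j => if x = j then (1 : K) else 0) = Pi.single x 1 := by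
    intro x
    ext j
    simp [Pi.single_apply, eq_comm]
  ext i
  rw [twist_apply, coordMap_apply, LinearMap.pi_apply_eq_sum_univ T v]
  simp [coordMap_apply, Finset.sum_apply, mul_comm, h]

theorem twist_twist (i d : ℕ) (T : Vec l K →ₗ[K] Vec n K) :
    twist k F i (twist k K d T) = twist k F (i + d) T := by
  refine LinearMap.ext fun v => ?_
  ext c
  rw [twist_apply, twist_apply]
  refine Finset.sum_congr rfl fun a _ => ?_
  rw [← coordMap_single (conjEmb k K K d), twist_coordMap, coordMap_apply, coordMap_single,
    conjEmb_self, conjEmb_frob_pow]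

theorem twist_add_three (hK : Module.finrank k K = 3) (j : ℕ) (T : Vec l K →ₗ[K] Vec n K) :
    twist k F (j + 3) T = twist k F j T := by
  unfold twist
  rw [conjEmb_add_three hK]

theorem coordMap_frob_twist (j : ℕ) (T : Vec l K →ₗ[K] Vec n K) (v : Vec l F) :
    coordMap (frob k F) (twist k F j T v) = twist k F (j + 1) T (coordMap (frob k F) v) := by
  ext i
  simp only [twist_apply, coordMap_apply, map_sum, map_mul, frob_conjEmb]

theorem twist_extLin [IsScalarTower k K F] (j : ℕ) (T : Vec l k →ₗ[k] Vec n k) :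
    twist k F j (extLin K T) = extLin F T := by
  refine LinearMap.ext fun v => ?_
  ext i
  rw [twist_apply, extLin_apply]
  refine Finset.sum_congr rfl fun a _ => ?_
  rw [← coordMap_single (algebraMap k K), extLin_coordMap, coordMap_apply, conjEmb_algebraMap]

end Twist

/-! ### Coordinates of the Bose representation -/

section Coordinates

variable {k K F : Type*} [Field k] [Fintype k] [Field K] [Field F]
  [Algebra k K] [Algebra k F] [Algebra K F] (m : Bose k K) (M : Vec 2 K ≃ₗ[K] Vec 2 K)

/-- The component in `Γ`, in the coordinates of the frame `M`. -/
def Bose.frameComp : Vec 8 K →ₗ[K] Vec 2 K := M.symm.toLinearMap ∘ₗ m.component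

/-- The embedding of the plane with frame `M` onto `Γ`. -/
def Bose.frameVec : Vec 2 K →ₗ[K] Vec 8 K := m.toVec ∘ₗ M.toLinearMap

theorem Bose.component_toVec (u : Vec 2 K) : m.component (m.toVec u) = u := by
  simp [Bose.component, Bose.toVec]

theorem Bose.component_eq_zero {v : Vec 8 K}
    (hv : v ∈ conj k m.Γ ⊔ conj k (conj k m.Γ)) : m.component v = 0 := by
  simp only [Bose.component, LinearMap.comp_apply]
  have := (Submodule.projectionOnto_apply_eq_zero_iff m.isCompl).mpr hv
  rw [this, map_zero]

theorem Bose.toVec_mem (u : Vec 2 K) : m.toVec u ∈ m.Γ := (m.coord u).2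

theorem Bose.frameComp_frameVec : m.frameComp M ∘ₗ m.frameVec M = LinearMap.id := by
  refine LinearMap.ext fun v => ?_
  simp [Bose.frameComp, Bose.frameVec, Bose.component_toVec]

theorem coordMap_frob_pow_succ {n : ℕ} (j : ℕ) (v : Vec n K) :
    coordMap (frob k K ^ (j + 1)) v = coordMap (frob k K) (coordMap (frob k K ^ j) v) := by
  ext i
  simp only [coordMap_apply, pow_succ']
  rfl

/-- The conjugate embeddings have image in `Γ^q` or `Γ^(q²)`, which lie in the kernel of the
projection onto `Γ`. As Frobenius is surjective on `K`, every argument may be taken to be a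
conjugate vector. -/
theorem Bose.frameComp_twist_frameVec (hK : Module.finrank k K = 3) {j : ℕ} (hj : j = 1 ∨ j = 2) :
    m.frameComp M ∘ₗ twist k K j (m.frameVec M) = 0 := by
  have := finite_of_finrank (by norm_num) hK
  refine LinearMap.ext fun v => ?_
  obtain ⟨u, rfl⟩ : ∃ u, coordMap (conjEmb k K K j) u = v := by
    have hs : Function.Surjective (conjEmb k K K j) :=
      (Finite.injective_iff_bijective.mp (conjEmb k K K j).injective).2
    choose g hg using hs
    exact ⟨fun i => g (v i), by ext i; exact hg _⟩
  rw [LinearMap.comp_apply, twist_coordMap, Bose.frameComp, LinearMap.comp_apply,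
    m.component_eq_zero, map_zero, LinearMap.zero_apply]
  have h0 := coordMap_mem_subMap (frob k K) (m.toVec_mem (M u))
  rw [conjEmb_self]
  rcases hj with rfl | rfl
  · refine Submodule.mem_sup_left ?_
    rw [pow_one]
    exact h0
  · refine Submodule.mem_sup_right ?_
    rw [coordMap_frob_pow_succ, pow_one]
    exact coordMap_mem_subMap (frob k K) h0

/-- The coordinates of the component in the `j`-th transversal plane. -/
def Bose.Y (m : Bose k K) (M : Vec 2 K ≃ₗ[K] Vec 2 K) (F : Type*) [Field F]
    [Algebra K F] (j : ℕ) : Vec 8 F →ₗ[F] Vec 2 F :=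
  twist k F j (m.frameComp M)

/-- The embedding of the plane onto the `j`-th transversal plane. -/
def Bose.G (m : Bose k K) (M : Vec 2 K ≃ₗ[K] Vec 2 K) (F : Type*) [Field F]
    [Algebra K F] (j : ℕ) : Vec 2 F →ₗ[F] Vec 8 F :=
  twist k F j (m.frameVec M)

theorem Bose.Y_G (j : ℕ) (u : Vec 2 F) : m.Y M F j (m.G M F j u) = u := by
  rw [Bose.Y, Bose.G, ← LinearMap.comp_apply, ← twist_comp, m.frameComp_frameVec, twist_id]
  rfl

theorem Bose.Y_G_add (hK : Module.finrank k K = 3) {d : ℕ} (hd : d = 1 ∨ d = 2) (j : ℕ)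
    (u : Vec 2 F) : m.Y M F j (m.G M F (j + d) u) = 0 := by
  rw [Bose.Y, Bose.G, ← LinearMap.comp_apply, ← twist_twist, ← twist_comp,
    m.frameComp_twist_frameVec M hK hd, twist_zero]
  rfl

theorem Bose.Y_add_three (hK : Module.finrank k K = 3) (j : ℕ) : m.Y M F (j + 3) = m.Y M F j :=
  twist_add_three hK _ _

theorem Bose.G_add_three (hK : Module.finrank k K = 3) (j : ℕ) : m.G M F (j + 3) = m.G M F j :=
  twist_add_three hK _ _

theorem Bose.Y_G_of_lt (hK : Module.finrank k K = 3) {i j : ℕ} (hi : i < 3) (hj : j < 3)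
    (hij : i ≠ j) (u : Vec 2 F) : m.Y M F i (m.G M F j u) = 0 := by
  rcases lt_or_gt_of_ne hij with h | h
  · obtain ⟨d, rfl⟩ := Nat.exists_eq_add_of_lt h
    rw [add_assoc]
    exact m.Y_G_add M hK (by omega) i u
  -- Replacing `j` by `j + 3` makes the index difference positive, again 1 or 2.
  · obtain ⟨d, hd⟩ := Nat.exists_eq_add_of_lt (show i < j + 3 by omega)
    rw [← m.G_add_three M hK, hd, add_assoc]
    exact m.Y_G_add M hK (by omega) i u

theorem Bose.Y_sum (hK : Module.finrank k K = 3) (z : ℕ → Vec 2 F) {j : ℕ} (hj : j < 3) :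
    m.Y M F j (m.G M F 0 (z 0) + m.G M F 1 (z 1) + m.G M F 2 (z 2)) = z j := by
  rw [map_add, map_add]
  interval_cases j
  · rw [m.Y_G, m.Y_G_of_lt M hK (by omega) (by omega) (by omega),
      m.Y_G_of_lt M hK (by omega) (by omega) (by omega), add_zero, add_zero]
  · rw [m.Y_G, m.Y_G_of_lt M hK (by omega) (by omega) (by omega),
      m.Y_G_of_lt M hK (by omega) (by omega) (by omega), add_zero, zero_add]
  · rw [m.Y_G, m.Y_G_of_lt M hK (by omega) (by omega) (by omega),
      m.Y_G_of_lt M hK (by omega) (by omega) (by omega), zero_add, zero_add]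

theorem Bose.exists_Y (hK : Module.finrank k K = 3) (z : ℕ → Vec 2 F) :
    ∃ v, ∀ j < 3, m.Y M F j v = z j :=
  ⟨_, fun _ hj => m.Y_sum M hK z hj⟩

/-- The components can be prescribed freely, and a surjection between spaces of dimension nine is
injective. -/
theorem Bose.Y_injective (hK : Module.finrank k K = 3) {v w : Vec 8 F}
    (h : ∀ j < 3, m.Y M F j v = m.Y M F j w) : v = w := by
  let T : Vec 8 F →ₗ[F] (Fin 3 → Vec 2 F) := LinearMap.pi fun j => m.Y M F j
  have hs : Function.Surjective T := by
    intro z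
    obtain ⟨v, hv⟩ := m.exists_Y M hK fun j => if h : j < 3 then z ⟨j, h⟩ else 0
    refine ⟨v, ?_⟩
    ext1 j
    have := hv j j.2
    simp only [j.2, dif_pos] at this
    exact this
  have hi : Function.Injective T := by
    rw [LinearMap.injective_iff_surjective_of_finrank_eq_finrank]
    · exact hs
    · simp [Module.finrank_pi_fintype]
  refine hi ?_
  ext1 j
  exact h j j.2

theorem Bose.eq_sum_G (hK : Module.finrank k K = 3) (v : Vec 8 F) :
    v = m.G M F 0 (m.Y M F 0 v) + m.G M F 1 (m.Y M F 1 v) + m.G M F 2 (m.Y M F 2 v) :=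
  m.Y_injective M hK fun _ hj => (m.Y_sum M hK (fun j => m.Y M F j v) hj).symm

theorem Bose.G_coordMap (j : ℕ) (u : Vec 2 K) :
    m.G M F j (coordMap (conjEmb k K F j) u) = coordMap (conjEmb k K F j) (m.toVec (M u)) :=
  twist_coordMap _ _ _

theorem extLin_symm_extLin (u : Vec 2 F) :
    extLin F M.toLinearMap (extLin F M.symm.toLinearMap u) = u := by
  rw [← LinearMap.comp_apply, ← extLin_comp, LinearEquiv.comp_symm, extLin_id]
  rfl

theorem extLin_extLin_symm (u : Vec 2 F) :
    extLin F M.symm.toLinearMap (extLin F M.toLinearMap u) = u := by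
  have := extLin_symm_extLin M.symm u
  exact this

theorem Bose.G_zero (u : Vec 2 F) :
    m.G M F 0 u = extLin F m.toVec (extLin F M.toLinearMap u) := by
  rw [Bose.G, twist_zero_left, Bose.frameVec, extLin_comp]
  rfl

theorem Bose.isRep_toΓ {P : PG 2 F} {u : Vec 2 F} (h : IsRep P (extLin F M.toLinearMap u)) :
    IsRep (m.toΓ P) (m.G M F 0 u) := by
  rw [m.G_zero]
  exact h.map _ _

/-- The coordinates of a point of `PG(8,k)`: a bijection onto `K³`. -/
def Bose.y : Vec 8 k →ₗ[k] Vec 2 K where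
  toFun v := m.Y M K 0 (coordMap (algebraMap k K) v)
  map_add' v w := by rw [map_add, map_add]
  map_smul' a v := by
    rw [coordMap_smul, map_smul, algebraMap_smul]; rfl

/-- The components of a rational point are the conjugates of a single vector `y`: the one in `Γ`
determines the others. -/
theorem Bose.Y_coordMap [IsScalarTower k K F] (j : ℕ) (v : Vec 8 k) :
    m.Y M F j (coordMap (algebraMap k F) v) = coordMap (conjEmb k K F j) (m.y M v) := by
  have h : coordMap (algebraMap k F) v = coordMap (conjEmb k K F j) (coordMap (algebraMap k K) v) := by
    ext i
    simp only [coordMap_apply, conjEmb_algebraMap]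
  rw [h, Bose.Y, twist_coordMap]
  congr 1
  change _ = m.Y M K 0 _
  rw [Bose.Y, twist_zero_left, extLin_self]

/-- Both sides have dimension nine over `k`. Consequently a map over `k` into the ambient space may
be given by its component in `Γ` alone, as is done for the rational curves. -/
theorem Bose.y_bijective (hK : Module.finrank k K = 3) : Function.Bijective (m.y M) := by
  have := Module.finite_of_finrank_pos (R := k) (M := K) (by omega)
  have hi : Function.Injective (m.y M) := by
    intro v w h
    refine coordMap_injective (algebraMap k K) (m.Y_injective M hK fun j _ => ?_)
    rw [m.Y_coordMap, m.Y_coordMap, h]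
  refine ⟨hi, ?_⟩
  rw [← LinearMap.injective_iff_surjective_of_finrank_eq_finrank]
  · exact hi
  · rw [Module.finrank_fin_fun, Module.finrank_pi_fintype]
    simp [hK]

/-- The span of the three conjugates of a subspace of `Γ`. -/
theorem Bose.mem_sup_conj_iff (hK : Module.finrank k K = 3) (U : Submodule K (Vec 2 K))
    (v : Vec 8 K) :
    v ∈ U.map m.toVec ⊔ conj k (U.map m.toVec) ⊔ conj k (conj k (U.map m.toVec)) ↔
      ∀ j < 3, ∃ u, M u ∈ U ∧ m.Y M K j v = coordMap (frob k K ^ j) u := by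
  have := finite_of_finrank (by norm_num) hK
  have hs := (frob_bijective (k := k) (F := K)).2
  constructor
  · intro h
    obtain ⟨w, hw, x₂, hx₂, rfl⟩ := Submodule.mem_sup.mp h
    obtain ⟨x₀, hx₀, x₁, hx₁, rfl⟩ := Submodule.mem_sup.mp hw
    obtain ⟨u₀, hu₀, rfl⟩ := hx₀
    obtain ⟨_, ⟨u₁, hu₁, rfl⟩, rfl⟩ := (mem_subMap_iff hs).mp hx₁
    obtain ⟨x₃, hx₃, rfl⟩ := (mem_subMap_iff hs).mp hx₂
    obtain ⟨_, ⟨u₂, hu₂, rfl⟩, rfl⟩ := (mem_subMap_iff hs).mp hx₃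
    let u : ℕ → Vec 2 K := fun j => M.symm (if j = 0 then u₀ else if j = 1 then u₁ else u₂)
    have key : ∀ j, coordMap (frob k K ^ j) (m.toVec (M (u j))) =
        m.G M K j (coordMap (frob k K ^ j) (u j)) := fun j => (m.G_coordMap M j (u j)).symm
    have e : m.toVec u₀ + coordMap (frob k K) (m.toVec u₁) +
        coordMap (frob k K) (coordMap (frob k K) (m.toVec u₂)) =
        m.G M K 0 (coordMap (frob k K ^ 0) (u 0)) + m.G M K 1 (coordMap (frob k K ^ 1) (u 1)) +
          m.G M K 2 (coordMap (frob k K ^ 2) (u 2)) := by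
      rw [← key, ← key, ← key, coordMap_frob_pow_succ 1, pow_one]
      simp only [u, M.apply_symm_apply]
      rfl
    intro j hj
    refine ⟨u j, ?_, ?_⟩
    · simp only [u, M.apply_symm_apply]
      split_ifs <;> assumption
    · rw [e, m.Y_sum M hK (fun j => coordMap (frob k K ^ j) (u j)) hj]
  · intro h
    rw [m.eq_sum_G M hK v]
    have key : ∀ j < 3, ∃ u ∈ U, m.G M K j (m.Y M K j v) = coordMap (frob k K ^ j) (m.toVec u) := by
      intro j hj
      obtain ⟨u, hu, e⟩ := h j hj
      exact ⟨M u, hu, by rw [e, ← conjEmb_self, m.G_coordMap]⟩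
    obtain ⟨u₀, hu₀, e₀⟩ := key 0 (by omega)
    obtain ⟨u₁, hu₁, e₁⟩ := key 1 (by omega)
    obtain ⟨u₂, hu₂, e₂⟩ := key 2 (by omega)
    rw [e₀, e₁, e₂]
    refine Submodule.add_mem_sup (Submodule.add_mem_sup ⟨u₀, hu₀, rfl⟩ ?_) ?_
    · rw [pow_one]
      exact coordMap_mem_subMap _ ⟨u₁, hu₁, rfl⟩
    · rw [coordMap_frob_pow_succ, pow_one]
      exact coordMap_mem_subMap _ (coordMap_mem_subMap _ ⟨u₂, hu₂, rfl⟩)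

/-! ### Equations -/

theorem aeval_descend {n : ℕ} {τ : K →ₗ[k] k} {b : K}
    (h : ∀ x, algebraMap k F (τ x) = ∑ j : Fin 3, conjEmb k K F j (b * x))
    (P : MvPolynomial (Fin (n + 1)) K) (v : Vec n F) :
    MvPolynomial.aeval v (descend τ P) =
      ∑ j : Fin 3, conjEmb k K F j b * MvPolynomial.eval₂ (conjEmb k K F j) v P := by
  simp only [descend, map_sum, MvPolynomial.aeval_monomial, h, MvPolynomial.eval₂_eq, map_mul,
    Finset.mul_sum, Finset.sum_mul, Finsupp.prod_fintype, pow_zero, implies_true]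
  rw [Finset.sum_comm]
  refine Finset.sum_congr rfl fun j _ => Finset.sum_congr rfl fun d _ => ?_
  rw [mul_assoc]
  congr 2
  rw [Finset.prod_subset (Finset.subset_univ d.support)]
  intro i _ hi
  rw [Finsupp.notMem_support_iff.mp hi, pow_zero]

/-- With `τ = Tr(b ·)`, the descended polynomial takes the value `∑ b^(q^j) P^(j)(v)`. If this
vanishes for all `b`, independence of the embeddings kills each conjugate value. -/
theorem forall_aeval_descend_iff [IsScalarTower k K F] (hK : Module.finrank k K = 3) {n : ℕ}
    (P : MvPolynomial (Fin (n + 1)) K) (v : Vec n F) :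
    (∀ τ : K →ₗ[k] k, MvPolynomial.aeval v (descend τ P) = 0) ↔
      ∀ j < 3, MvPolynomial.eval₂ (conjEmb k K F j) v P = 0 := by
  constructor
  · intro h
    have := conjEmb_independent (k := k) (K := K) hK
      (fun j : Fin 3 => MvPolynomial.eval₂ (conjEmb k K F j) v P) (by
        intro b
        obtain ⟨τ, hτ⟩ := exists_functional (F := F) b hK
        rw [← h τ, aeval_descend hτ]
        simp only [mul_comm])
    intro j hj
    exact congrFun this ⟨j, hj⟩
  · intro h τ
    obtain ⟨b, hb⟩ := exists_trace_repr (F := F) hK τ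
    rw [aeval_descend hb]
    exact Finset.sum_eq_zero fun j _ => by rw [h j j.2, mul_zero]

theorem Bose.eval₂_form (j : ℕ) (i : Fin 3) (v : Vec 8 F) :
    MvPolynomial.eval₂ (conjEmb k K F j) v (m.form M i) = m.Y M F j v i := by
  rw [Bose.Y, twist_apply, Bose.form, linForm]
  simp [MvPolynomial.eval₂_sum, Bose.frameComp]

/-- Raising the coefficients to the power `q` shifts the conjugate index by one; hence the equations
of the subplane compare the neighbouring components `Y_j` and `Y_{j+1}`. -/
theorem Bose.eval₂_formConj (j : ℕ) (i : Fin 3) (v : Vec 8 F) :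
    MvPolynomial.eval₂ (conjEmb k K F j) v (m.formConj M i) = m.Y M F (j + 1) v i := by
  rw [Bose.formConj, MvPolynomial.eval₂_map, ← m.eval₂_form]
  rfl

theorem Bose.eval₂_aeval_form [IsScalarTower k K F] (f : MvPolynomial (Fin 3) k) (j : ℕ)
    (v : Vec 8 F) :
    MvPolynomial.eval₂ (conjEmb k K F j) v (MvPolynomial.aeval (m.form M) f) =
      MvPolynomial.aeval (m.Y M F j v) f := by
  induction f using MvPolynomial.induction_on with
  | C a =>
    rw [MvPolynomial.algHom_C, MvPolynomial.algHom_C, IsScalarTower.algebraMap_apply k K,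
      MvPolynomial.algebraMap_eq, MvPolynomial.eval₂_C, conjEmb_algebraMap]
  | add p q hp hq => rw [map_add, map_add, MvPolynomial.eval₂_add, hp, hq]
  | mul_X p i hp =>
    rw [map_mul, map_mul, MvPolynomial.eval₂_mul, hp, MvPolynomial.aeval_X, MvPolynomial.aeval_X,
      m.eval₂_form]

theorem Bose.aeval_conicQuadrics_iff [IsScalarTower k K F] (hK : Module.finrank k K = 3)
    (f : MvPolynomial (Fin 3) k) (v : Vec 8 F) :
    (∀ Q ∈ m.conicQuadrics M f, MvPolynomial.aeval v Q = 0) ↔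
      ∀ j < 3, (∀ a b, m.Y M F j v a * m.Y M F (j + 1) v b = m.Y M F j v b * m.Y M F (j + 1) v a) ∧
        MvPolynomial.aeval (m.Y M F j v) f = 0 := by
  constructor
  · intro h j hj
    refine ⟨fun a b => ?_, ?_⟩
    · have := (forall_aeval_descend_iff hK _ v).mp
        (fun τ => h _ ⟨τ, Or.inl ⟨a, b, rfl⟩⟩) j hj
      rw [MvPolynomial.eval₂_sub, MvPolynomial.eval₂_mul, MvPolynomial.eval₂_mul] at this
      simp only [m.eval₂_form, m.eval₂_formConj] at this
      exact sub_eq_zero.mp this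
    · have := (forall_aeval_descend_iff hK _ v).mp (fun τ => h _ ⟨τ, Or.inr rfl⟩) j hj
      rwa [m.eval₂_aeval_form] at this
  · rintro h Q ⟨τ, ⟨a, b, rfl⟩ | rfl⟩
    · refine (forall_aeval_descend_iff hK _ v).mpr (fun j hj => ?_) τ
      rw [MvPolynomial.eval₂_sub, MvPolynomial.eval₂_mul, MvPolynomial.eval₂_mul]
      simp only [m.eval₂_form, m.eval₂_formConj]
      exact sub_eq_zero.mpr ((h j hj).1 a b)
    · refine (forall_aeval_descend_iff hK _ v).mpr (fun j hj => ?_) τ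
      rw [m.eval₂_aeval_form]
      exact (h j hj).2

theorem aeval_conicEq [IsScalarTower k K F] (f : MvPolynomial (Fin 3) k) (u : Vec 2 F) :
    MvPolynomial.aeval u (conicEq M f) =
      MvPolynomial.aeval (extLin F M.symm.toLinearMap u) f := by
  induction f using MvPolynomial.induction_on with
  | C a =>
    rw [conicEq, MvPolynomial.algHom_C, MvPolynomial.algHom_C, IsScalarTower.algebraMap_apply k K,
      MvPolynomial.algebraMap_eq, MvPolynomial.algHom_C, ← IsScalarTower.algebraMap_apply]
  | add p q hp hq =>
    simp only [conicEq] at hp hq ⊢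
    rw [map_add, map_add, map_add, hp, hq]
  | mul_X p i hp =>
    simp only [conicEq] at hp ⊢
    rw [map_mul, map_mul, map_mul, hp, MvPolynomial.aeval_X, MvPolynomial.aeval_X, extLin_apply,
      linForm]
    simp

end Coordinates

/-! ### Normal form of a non-degenerate conic over a finite field -/

section Conics

/-- The ternary quadratic form with coefficients `a`. -/
def terQuad {R : Type*} [CommRing R] (a : Fin 6 → R) (u : Fin 3 → R) : R :=
  a 0 * u 0 ^ 2 + a 1 * u 1 ^ 2 + a 2 * u 2 ^ 2 + a 3 * (u 1 * u 2) + a 4 * (u 0 * u 2) +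
    a 5 * (u 0 * u 1)

/-- The polar form of `terQuad`. -/
def terPolar {R : Type*} [CommRing R] (a : Fin 6 → R) (u v : Fin 3 → R) : R :=
  2 * a 0 * (u 0 * v 0) + 2 * a 1 * (u 1 * v 1) + 2 * a 2 * (u 2 * v 2) +
    a 3 * (u 1 * v 2 + u 2 * v 1) + a 4 * (u 0 * v 2 + u 2 * v 0) + a 5 * (u 0 * v 1 + u 1 * v 0)

theorem terQuad_combination {R : Type*} [CommRing R] (a : Fin 6 → R) (s t r : R)
    (u w v : Fin 3 → R) : terQuad a (s • u + t • w + r • v) =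
      s ^ 2 * terQuad a u + t ^ 2 * terQuad a w + r ^ 2 * terQuad a v +
        s * t * terPolar a u w + s * r * terPolar a u v + t * r * terPolar a v w := by
  simp only [terPolar, terQuad, Pi.smul_apply, Pi.add_apply, smul_eq_mul]
  ring

theorem map_terQuad {R S : Type*} [CommRing R] [CommRing S] (φ : R →+* S) (a : Fin 6 → R)
    (u : Fin 3 → R) : φ (terQuad a u) = terQuad (fun i => φ (a i)) (fun i => φ (u i)) := by
  simp [terQuad]

theorem map_terPolar {R S : Type*} [CommRing R] [CommRing S] (φ : R →+* S) (a : Fin 6 → R)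
    (u v : Fin 3 → R) :
    φ (terPolar a u v) = terPolar (fun i => φ (a i)) (fun i => φ (u i)) (fun i => φ (v i)) := by
  simp [terPolar, map_ofNat φ 2]

theorem exists_terQuad {k : Type*} [Field k] {f : MvPolynomial (Fin 3) k}
    (hf : f.IsHomogeneous 2) :
    ∃ a : Fin 6 → k, f = terQuad (fun i => MvPolynomial.C (a i)) MvPolynomial.X := by
  have hadd : ∀ a b : Fin 6 → k, terQuad (fun i => MvPolynomial.C ((a + b) i)) MvPolynomial.X =
      (terQuad (fun i => MvPolynomial.C (a i)) MvPolynomial.X : MvPolynomial (Fin 3) k) +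
      terQuad (fun i => MvPolynomial.C (b i)) MvPolynomial.X := by
    intro a b
    simp only [terQuad, Pi.add_apply, map_add]
    ring
  have hmon : ∀ (d : Fin 3 →₀ ℕ) (r : k), d.degree = 2 → ∃ a : Fin 6 → k,
      MvPolynomial.monomial d r = terQuad (fun i => MvPolynomial.C (a i)) MvPolynomial.X := by
    intro d r hd
    rw [Finsupp.degree_eq_sum, Fin.sum_univ_three] at hd
    rw [MvPolynomial.monomial_eq, Finsupp.prod_fintype _ _ (by simp), Fin.prod_univ_three]
    generalize d 0 = x at *
    generalize d 1 = y at *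
    generalize d 2 = z at *
    have hz : z = 2 - x - y := by omega
    subst hz
    have hx : x ≤ 2 := by omega
    have hy : y ≤ 2 := by omega
    interval_cases x <;> interval_cases y <;> try omega
    · exact ⟨![0, 0, r, 0, 0, 0], by simp [terQuad]⟩
    · exact ⟨![0, 0, 0, r, 0, 0], by simp [terQuad]⟩
    · exact ⟨![0, r, 0, 0, 0, 0], by simp [terQuad]⟩
    · exact ⟨![0, 0, 0, 0, r, 0], by simp [terQuad]⟩
    · exact ⟨![0, 0, 0, 0, 0, r], by simp [terQuad]⟩
    · exact ⟨![r, 0, 0, 0, 0, 0], by simp [terQuad]⟩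
  rw [f.as_sum]
  refine Finset.sum_induction _ (fun p => ∃ a : Fin 6 → k,
    p = terQuad (fun i => MvPolynomial.C (a i)) MvPolynomial.X) ?_ ⟨0, by simp [terQuad]⟩ ?_
  · rintro _ _ ⟨a, rfl⟩ ⟨b, rfl⟩
    exact ⟨a + b, (hadd a b).symm⟩
  · intro d hd
    refine hmon d _ ?_
    rw [Finsupp.degree_eq_weight_one]
    exact hf (MvPolynomial.mem_support_iff.mp hd)

theorem aeval_terQuad {k F : Type*} [Field k] [CommRing F] [Algebra k F] (a : Fin 6 → k)
    (u : Fin 3 → F) :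
    MvPolynomial.aeval u (terQuad (fun i => MvPolynomial.C (a i)) MvPolynomial.X) =
      terQuad (fun i => algebraMap k F (a i)) u := by
  simp [terQuad, MvPolynomial.algHom_C]

/-- A non-degenerate conic over a finite field is projectively equivalent to `x z = y²`. -/
theorem exists_conic_normal_form {k : Type*} [Field k] [Fintype k] {f : MvPolynomial (Fin 3) k}
    (hf : IsNondegenerateConic f) :
    ∃ (N : Vec 2 k ≃ₗ[k] Vec 2 k) (c : k), c ≠ 0 ∧ conicEq N.symm f =
      MvPolynomial.C c * (MvPolynomial.X 0 * MvPolynomial.X 2 - MvPolynomial.X 1 ^ 2) := by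
  classical
  obtain ⟨hf2, hnd⟩ := hf
  obtain ⟨a, rfl⟩ := exists_terQuad hf2
  -- The partial derivatives at `u` are the values of the polar form against the unit vectors, so a
  -- zero of the form is never in the radical of the polar form. This holds in every characteristic.
  have hns : ∀ u : Vec 2 k, u ≠ 0 → terQuad a u = 0 → ∃ v, terPolar a u v ≠ 0 := by
    intro u hu h0
    obtain ⟨i, hi⟩ := hnd (coordMap (algebraMap k (AlgebraicClosure k)) u)
      (fun h => hu (coordMap_injective _ (h.trans (map_zero _).symm))) (by
        rw [aeval_terQuad]
        have := congrArg (algebraMap k (AlgebraicClosure k)) h0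
        simpa [terQuad, coordMap_apply] using this)
    refine ⟨Pi.single i 1, fun h => hi ?_⟩
    have := congrArg (algebraMap k (AlgebraicClosure k)) h
    rw [map_zero] at this
    rw [← this]
    fin_cases i <;>
      simp [terQuad, terPolar, MvPolynomial.pderiv_X, MvPolynomial.algHom_C,
        coordMap_apply, map_ofNat (algebraMap k (AlgebraicClosure k)) 2] <;> ring
  -- a rational point
  obtain ⟨u, hu, hu0⟩ : ∃ u : Vec 2 k, u ≠ 0 ∧ terQuad a u = 0 := by
    obtain ⟨p, hp⟩ := CharP.exists k
    have hprime := CharP.char_is_prime k p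
    -- Chevalley–Warning: degree 2 in three variables, so the number of zeros is divisible by the
    -- characteristic and the zero vector is not the only one.
    have hdvd := char_dvd_card_solutions p
      (f := (terQuad (fun i => MvPolynomial.C (a i)) MvPolynomial.X : MvPolynomial (Fin 3) k))
      (lt_of_le_of_lt hf2.totalDegree_le (by simp))
    by_contra! h
    have h1 : Fintype.card {x : Fin 3 → k // MvPolynomial.eval x
        (terQuad (fun i => MvPolynomial.C (a i)) MvPolynomial.X) = 0} = 1 := by
      rw [Fintype.card_eq_one_iff]
      refine ⟨⟨0, by simp [terQuad]⟩, ?_⟩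
      rintro ⟨y, hy⟩
      rw [Subtype.mk.injEq]
      by_contra hne
      refine h y hne ?_
      rw [← hy]
      simp [terQuad]
    rw [h1] at hdvd
    exact hprime.one_lt.ne' (Nat.dvd_one.mp hdvd)
  obtain ⟨v₀, hv₀⟩ := hns u hu hu0
  -- a hyperbolic pair
  obtain ⟨v, hv, huv⟩ : ∃ v, terQuad a v = 0 ∧ terPolar a u v = 1 := by
    have hb : terPolar a u ((terPolar a u v₀)⁻¹ • v₀) = 1 := by
      rw [← inv_mul_cancel₀ hv₀]
      simp only [terPolar, Pi.smul_apply, smul_eq_mul]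
      ring
    set v₁ := (terPolar a u v₀)⁻¹ • v₀
    -- As `u` is isotropic and pairs to 1 with `v₁`, subtracting this multiple of `u` makes `v₁`
    -- isotropic without changing the pairing.
    refine ⟨v₁ - terQuad a v₁ • u, ?_, ?_⟩
    · have : v₁ - terQuad a v₁ • u = (-terQuad a v₁) • u + (1 : k) • v₁ + (0 : k) • v₁ := by
        module
      rw [this, terQuad_combination, hb, hu0]; ring
    · have : terPolar a u (v₁ - terQuad a v₁ • u) =
          terPolar a u v₁ - 2 * terQuad a v₁ * terQuad a u := by
        generalize terQuad a v₁ = t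
        simp only [terPolar, terQuad, Pi.smul_apply, Pi.sub_apply, smul_eq_mul]
        ring
      rw [this, hb, hu0]; ring
  have hsymm : ∀ x y, terPolar a x y = terPolar a y x := by
    intro x y; simp only [terPolar]; ring
  have hdiag : ∀ x, terPolar a x x = 2 * terQuad a x := by
    intro x; simp only [terPolar, terQuad]; ring
  have hlin : ∀ x y z w s t r, terPolar a x (s • y + t • z + r • w) =
      s * terPolar a x y + t * terPolar a x z + r * terPolar a x w := by
    intros; simp only [terPolar, Pi.add_apply, Pi.smul_apply, smul_eq_mul]; ring
  obtain ⟨w, hw, huw, hvw⟩ : ∃ w, w ≠ 0 ∧ terPolar a u w = 0 ∧ terPolar a v w = 0 := by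
    let T : Vec 2 k →ₗ[k] (Fin 2 → k) :=
      { toFun := fun w => ![terPolar a u w, terPolar a v w]
        map_add' := fun x y => by
          ext i; fin_cases i <;> simp [terPolar] <;> ring
        map_smul' := fun s x => by
          ext i; fin_cases i <;> simp [terPolar] <;> ring }
    -- Orthogonality to `u` and `v` is two linear conditions in dimension three.
    obtain ⟨w, hw, hw0⟩ := (Submodule.ne_bot_iff _).mp
      (LinearMap.ker_ne_bot_of_finrank_lt (f := T) (by simp))
    have : T w = 0 := hw
    exact ⟨w, hw0, congrFun this 0, congrFun this 1⟩
  -- In the basis `u, w, μ v` the form is `μ c₀ c₂ + Q(w) c₁²`; the choice `μ = -Q(w)` made below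
  -- turns it into `μ (c₀ c₂ - c₁²)`.
  let N : k → Vec 2 k →ₗ[k] Vec 2 k := fun μ =>
    { toFun := fun c => c 0 • u + c 1 • w + (c 2 * μ) • v
      map_add' := fun x y => by
        ext i; simp; ring
      map_smul' := fun s x => by
        ext i; simp; ring }
  have hN : ∀ μ, μ ≠ 0 → Function.Injective (N μ) := by
    intro μ hμ
    rw [injective_iff_map_eq_zero]
    intro c hc
    have hc' : c 0 • u + c 1 • w + (c 2 * μ) • v = 0 := hc
    have h1 : terPolar a u 0 = 0 := by simp [terPolar]
    have h2 : terPolar a v 0 = 0 := by simp [terPolar]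
    rw [← hc', hlin, hdiag, hu0, huw, huv] at h1
    rw [← hc', hlin, hdiag, hv, hvw, hsymm v u, huv] at h2
    have e2 : c 2 = 0 := by simpa [hμ] using h1
    have e0 : c 0 = 0 := by simpa using h2
    rw [e0, e2] at hc'
    have e1 : c 1 = 0 := by simpa [hw] using hc'
    ext i; fin_cases i <;> assumption
  -- Otherwise `w` would be orthogonal to `u`, `v` and itself, hence a singular zero.
  have hγ : terQuad a w ≠ 0 := by
    intro h0
    obtain ⟨x, hx⟩ := hns w hw h0
    obtain ⟨c, rfl⟩ := LinearMap.surjective_of_injective (hN 1 one_ne_zero) x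
    apply hx
    change terPolar a w (c 0 • u + c 1 • w + (c 2 * 1) • v) = 0
    rw [hlin, hsymm w u, huw, hsymm w v, hvw, hdiag, h0]
    ring
  have hγ' : - terQuad a w ≠ 0 := neg_ne_zero.mpr hγ
  refine ⟨LinearEquiv.ofInjectiveEndo (N (-terQuad a w)) (hN _ hγ'), - terQuad a w, hγ', ?_⟩
  let C : k →+* MvPolynomial (Fin 3) k := MvPolynomial.C
  have hform : (fun i => linForm ((LinearMap.proj i : Vec 2 k →ₗ[k] k) ∘ₗ
      (LinearEquiv.ofInjectiveEndo (N (-terQuad a w)) (hN _ hγ')).symm.symm.toLinearMap)) =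
      (MvPolynomial.X 0 : MvPolynomial (Fin 3) k) • (fun i => C (u i)) +
        (MvPolynomial.X 1 : MvPolynomial (Fin 3) k) • (fun i => C (w i)) +
        (MvPolynomial.X 2 * C (-terQuad a w)) • (fun i => C (v i)) := by
    ext1 i
    simp [linForm, Fin.sum_univ_three, N, C]
    ring
  unfold conicEq
  rw [hform, aeval_terQuad, terQuad_combination]
  change _ * terQuad (fun i => C (a i)) (fun i => C (u i)) +
    _ * terQuad (fun i => C (a i)) (fun i => C (w i)) +
    _ * terQuad (fun i => C (a i)) (fun i => C (v i)) +
    _ * terPolar (fun i => C (a i)) (fun i => C (u i)) (fun i => C (w i)) +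
    _ * terPolar (fun i => C (a i)) (fun i => C (u i)) (fun i => C (v i)) +
    _ * terPolar (fun i => C (a i)) (fun i => C (v i)) (fun i => C (w i)) = C _ * _
  rw [← map_terQuad, ← map_terQuad, ← map_terQuad, ← map_terPolar, ← map_terPolar, ← map_terPolar,
    hu0, hv, huv, huw, hvw, map_zero, map_one, map_neg]
  ring

/-- The values of a quadratic form with normal form `x z - y²`. -/
theorem aeval_of_normal_form {k F : Type*} [Field k] [Fintype k] [Field F] [Algebra k F]
    {f : MvPolynomial (Fin 3) k} {N : Vec 2 k ≃ₗ[k] Vec 2 k} {c : k}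
    (h : conicEq N.symm f =
      MvPolynomial.C c * (MvPolynomial.X 0 * MvPolynomial.X 2 - MvPolynomial.X 1 ^ 2))
    (w : Vec 2 F) : MvPolynomial.aeval (extLin F N.toLinearMap w) f =
      algebraMap k F c * (w 0 * w 2 - w 1 ^ 2) := by
  have := aeval_conicEq N.symm f w
  rw [h] at this
  rw [show N.toLinearMap = N.symm.symm.toLinearMap from rfl, ← this]
  simp [MvPolynomial.algHom_C]

end Conics

/-! ### Change of frame -/

section Frames

variable {k K F : Type*} [Field k] [Fintype k] [Field K] [Field F]
  [Algebra k K] [Algebra k F] [Algebra K F] (m : Bose k K)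
  (N : Vec 2 k ≃ₗ[k] Vec 2 k) (M : Vec 2 K ≃ₗ[K] Vec 2 K)

/-- The frame `M` followed by a change of coordinates defined over `k`. -/
def frameTrans : Vec 2 K ≃ₗ[K] Vec 2 K :=
  (LinearEquiv.ofInjectiveEndo (extLin K N.toLinearMap) (extLin_injective K _ N.injective)).trans M

variable {N M}

theorem frameTrans_apply (u : Vec 2 K) :
    frameTrans N M u = M (extLin K N.toLinearMap u) := rfl

theorem frameTrans_toLinearMap :
    (frameTrans N M).toLinearMap = M.toLinearMap ∘ₗ extLin K N.toLinearMap := rfl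

theorem extLin_frameTrans [IsScalarTower k K F] (u : Vec 2 F) :
    extLin F (frameTrans N M).toLinearMap u =
      extLin F M.toLinearMap (extLin F N.toLinearMap u) := by
  rw [frameTrans_toLinearMap, extLin_comp, extLin_extLin]
  rfl

theorem extLin_symm_frameTrans [IsScalarTower k K F] (u : Vec 2 F) :
    extLin F M.symm.toLinearMap (extLin F (frameTrans N M).toLinearMap u) =
      extLin F N.toLinearMap u := by
  rw [extLin_frameTrans, extLin_extLin_symm]

theorem Bose.frameComp_frameTrans :
    m.frameComp M = extLin K N.toLinearMap ∘ₗ m.frameComp (frameTrans N M) := by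
  refine LinearMap.ext fun v => ?_
  apply M.injective
  simp only [LinearMap.comp_apply, ← frameTrans_apply, Bose.frameComp, LinearEquiv.coe_coe,
    LinearEquiv.apply_symm_apply]

theorem Bose.Y_frameTrans [IsScalarTower k K F] (j : ℕ) (v : Vec 8 F) :
    m.Y M F j v = extLin F N.toLinearMap (m.Y (frameTrans N M) F j v) := by
  rw [Bose.Y, m.frameComp_frameTrans (N := N), twist_comp, twist_extLin]
  rfl

/-- Two vectors are proportional (one of them may be zero). -/
def Parallel {n : ℕ} (u v : Vec n F) : Prop := ∀ a b, u a * v b = u b * v a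

theorem parallel_iff {n : ℕ} {u v : Vec n F} :
    Parallel u v ↔ ∃ (x : Vec n F) (α β : F), u = α • x ∧ v = β • x := by
  constructor
  · intro h
    by_cases hu : u = 0
    · exact ⟨v, 0, 1, by simp [hu], by simp⟩
    obtain ⟨i, hi⟩ := Function.ne_iff.mp hu
    have hi : u i ≠ 0 := hi
    refine ⟨u, 1, v i / u i, by simp, ?_⟩
    ext b
    have := h i b
    simp only [Pi.smul_apply, smul_eq_mul]
    field_simp
    linear_combination this
  · rintro ⟨x, α, β, rfl, rfl⟩ a b
    simp only [Pi.smul_apply, smul_eq_mul]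
    ring

theorem Parallel.map {n r : ℕ} {u v : Vec n F} (h : Parallel u v) (T : Vec n F →ₗ[F] Vec r F) :
    Parallel (T u) (T v) := by
  obtain ⟨x, α, β, rfl, rfl⟩ := parallel_iff.mp h
  exact parallel_iff.mpr ⟨T x, α, β, map_smul _ _ _, map_smul _ _ _⟩

theorem parallel_map_iff {n r : ℕ} {u v : Vec n F} {T : Vec n F →ₗ[F] Vec r F}
    (hT : Function.Injective T) : Parallel (T u) (T v) ↔ Parallel u v := by
  refine ⟨fun h => ?_, fun h => h.map T⟩
  obtain ⟨S, hS⟩ := T.exists_leftInverse_of_injective (LinearMap.ker_eq_bot.mpr hT)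
  have := h.map S
  rwa [← LinearMap.comp_apply, ← LinearMap.comp_apply, hS] at this

theorem Parallel.smul {n : ℕ} {u v : Vec n F} (h : Parallel u v) (a b : F) :
    Parallel (a • u) (b • v) := by
  obtain ⟨x, α, β, rfl, rfl⟩ := parallel_iff.mp h
  exact parallel_iff.mpr ⟨x, a * α, b * β, by rw [smul_smul], by rw [smul_smul]⟩

/-- A change of coordinates over `k` permutes the rational vectors, so the subplane may be read in
the frame adapted to the conic. -/
theorem mem_subplane_iff {P : PG 2 K} :
    P ∈ subplane k M ↔
      ∃ x : Vec 2 k, IsRep P (frameTrans N M (coordMap (algebraMap k K) x)) := by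
  have key : ∀ (x : PG 2 k) {v}, IsRep x v →
      IsRep (ptLin M (extPt K x)) (M (coordMap (algebraMap k K) v)) :=
    fun x v h => (h.ptMap _).ptLin M
  constructor
  · rintro ⟨x, rfl⟩
    refine ⟨N.symm x.rep, ?_⟩
    rw [frameTrans_apply, extLin_coordMap]
    simpa using key x (isRep_rep x)
  · rintro ⟨x, hx⟩
    have hx0 : x ≠ 0 := by
      rintro rfl
      exact hx.ne_zero (by simp)
    have hN : N x ≠ 0 := by simpa using hx0
    refine ⟨Projectivization.mk k (N x) hN, ?_⟩
    refine (key _ (isRep_mk hN)).unique ?_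
    rwa [frameTrans_apply, extLin_coordMap] at hx

/-- Matrices over `k` commute with Frobenius, so in the adapted frame too the collineation is plain
Frobenius on coordinates. -/
theorem isRep_planeConj {P : PG 2 K} {u : Vec 2 K} (h : IsRep P (frameTrans N M u)) :
    IsRep (planeConj k M P) (frameTrans N M (coordMap (frob k K) u)) := by
  have h1 := ((h.ptLin M.symm).ptMap (frob k K)).ptLin M
  rwa [frameTrans_apply, M.symm_apply_apply, coordMap_frob_extLin, ← frameTrans_apply] at h1

theorem exists_isRep_frame (M : Vec 2 K ≃ₗ[K] Vec 2 K) (P : PG 2 F) :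
    ∃ u, IsRep P (extLin F M.toLinearMap u) :=
  ⟨extLin F M.symm.toLinearMap P.rep, by rw [extLin_symm_extLin]; exact isRep_rep P⟩

variable {f : MvPolynomial (Fin 3) k} {c : k}

theorem aeval_smul_of_normal_form (h : conicEq N.symm f =
      MvPolynomial.C c * (MvPolynomial.X 0 * MvPolynomial.X 2 - MvPolynomial.X 1 ^ 2))
    (hc : c ≠ 0) {b : F} (hb : b ≠ 0) (w : Vec 2 F) :
    MvPolynomial.aeval (b • extLin F N.toLinearMap w) f = 0 ↔ w 0 * w 2 = w 1 ^ 2 := by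
  have hc' : algebraMap k F c ≠ 0 := by simpa using hc
  rw [← map_smul, aeval_of_normal_form h]
  simp only [Pi.smul_apply, smul_eq_mul, mul_eq_zero, hc', false_or]
  rw [show b * w 0 * (b * w 2) - (b * w 1) ^ 2 = b ^ 2 * (w 0 * w 2 - w 1 ^ 2) by ring]
  simp [hb, sub_eq_zero]

theorem mem_fqConic_iff (h : conicEq N.symm f =
      MvPolynomial.C c * (MvPolynomial.X 0 * MvPolynomial.X 2 - MvPolynomial.X 1 ^ 2))
    (hc : c ≠ 0) {P : PG 2 K} :
    P ∈ fqConic M f ↔ ∃ x : Vec 2 k, x 0 * x 2 = x 1 ^ 2 ∧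
      IsRep P (frameTrans N M (coordMap (algebraMap k K) x)) := by
  have key : ∀ (x : PG 2 k) {v}, IsRep x v →
      IsRep (ptLin M (extPt K x)) (M (coordMap (algebraMap k K) v)) :=
    fun x v h => (h.ptMap _).ptLin M
  have hloc : ∀ (x : PG 2 k) {v}, IsRep x (N v) →
      (x ∈ locus k {f} ↔ v 0 * v 2 = v 1 ^ 2) := by
    intro x v hv
    obtain ⟨b, hb, he⟩ := (isRep_rep x).exists_smul hv
    rw [← aeval_smul_of_normal_form h hc hb, extLin_self]
    simp [locus, he]
  constructor
  · rintro ⟨x, hx, rfl⟩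
    have hr : IsRep x (N (N.symm x.rep)) := by rw [N.apply_symm_apply]; exact isRep_rep x
    refine ⟨N.symm x.rep, (hloc x hr).mp hx, ?_⟩
    rw [frameTrans_apply, extLin_coordMap]
    exact key x hr
  · rintro ⟨x, hx, hP⟩
    have hx0 : x ≠ 0 := by
      rintro rfl
      exact hP.ne_zero (by simp)
    have hN : N x ≠ 0 := by simpa using hx0
    refine ⟨Projectivization.mk k (N x) hN, (hloc _ (isRep_mk hN)).mpr hx, ?_⟩
    refine (key _ (isRep_mk hN)).unique ?_
    rwa [frameTrans_apply, extLin_coordMap] at hP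

theorem mem_conicExt_iff [IsScalarTower k K F] (h : conicEq N.symm f =
      MvPolynomial.C c * (MvPolynomial.X 0 * MvPolynomial.X 2 - MvPolynomial.X 1 ^ 2))
    (hc : c ≠ 0) {P : PG 2 F} {u : Vec 2 F}
    (hu : IsRep P (extLin F (frameTrans N M).toLinearMap u)) :
    P ∈ conicExt F M f ↔ u 0 * u 2 = u 1 ^ 2 := by
  obtain ⟨b, hb, he⟩ := (isRep_rep P).exists_smul hu
  rw [← aeval_smul_of_normal_form h hc hb, ← extLin_symm_frameTrans (M := M), ← map_smul, ← he,
    ← aeval_conicEq]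
  simp [conicExt, locus]

/-- The equations of the variety in the coordinates of the transversal planes. -/
theorem Bose.mem_conicVariety_iff [IsScalarTower k K F] (hK : Module.finrank k K = 3)
    (h : conicEq N.symm f =
      MvPolynomial.C c * (MvPolynomial.X 0 * MvPolynomial.X 2 - MvPolynomial.X 1 ^ 2))
    (hc : c ≠ 0) {S6 : Submodule k (Vec 8 k)} {P : PG 8 F} {v : Vec 8 F} (hv : IsRep P v) :
    P ∈ m.conicVariety S6 M f F ↔
      (∀ j < 3, Parallel (m.Y (frameTrans N M) F j v) (m.Y (frameTrans N M) F (j + 1) v) ∧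
        m.Y (frameTrans N M) F j v 0 * m.Y (frameTrans N M) F j v 2 =
          m.Y (frameTrans N M) F j v 1 ^ 2) ∧ v ∈ ext F S6 := by
  obtain ⟨b, hb, he⟩ := (isRep_rep P).exists_smul hv
  have hpar : ∀ j, Parallel (m.Y M F j P.rep) (m.Y M F (j + 1) P.rep) ↔
      Parallel (m.Y (frameTrans N M) F j v) (m.Y (frameTrans N M) F (j + 1) v) := by
    intro j
    rw [m.Y_frameTrans (N := N) (M := M), m.Y_frameTrans (N := N) (M := M),
      parallel_map_iff (extLin_injective F _ N.injective), he, map_smul, map_smul]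
    refine ⟨fun h => ?_, fun h => h.smul b b⟩
    have := h.smul b⁻¹ b⁻¹
    rwa [smul_smul, smul_smul, inv_mul_cancel₀ hb, one_smul, one_smul] at this
  change (∀ Q ∈ m.conicQuadrics M f, MvPolynomial.aeval P.rep Q = 0) ∧ _ ↔ _
  rw [m.aeval_conicQuadrics_iff M hK, hv.mem_pts]
  refine and_congr (forall₂_congr fun j _ => and_congr (hpar j) ?_) Iff.rfl
  rw [← aeval_smul_of_normal_form h hc hb, m.Y_frameTrans (N := N) (M := M), he, map_smul, map_smul]

/-- The points over `k` of the variety are its rational points over `K`. -/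
theorem Bose.extPt_mem_conicVariety (hK : Module.finrank k K = 3)
    (h : conicEq N.symm f =
      MvPolynomial.C c * (MvPolynomial.X 0 * MvPolynomial.X 2 - MvPolynomial.X 1 ^ 2))
    (hc : c ≠ 0) {S6 : Submodule k (Vec 8 k)} {P : PG 8 k} :
    extPt K P ∈ m.conicVariety S6 M f K ↔ P ∈ m.conicVariety S6 M f k := by
  have hr : IsRep (extPt K P) (coordMap (algebraMap k K) P.rep) := (isRep_rep P).ptMap _
  have hQ : (∀ Q ∈ m.conicQuadrics M f,
      MvPolynomial.aeval (coordMap (algebraMap k K) P.rep) Q = 0) ↔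
      ∀ Q ∈ m.conicQuadrics M f, MvPolynomial.aeval P.rep Q = 0 := by
    refine forall₂_congr fun Q _ => ?_
    rw [show (coordMap (algebraMap k K) P.rep : Vec 8 K) = algebraMap k K ∘ P.rep from rfl]
    have : MvPolynomial.aeval (algebraMap k K ∘ P.rep) Q =
        algebraMap k K (MvPolynomial.aeval P.rep Q) := MvPolynomial.aeval_algebraMap_apply _ _ _
    rw [this, map_eq_zero]
  have h2 := m.aeval_conicQuadrics_iff (F := K) M hK f (coordMap (algebraMap k K) P.rep)
  rw [m.mem_conicVariety_iff hK h hc hr, coordMap_mem_ext_iff]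
  change _ ↔ (∀ Q ∈ m.conicQuadrics M f, MvPolynomial.aeval P.rep Q = 0) ∧ _
  rw [← hQ, h2, mem_pts_iff, ext_self]
  refine and_congr (forall₂_congr fun j _ => and_congr ?_ ?_) Iff.rfl
  · change _ ↔ Parallel (m.Y M K j _) (m.Y M K (j + 1) _)
    rw [m.Y_frameTrans (N := N) (M := M), m.Y_frameTrans (N := N) (M := M)]
    exact (parallel_map_iff (extLin_injective K _ N.injective)).symm
  · rw [← aeval_smul_of_normal_form h hc (one_ne_zero (α := K)), one_smul,
      ← m.Y_frameTrans (N := N) (M := M)]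

end Frames

/-! ### The line at infinity in a frame -/

section Infinity

variable {k K F : Type*} [Field k] [Fintype k] [Field K] [Field F]
  [Algebra k K] [Algebra k F] [Algebra K F]

/-- In the frame `M`, the line `ℓ` has the equation `a · u = 0`, scaled in such a way that `a · y` is
rational on the 6-space `S6`; and `ℓ` has no rational points. -/
structure Bose.IsLineEq (m : Bose k K) (M : Vec 2 K ≃ₗ[K] Vec 2 K) (ℓ : Submodule K (Vec 2 K))
    (S6 : Submodule k (Vec 8 k)) (a : Vec 2 K) : Prop where
  mem_line : ∀ u, M u ∈ ℓ ↔ dotProduct a u = 0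
  mem_infinity : ∀ v, v ∈ m.infinity ℓ ↔ dotProduct a (m.y M v) = 0
  mem_space : ∀ v ∈ S6, ∃ c, dotProduct a (m.y M v) = algebraMap k K c
  indep : ∀ x : Vec 2 k, dotProduct a (coordMap (algebraMap k K) x) = 0 → x = 0

theorem map_dotProduct {F' : Type*} [Field F'] (σ : F →+* F') {n : ℕ} (a u : Vec n F) :
    σ (dotProduct a u) = dotProduct (coordMap σ a) (coordMap σ u) := by
  simp [dotProduct, coordMap_apply]

theorem dotProduct_smul' {n : ℕ} (a u : Vec n F) (c : F) :
    dotProduct (c • a) u = c * dotProduct a u := by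
  rw [smul_dotProduct, smul_eq_mul]

theorem Bose.mem_infinity_of_mem_line (m : Bose k K) {M : Vec 2 K ≃ₗ[K] Vec 2 K}
    (hK : Module.finrank k K = 3) {ℓ : Submodule K (Vec 2 K)} {a : Vec 2 K}
    (ha : ∀ u, M u ∈ ℓ ↔ dotProduct a u = 0) (v : Vec 8 k) :
    v ∈ m.infinity ℓ ↔ dotProduct a (m.y M v) = 0 := by
  change coordMap (algebraMap k K) v ∈ ℓ.map m.toVec ⊔ conj k (ℓ.map m.toVec) ⊔
    conj k (conj k (ℓ.map m.toVec)) ↔ _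
  rw [m.mem_sup_conj_iff M hK]
  constructor
  · intro h
    obtain ⟨u, hu, e⟩ := h 0 (by omega)
    rw [m.Y_coordMap] at e
    have : m.y M v = u := e
    rw [this]
    exact (ha u).mp hu
  · intro h j _
    exact ⟨m.y M v, (ha _).mpr h, m.Y_coordMap M j v⟩

theorem exists_line_equation {W : Submodule K (Vec 2 K)} (hW : Module.finrank K W = 2)
    (M : Vec 2 K ≃ₗ[K] Vec 2 K) : ∃ a : Vec 2 K, a ≠ 0 ∧ ∀ u, M u ∈ W ↔ dotProduct a u = 0 := by
  obtain ⟨φ, hφ, hle⟩ := Submodule.exists_le_ker_of_lt_top W (by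
    rw [lt_top_iff_ne_top]
    rintro rfl
    rw [finrank_top, Module.finrank_fin_fun] at hW
    omega)
  have hker : W = LinearMap.ker φ := by
    refine Submodule.eq_of_le_of_finrank_le hle ?_
    have h1 := LinearMap.finrank_range_add_finrank_ker φ
    have h2 : 0 < Module.finrank K (LinearMap.range φ) := by
      rw [Module.finrank_pos_iff_exists_ne_zero]
      obtain ⟨v, hv⟩ := DFunLike.ne_iff.mp hφ
      exact ⟨⟨φ v, v, rfl⟩, fun h => hv (congrArg Subtype.val h)⟩
    rw [Module.finrank_fin_fun] at h1
    omega
  have hdot : ∀ u, φ (M u) = dotProduct (fun i => φ (M (Pi.single i 1))) u := by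
    intro u
    have := LinearMap.pi_apply_eq_sum_univ (φ ∘ₗ M.toLinearMap) u
    have h : ∀ x : Fin 3, (fun j => if x = j then (1 : K) else 0) = Pi.single x 1 := by
      intro x
      ext j
      simp [Pi.single_apply, eq_comm]
    simpa [h, dotProduct, mul_comm] using this
  refine ⟨fun i => φ (M (Pi.single i 1)), ?_, fun u => ?_⟩
  · intro h
    refine hφ (LinearMap.ext fun v => ?_)
    rw [h] at hdot
    have := hdot (M.symm v)
    simpa using this
  · rw [hker, LinearMap.mem_ker, hdot]

/-- It is the kernel of the surjective `k`-linear map `v ↦ a · y(v)` onto `K`, of dimension `9 - 3`.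
-/
theorem Bose.finrank_infinity (m : Bose k K) {M : Vec 2 K ≃ₗ[K] Vec 2 K}
    (hK : Module.finrank k K = 3) {ℓ : Submodule K (Vec 2 K)} {a : Vec 2 K} (ha0 : a ≠ 0)
    (ha : ∀ u, M u ∈ ℓ ↔ dotProduct a u = 0) : Module.finrank k (m.infinity ℓ) = 6 := by
  have := Module.finite_of_finrank_pos (R := k) (M := K) (by omega)
  let θ : Vec 8 k →ₗ[k] K :=
    { toFun := fun v => dotProduct a (m.y M v)
      map_add' := fun v w => by rw [map_add, dotProduct_add]
      map_smul' := fun c v => by rw [map_smul, dotProduct_smul]; rfl }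
  have hker : m.infinity ℓ = LinearMap.ker θ := by
    ext v
    rw [m.mem_infinity_of_mem_line hK ha]
    rfl
  have hs : Function.Surjective θ := by
    intro z
    obtain ⟨i, hi⟩ := Function.ne_iff.mp ha0
    obtain ⟨v, hv⟩ := (m.y_bijective M hK).2 (Pi.single i (z / a i))
    refine ⟨v, ?_⟩
    change dotProduct a (m.y M v) = z
    rw [hv, dotProduct_single, mul_div_cancel₀ _ hi]
  have h1 := LinearMap.finrank_range_add_finrank_ker θ
  rw [LinearMap.range_eq_top.mpr hs, finrank_top, hK, Module.finrank_fin_fun, ← hker] at h1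
  omega

/-- The 6-space is spanned by the hyperplane at infinity and one further vector `v₀`. Dividing an
equation of the line by its value at `v₀` makes it vanish at infinity and take the value 1 at `v₀`,
so it has values in `k` on the whole 6-space. -/
theorem Bose.exists_isLineEq (m : Bose k K) {M : Vec 2 K ≃ₗ[K] Vec 2 K}
    (hK : Module.finrank k K = 3) {ℓ : Submodule K (Vec 2 K)} (hℓ : Module.finrank K ℓ = 2)
    {S6 : Submodule k (Vec 8 k)} (hS6 : Module.finrank k S6 = 7) (hinf : m.infinity ℓ ≤ S6)
    (hrat : ∀ x : Vec 2 k, M (coordMap (algebraMap k K) x) ∈ ℓ → x = 0) :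
    ∃ a, m.IsLineEq M ℓ S6 a := by
  obtain ⟨a, ha0, ha⟩ := exists_line_equation hℓ M
  have hmem := m.mem_infinity_of_mem_line hK ha
  have hfin := m.finrank_infinity hK ha0 ha
  obtain ⟨v₀, hv₀, hv₀'⟩ : ∃ v ∈ S6, v ∉ m.infinity ℓ := by
    by_contra! h
    have := Submodule.finrank_mono (show S6 ≤ m.infinity ℓ from h)
    omega
  have hw : dotProduct a (m.y M v₀) ≠ 0 := fun h => hv₀' ((hmem v₀).mpr h)
  have hw' := inv_ne_zero hw
  have hsup : S6 = m.infinity ℓ ⊔ Submodule.span k {v₀} := by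
    refine (Submodule.eq_of_le_of_finrank_le (sup_le hinf ?_) ?_).symm
    · rwa [Submodule.span_singleton_le_iff_mem]
    · have hlt : m.infinity ℓ < m.infinity ℓ ⊔ Submodule.span k {v₀} := by
        refine lt_of_le_of_ne le_sup_left fun h => hv₀' ?_
        rw [h]
        exact Submodule.mem_sup_right (Submodule.mem_span_singleton_self v₀)
      have := Submodule.finrank_lt_finrank_of_lt hlt
      omega
  refine ⟨(dotProduct a (m.y M v₀))⁻¹ • a, fun u => ?_, fun v => ?_, fun v hv => ?_, fun x hx => ?_⟩
  · rw [ha, dotProduct_smul', mul_eq_zero, or_iff_right hw']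
  · rw [hmem, dotProduct_smul', mul_eq_zero, or_iff_right hw']
  · rw [hsup] at hv
    obtain ⟨v₁, hv₁, _, hv₂, rfl⟩ := Submodule.mem_sup.mp hv
    obtain ⟨c, rfl⟩ := Submodule.mem_span_singleton.mp hv₂
    refine ⟨c, ?_⟩
    rw [dotProduct_smul', map_add, dotProduct_add, (hmem v₁).mp hv₁, zero_add, map_smul,
      dotProduct_smul, Algebra.smul_def, mul_comm, mul_assoc, mul_inv_cancel₀ hw, mul_one]
  · rw [dotProduct_smul', mul_eq_zero, or_iff_right hw'] at hx
    exact hrat x ((ha _).mpr hx)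

variable {m : Bose k K} {M : Vec 2 K ≃ₗ[K] Vec 2 K} {ℓ : Submodule K (Vec 2 K)}
  {S6 : Submodule k (Vec 8 k)} {a : Vec 2 K}

theorem Bose.IsLineEq.ne_zero (h : m.IsLineEq M ℓ S6 a) : a ≠ 0 := by
  rintro rfl
  have := congrFun (h.indep (Pi.single 0 1) (by simp)) 0
  simp at this

theorem coordMap_ne_zero {F' : Type*} [Field F'] (σ : F →+* F') {n : ℕ} {a : Vec n F}
    (ha : a ≠ 0) : coordMap σ a ≠ 0 := fun h => ha (coordMap_injective σ (h.trans (map_zero _).symm))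

theorem exists_dotProduct_eq {n : ℕ} {a : Vec n F} (ha : a ≠ 0) (z : F) :
    ∃ u, dotProduct a u = z := by
  obtain ⟨i, hi⟩ := Function.ne_iff.mp ha
  exact ⟨Pi.single i (z / a i), by rw [dotProduct_single, mul_div_cancel₀ _ hi]⟩

/-- The value at `Y j v` of the `j`-th conjugate of the equation `a` of the line at infinity. -/
def Bose.infForm (m : Bose k K) (M : Vec 2 K ≃ₗ[K] Vec 2 K) (a : Vec 2 K) (F : Type*) [Field F]
    [Algebra K F] (j : ℕ) : Vec 8 F →ₗ[F] F :=
  dotProductBilin F F (coordMap (conjEmb k K F j) a) ∘ₗ m.Y M F j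

theorem Bose.infForm_apply (j : ℕ) (v : Vec 8 F) :
    m.infForm M a F j v = dotProduct (coordMap (conjEmb k K F j) a) (m.Y M F j v) := rfl

theorem Bose.infForm_coordMap [IsScalarTower k K F] (j : ℕ) (v : Vec 8 k) :
    m.infForm M a F j (coordMap (algebraMap k F) v) =
      conjEmb k K F j (dotProduct a (m.y M v)) := by
  rw [Bose.infForm_apply, m.Y_coordMap, map_dotProduct]

theorem Bose.IsLineEq.exists_infForm (h : m.IsLineEq M ℓ S6 a) (hK : Module.finrank k K = 3)
    (z : ℕ → F) : ∃ v, ∀ j < 3, m.infForm M a F j v = z j := by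
  choose u hu using fun j => exists_dotProduct_eq (coordMap_ne_zero (conjEmb k K F j) h.ne_zero) (z j)
  obtain ⟨v, hv⟩ := m.exists_Y M hK u
  exact ⟨v, fun j hj => by rw [Bose.infForm_apply, hv j hj, hu]⟩

/-- On rational vectors of the 6-space `a · y` lies in `k`, so its three conjugates agree. These are
two independent conditions, and `9 - 2 = 7` is the rank of the 6-space. -/
theorem Bose.IsLineEq.mem_ext_space_iff [IsScalarTower k K F] (h : m.IsLineEq M ℓ S6 a)
    (hK : Module.finrank k K = 3) (hS6 : Module.finrank k S6 = 7) (v : Vec 8 F) :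
    v ∈ ext F S6 ↔ m.infForm M a F 1 v = m.infForm M a F 0 v ∧
      m.infForm M a F 2 v = m.infForm M a F 0 v := by
  let T : Vec 8 F →ₗ[F] F × F := (m.infForm M a F 1 - m.infForm M a F 0).prod
    (m.infForm M a F 2 - m.infForm M a F 0)
  have hs : Function.Surjective T := by
    rintro ⟨x, y⟩
    obtain ⟨v, hv⟩ := h.exists_infForm (F := F) hK fun j => if j = 0 then 0 else if j = 1 then x else y
    refine ⟨v, ?_⟩
    simp [T, hv]
  have hker : ext F S6 = LinearMap.ker T := by
    refine Submodule.eq_of_le_of_finrank_eq (Submodule.span_le.mpr ?_) ?_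
    · rintro _ ⟨w, hw, rfl⟩
      obtain ⟨c, hc⟩ := h.mem_space w hw
      have : ∀ j, m.infForm M a F j (coordMap (algebraMap k F) w) = algebraMap k F c := by
        intro j
        rw [Bose.infForm_coordMap, hc, conjEmb_algebraMap]
      simp [T, this]
    · have h1 := LinearMap.finrank_range_add_finrank_ker T
      rw [LinearMap.range_eq_top.mpr hs, finrank_top, Module.finrank_fin_fun, Module.finrank_prod,
        Module.finrank_self] at h1
      rw [ext, finrank_subMap, hS6]
      omega
  rw [hker, LinearMap.mem_ker]
  simp [T, sub_eq_zero]

theorem Bose.IsLineEq.mem_ext_infinity_iff [IsScalarTower k K F] (h : m.IsLineEq M ℓ S6 a)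
    (hK : Module.finrank k K = 3) (v : Vec 8 F) :
    v ∈ ext F (m.infinity ℓ) ↔ ∀ j < 3, m.infForm M a F j v = 0 := by
  let T : Vec 8 F →ₗ[F] (Fin 3 → F) := LinearMap.pi fun j => m.infForm M a F j
  have hs : Function.Surjective T := by
    intro z
    obtain ⟨v, hv⟩ := h.exists_infForm (F := F) hK fun j => if h : j < 3 then z ⟨j, h⟩ else 0
    refine ⟨v, ?_⟩
    ext j
    have := hv j j.2
    simp only [j.2, dif_pos] at this
    exact this
  have hker : ext F (m.infinity ℓ) = LinearMap.ker T := by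
    refine Submodule.eq_of_le_of_finrank_eq (Submodule.span_le.mpr ?_) ?_
    · rintro _ ⟨w, hw, rfl⟩
      have hw := (h.mem_infinity w).mp hw
      rw [SetLike.mem_coe, LinearMap.mem_ker]
      ext j
      change m.infForm M a F j (coordMap (algebraMap k F) w) = 0
      rw [Bose.infForm_coordMap, hw, map_zero]
    · have h1 := LinearMap.finrank_range_add_finrank_ker T
      rw [LinearMap.range_eq_top.mpr hs, finrank_top, Module.finrank_fin_fun,
        Module.finrank_fin_fun] at h1
      rw [ext, finrank_subMap, m.finrank_infinity hK h.ne_zero h.mem_line]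
      omega
  rw [hker, LinearMap.mem_ker, funext_iff]
  exact ⟨fun h j hj => h ⟨j, hj⟩, fun h j => h j j.2⟩

theorem Bose.IsLineEq.mem_ext_line_iff (h : m.IsLineEq M ℓ S6 a)
    (hℓ : Module.finrank K ℓ = 2) (u : Vec 2 F) :
    extLin F M.toLinearMap u ∈ ext F ℓ ↔
      dotProduct (coordMap (algebraMap K F) a) u = 0 := by
  let T : Vec 2 F →ₗ[F] F :=
    dotProductBilin F F (coordMap (algebraMap K F) a) ∘ₗ extLin F M.symm.toLinearMap
  have hs : Function.Surjective T := by
    intro z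
    obtain ⟨u, hu⟩ := exists_dotProduct_eq (coordMap_ne_zero (algebraMap K F) h.ne_zero) z
    refine ⟨extLin F M.toLinearMap u, ?_⟩
    change dotProduct _ (extLin F M.symm.toLinearMap _) = _
    rw [extLin_extLin_symm, hu]
  have hker : ext F ℓ = LinearMap.ker T := by
    refine Submodule.eq_of_le_of_finrank_eq (Submodule.span_le.mpr ?_) ?_
    · rintro _ ⟨w, hw, rfl⟩
      change dotProduct _ (extLin F M.symm.toLinearMap _) = 0
      rw [extLin_coordMap, ← map_dotProduct, LinearEquiv.coe_coe, (h.mem_line _).mp, map_zero]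
      simpa using hw
    · have h1 := LinearMap.finrank_range_add_finrank_ker T
      rw [LinearMap.range_eq_top.mpr hs, finrank_top, Module.finrank_self,
        Module.finrank_fin_fun] at h1
      rw [ext, finrank_subMap, hℓ]
      omega
  rw [hker, LinearMap.mem_ker]
  change dotProduct _ (extLin F M.symm.toLinearMap _) = 0 ↔ _
  rw [extLin_extLin_symm]

/-- The three conjugates of the line at infinity are not concurrent. -/
theorem Bose.IsLineEq.det_ne_zero (h : m.IsLineEq M ℓ S6 a) (hK : Module.finrank k K = 3) :
    dotProduct (coordMap (frob k K ^ 0) a)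
      (crossProduct (coordMap (frob k K ^ 1) a) (coordMap (frob k K ^ 2) a)) ≠ 0 := by
  have := Module.finite_of_finrank_pos (R := k) (M := K) (by omega)
  rw [triple_product_eq_det]
  intro hdet
  -- Concurrent conjugates would give a non-trivial relation `z` between the three vectors
  -- `a^(q^j)`.
  obtain ⟨z, hz, hz0⟩ := Matrix.exists_vecMul_eq_zero_iff.mpr hdet
  apply hz
  refine conjEmb_independent (k := k) hK z fun b => ?_
  let θ : Vec 2 k →ₗ[k] K :=
    { toFun := fun x => dotProduct a (coordMap (algebraMap k K) x)
      map_add' := fun x y => by rw [map_add, dotProduct_add]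
      map_smul' := fun c x => by
        rw [coordMap_smul, dotProduct_smul, algebraMap_smul]; rfl }
  have hi : Function.Injective θ := (injective_iff_map_eq_zero θ).mpr h.indep
  -- The line has no rational points, so `x ↦ a · x` is injective from `k³` to `K` and, by
  -- dimension, surjective. The relation `z` thus annihilates the conjugates of every element of
  -- `K`, against the independence of the embeddings.
  have hs : Function.Surjective θ := by
    rwa [← LinearMap.injective_iff_surjective_of_finrank_eq_finrank]
    rw [Module.finrank_fin_fun, hK]
  obtain ⟨x, rfl⟩ := hs b
  have key : ∀ j, conjEmb k K K j (θ x) =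
      ∑ i, (frob k K ^ j) (a i) * algebraMap k K (x i) := by
    intro j
    change conjEmb k K K j (dotProduct a _) = _
    rw [map_dotProduct]
    refine Finset.sum_congr rfl fun i _ => ?_
    rw [coordMap_apply, coordMap_apply, coordMap_apply, conjEmb_algebraMap]
    rfl
  simp only [key, Finset.mul_sum]
  rw [Finset.sum_comm]
  refine Finset.sum_eq_zero fun i _ => ?_
  have hzi := congrFun hz0 i
  simp only [Matrix.vecMul, dotProduct, Fin.sum_univ_three, Pi.zero_apply] at hzi
  simp only [Fin.sum_univ_three]
  have e : z 0 * (frob k K ^ 0) (a i) + z 1 * (frob k K ^ 1) (a i) +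
    z 2 * (frob k K ^ 2) (a i) = 0 := hzi
  change z 0 * ((frob k K ^ 0) (a i) * algebraMap k K (x i)) +
    z 1 * ((frob k K ^ 1) (a i) * algebraMap k K (x i)) +
    z 2 * ((frob k K ^ 2) (a i) * algebraMap k K (x i)) = 0
  linear_combination (algebraMap k K (x i)) * e

end Infinity

/-! ### Points of a conic and binary forms -/

section Forms

variable {F : Type*} [Field F]

theorem veronese_two (s t : F) : veronese 2 s t = ![s ^ 2, s * t, t ^ 2] := by
  ext i
  fin_cases i <;> simp [veronese]

theorem veronese_ne_zero {r : ℕ} {s t : F} (h : s ≠ 0 ∨ t ≠ 0) : veronese r s t ≠ 0 := by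
  intro h0
  rcases h with h | h
  · have := congrFun h0 0
    simp [veronese, h] at this
  · have := congrFun h0 (Fin.last r)
    simp [veronese, h] at this

theorem veronese_smul (r : ℕ) (c s t : F) :
    veronese r (c * s) (c * t) = c ^ r • veronese r s t := by
  ext i
  have : c ^ r = c ^ (r - (i : ℕ)) * c ^ (i : ℕ) := by
    rw [← pow_add, Nat.sub_add_cancel (Nat.lt_succ_iff.mp i.2)]
  simp only [veronese, mul_pow, Pi.smul_apply, smul_eq_mul, this]
  ring

theorem coordMap_veronese {F' : Type*} [Field F'] (σ : F →+* F') (r : ℕ) (s t : F) :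
    coordMap σ (veronese r s t) = veronese r (σ s) (σ t) := by
  ext i
  simp [veronese, coordMap_apply]

theorem dotProduct_veronese (a : Vec 2 F) (s t : F) :
    dotProduct a (veronese 2 s t) = binQuad a s t := by
  rw [veronese_two]
  simp [dotProduct, Fin.sum_univ_three, binQuad]

theorem map_binQuad {F' : Type*} [Field F'] (σ : F →+* F') (a : Vec 2 F) (s t : F) :
    σ (binQuad a s t) = binQuad (coordMap σ a) (σ s) (σ t) := by
  simp [binQuad, coordMap_apply]

theorem conic_veronese (s t : F) :
    veronese 2 s t 0 * veronese 2 s t 2 = veronese 2 s t 1 ^ 2 := by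
  simp [veronese_two]; ring

theorem exists_veronese {x : Vec 2 F} (hx : x ≠ 0) (h : x 0 * x 2 = x 1 ^ 2) :
    ∃ c s t : F, c ≠ 0 ∧ (s ≠ 0 ∨ t ≠ 0) ∧ x = c • veronese 2 s t := by
  by_cases h0 : x 0 = 0
  · have h1 : x 1 = 0 := by
      rw [h0, zero_mul] at h
      exact pow_eq_zero_iff (two_ne_zero) |>.mp h.symm
    have h2 : x 2 ≠ 0 := by
      intro h2
      apply hx
      ext i; fin_cases i <;> assumption
    refine ⟨x 2, 0, 1, h2, by simp, ?_⟩
    ext i; fin_cases i <;> simp [veronese_two, h0, h1]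
  · refine ⟨x 0, 1, x 1 / x 0, h0, by simp, ?_⟩
    ext i; fin_cases i
    · simp [veronese_two]
    · simp [veronese_two]; field_simp
    · simp [veronese_two]; field_simp; linear_combination h

/-- The resultant of two binary quadratic forms. -/
def resultant (a b : Vec 2 F) : F :=
  crossProduct a b 0 * crossProduct a b 2 - crossProduct a b 1 ^ 2

/-- The definition evaluates `x z - y²` at the intersection of the lines `a` and `b`; this expansion
is minus the Sylvester determinant. Two lines meet on the conic exactly when the forms they cut out
on it share a zero. -/
theorem resultant_eq (a b : Vec 2 F) : resultant a b =
    (a 1 * b 2 - a 2 * b 1) * (a 0 * b 1 - a 1 * b 0) - (a 2 * b 0 - a 0 * b 2) ^ 2 := by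
  simp [resultant, cross_apply]

theorem map_resultant {F' : Type*} [Field F'] (σ : F →+* F') (a b : Vec 2 F) :
    σ (resultant a b) = resultant (coordMap σ a) (coordMap σ b) := by
  simp [resultant_eq, coordMap_apply]

theorem coordMap_crossProduct {F' : Type*} [Field F'] (σ : F →+* F') (a b : Vec 2 F) :
    coordMap (n := 2) σ (crossProduct a b) = crossProduct (coordMap σ a) (coordMap σ b) := by
  ext i
  fin_cases i <;> simp [cross_apply, coordMap_apply]

/-- Sylvester elimination applied to the sequence `s³, s²t, st², t³` gives `s³ = t³ = 0`. -/
theorem eq_zero_of_binQuad_eq_zero {a b : Vec 2 F} (hr : resultant a b ≠ 0) {s t : F}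
    (ha : binQuad a s t = 0) (hb : binQuad b s t = 0) : s = 0 ∧ t = 0 := by
  rw [resultant_eq] at hr
  unfold binQuad at ha hb
  have := sylvester_eq_zero hr (w := fun n => s ^ (3 - n) * t ^ n)
    (by norm_num; linear_combination s * ha) (by norm_num; linear_combination t * ha)
    (by norm_num; linear_combination s * hb) (by norm_num; linear_combination t * hb)
  simpa using And.intro this.1 this.2.2.2

/-- A sequence of length 7 annihilated by the three products of two of three pairwise coprime
quadratic forms vanishes. -/
theorem sextic_eq_zero {a : ℕ → Vec 2 F} (h01 : resultant (a 0) (a 1) ≠ 0)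
    (h12 : resultant (a 1) (a 2) ≠ 0) (h02 : resultant (a 0) (a 2) ≠ 0) {w : ℕ → F}
    (hw : ∀ i j, i < j → j < 3 → ∀ n < 3,
      a i 0 * (a j 0 * w n + a j 1 * w (n + 1) + a j 2 * w (n + 2)) +
      a i 1 * (a j 0 * w (n + 1) + a j 1 * w (n + 2) + a j 2 * w (n + 3)) +
      a i 2 * (a j 0 * w (n + 2) + a j 1 * w (n + 3) + a j 2 * w (n + 4)) = 0) :
    ∀ n < 7, w n = 0 := by
  rw [resultant_eq] at h01 h12 h02
  -- The contraction of `w` with the form `a j`, a sequence of length five. Contractions with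
  -- different forms commute.
  let u : ℕ → ℕ → F := fun j n => a j 0 * w n + a j 1 * w (n + 1) + a j 2 * w (n + 2)
  have hswap : ∀ i j n, a i 0 * u j n + a i 1 * u j (n + 1) + a i 2 * u j (n + 2) =
      a j 0 * u i n + a j 1 * u i (n + 1) + a j 2 * u i (n + 2) := by
    intro i j n
    simp only [u, add_assoc, Nat.reduceAdd]
    ring
  have hu : ∀ i j, i < j → j < 3 → ∀ n < 3,
      a i 0 * u j n + a i 1 * u j (n + 1) + a i 2 * u j (n + 2) = 0 := hw
  have hu' : ∀ i j, i < j → j < 3 → ∀ n < 3,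
      a j 0 * u i n + a j 1 * u i (n + 1) + a j 2 * u i (n + 2) = 0 := by
    intro i j hij hj n hn
    rw [← hswap]
    exact hu i j hij hj n hn
  -- The contraction with `a 0` is killed by the coprime forms `a 1` and `a 2`; two overlapping
  -- windows of length four cover its five entries. The same holds for `a 1`, after which `w` itself
  -- is killed by `a 0` and `a 1`.
  have e0 : ∀ n < 2, u 0 n = 0 ∧ u 0 (n + 1) = 0 ∧ u 0 (n + 2) = 0 ∧ u 0 (n + 3) = 0 := by
    intro n hn
    exact sylvester_eq_zero h12 (w := fun i => u 0 (n + i))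
      (hu' 0 1 (by omega) (by omega) n (by omega))
      (hu' 0 1 (by omega) (by omega) (n + 1) (by omega))
      (hu' 0 2 (by omega) (by omega) n (by omega))
      (hu' 0 2 (by omega) (by omega) (n + 1) (by omega))
  have e1 : ∀ n < 2, u 1 n = 0 ∧ u 1 (n + 1) = 0 ∧ u 1 (n + 2) = 0 ∧ u 1 (n + 3) = 0 := by
    intro n hn
    exact sylvester_eq_zero h02 (w := fun i => u 1 (n + i))
      (hu 0 1 (by omega) (by omega) n (by omega))
      (hu 0 1 (by omega) (by omega) (n + 1) (by omega))
      (hu' 1 2 (by omega) (by omega) n (by omega))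
      (hu' 1 2 (by omega) (by omega) (n + 1) (by omega))
  have z0 : ∀ n < 5, u 0 n = 0 := by
    intro n hn
    have := e0 0 (by omega)
    have := e0 1 (by omega)
    interval_cases n <;> tauto
  have z1 : ∀ n < 5, u 1 n = 0 := by
    intro n hn
    have := e1 0 (by omega)
    have := e1 1 (by omega)
    interval_cases n <;> tauto
  have ew : ∀ n < 4, w n = 0 ∧ w (n + 1) = 0 ∧ w (n + 2) = 0 ∧ w (n + 3) = 0 := by
    intro n hn
    exact sylvester_eq_zero h01 (w := fun i => w (n + i)) (z0 n (by omega))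
      (z0 (n + 1) (by omega)) (z1 n (by omega)) (z1 (n + 1) (by omega))
  intro n hn
  have := ew 0 (by omega)
  have := ew 3 (by omega)
  interval_cases n <;> tauto

/-- A binary quadratic form with two given distinct zeros. -/
theorem exists_binQuad_eq_of_zeros (a : Vec 2 F) {s₁ t₁ s₂ t₂ : F} (hd : s₁ * t₂ - s₂ * t₁ ≠ 0)
    (h1 : binQuad a s₁ t₁ = 0) (h2 : binQuad a s₂ t₂ = 0) :
    ∃ c, a 0 = c * (t₁ * t₂) ∧ a 1 = - (c * (t₁ * s₂ + s₁ * t₂)) ∧ a 2 = c * (s₁ * s₂) := by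
  unfold binQuad at h1 h2
  -- For `c (s t₁ - t s₁)(s t₂ - t s₂)` the polar form takes the value `-c (s₁ t₂ - s₂ t₁)²` at the
  -- two zeros, which determines `c`.
  refine ⟨-(2 * a 0 * s₁ * s₂ + a 1 * (s₁ * t₂ + s₂ * t₁) + 2 * a 2 * t₁ * t₂) /
    (s₁ * t₂ - s₂ * t₁) ^ 2, ?_, ?_, ?_⟩
  · field_simp
    linear_combination t₂ ^ 2 * h1 + t₁ ^ 2 * h2
  · field_simp
    linear_combination (-2 * s₂ * t₂) * h1 + (-2 * s₁ * t₁) * h2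
  · field_simp
    linear_combination s₂ ^ 2 * h1 + s₁ ^ 2 * h2

end Forms

/-! ### The parametrised variety -/

section Param

variable {k K F : Type*} [Field k] [Fintype k] [Field K] [Field F]
  [Algebra k K] [Algebra k F] [Algebra K F]

/-- The `j`-th conjugate over `F` of a vector over `K`. -/
def conjVec (k : Type*) {K : Type*} (F : Type*) [Field k] [Fintype k] [Field K] [Field F]
    [Algebra k K] [Algebra K F] {n : ℕ} (a : Vec n K) (j : ℕ) : Vec n F :=
  coordMap (conjEmb k K F j) a

theorem conjVec_apply {n : ℕ} (a : Vec n K) (j : ℕ) (i : Fin (n + 1)) :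
    conjVec k F a j i = conjEmb k K F j (a i) := rfl

theorem conjVec_add_three (hK : Module.finrank k K = 3) {n : ℕ} (a : Vec n K) (j : ℕ) :
    conjVec k F a (j + 3) = conjVec k F a j := by
  rw [conjVec, conjEmb_add_three hK, conjVec]

theorem coordMap_frob_conjVec {n : ℕ} (a : Vec n K) (j : ℕ) :
    coordMap (frob k F) (conjVec k F a j) = conjVec k F a (j + 1) := by
  ext i
  exact frob_conjEmb j (a i)

theorem coordMap_conjEmb_conjVec {n : ℕ} (a : Vec n K) (i j : ℕ) :
    coordMap (conjEmb k K F i) (conjVec k K a j) = conjVec k F a (i + j) := by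
  ext c
  exact conjEmb_frob_pow j i (a c)

/-- The `j`-th conjugate of the quadratic form cut out by the line at infinity on the conic. -/
def Qf (k : Type*) {K F : Type*} [Field k] [Fintype k] [Field K] [Field F]
    [Algebra k K] [Algebra K F] (a : Vec 2 K) (s t : F) (j : ℕ) : F :=
  binQuad (conjVec k F a j) s t

theorem Qf_add_three (hK : Module.finrank k K = 3) (a : Vec 2 K) (s t : F) (j : ℕ) :
    Qf k a s t (j + 3) = Qf k a s t j := by
  rw [Qf, conjVec_add_three hK, Qf]

theorem Parallel.exists_smul {n : ℕ} {x y : Vec n F} (h : Parallel x y) (hx : x ≠ 0) :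
    ∃ c : F, y = c • x := by
  obtain ⟨i, hi⟩ := Function.ne_iff.mp hx
  have hi : x i ≠ 0 := hi
  refine ⟨y i / x i, ?_⟩
  ext b
  have := h i b
  simp only [Pi.smul_apply, smul_eq_mul]
  field_simp
  linear_combination this

theorem Parallel.symm {n : ℕ} {x y : Vec n F} (h : Parallel x y) : Parallel y x := by
  intro a b
  linear_combination h b a

theorem apply_mod_three {α : Type*} {g : ℕ → α} (h : ∀ j, g (j + 3) = g j) (j : ℕ) :
    g (j % 3) = g j := Function.Periodic.map_mod_nat h j

theorem forall_of_lt_three {g : ℕ → Prop} (h : ∀ j, g (j + 3) ↔ g j) (h' : ∀ j < 3, g j) (j : ℕ) :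
    g j := by
  have := apply_mod_three (fun j => propext (h j)) j
  exact this ▸ h' _ (Nat.mod_lt _ (by norm_num))

variable {m : Bose k K} {N : Vec 2 k ≃ₗ[k] Vec 2 k} {M : Vec 2 K ≃ₗ[K] Vec 2 K}
  {ℓ : Submodule K (Vec 2 K)} {S6 : Submodule k (Vec 8 k)} {a : Vec 2 K}
  {f : MvPolynomial (Fin 3) k} {c : k}

theorem Bose.Y_ext (hK : Module.finrank k K = 3) {v w : Vec 8 F}
    (h : ∀ j, m.Y M F j v = m.Y M F j w) : v = w := m.Y_injective M hK fun j _ => h j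

theorem Bose.Y_ne_zero (hK : Module.finrank k K = 3) {v : Vec 8 F} (hv : v ≠ 0) (i : ℕ) :
    m.Y M F i v ≠ 0 ∨ m.Y M F (i + 1) v ≠ 0 ∨ m.Y M F (i + 2) v ≠ 0 := by
  by_contra! h
  apply hv
  have key : ∀ j < 3, m.Y M F (i + j) v = 0 := by
    intro j hj
    interval_cases j
    · exact h.1
    · exact h.2.1
    · exact h.2.2
  refine m.Y_ext (M := M) hK fun j => ?_
  rw [map_zero]
  obtain ⟨d, hd, e⟩ : ∃ d < 3, (i + d) % 3 = j % 3 := by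
    -- This is `j - i` modulo 3.
    refine ⟨(j + 2 * i) % 3, Nat.mod_lt _ (by norm_num), by omega⟩
  rw [← apply_mod_three (m.Y_add_three M hK) j, ← e, apply_mod_three (m.Y_add_three M hK),
    key d hd]

/-- The points of the variety, in terms of a parameter of the conic. -/
theorem Bose.IsLineEq.mem_conicVariety_iff [IsScalarTower k K F]
    (hK : Module.finrank k K = 3) (hS6 : Module.finrank k S6 = 7)
    (h : m.IsLineEq (frameTrans N M) ℓ S6 a) (hf : conicEq N.symm f =
      MvPolynomial.C c * (MvPolynomial.X 0 * MvPolynomial.X 2 - MvPolynomial.X 1 ^ 2))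
    (hc : c ≠ 0) {P : PG 8 F} {v : Vec 8 F} (hv : IsRep P v) :
    P ∈ m.conicVariety S6 M f F ↔ ∃ (s t : F) (α : ℕ → F), (s ≠ 0 ∨ t ≠ 0) ∧
      (∀ j, α (j + 3) = α j) ∧ (∀ j, m.Y (frameTrans N M) F j v = α j • veronese 2 s t) ∧
      ∀ j, α j * Qf k a s t j = α 0 * Qf k a s t 0 := by
  rw [m.mem_conicVariety_iff hK hf hc hv, h.mem_ext_space_iff hK hS6]
  have hY3 := m.Y_add_three (F := F) (frameTrans N M) hK
  set Y := fun j => m.Y (frameTrans N M) F j v with hY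
  have hper : ∀ j, Y (j + 3) = Y j := fun j => by simp only [hY, hY3]
  have hinf : ∀ {s t : F} {α : ℕ → F} (j : ℕ), Y j = α j • veronese 2 s t →
      m.infForm (frameTrans N M) a F j v = α j * Qf k a s t j := by
    intro s t α j hj
    rw [Bose.infForm_apply]
    change dotProduct _ (Y j) = _
    rw [hj, dotProduct_smul, dotProduct_veronese, smul_eq_mul]
    rfl
  constructor
  · rintro ⟨h1, h2⟩
    have hP : ∀ j, Parallel (Y j) (Y (j + 1)) := forall_of_lt_three
      (fun j => by rw [hper, show j + 3 + 1 = j + 1 + 3 by ring, hper]) fun j hj => (h1 j hj).1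
    have hC : ∀ j, Y j 0 * Y j 2 = Y j 1 ^ 2 := forall_of_lt_three
      (fun j => by rw [hper]) fun j hj => (h1 j hj).2
    obtain ⟨i, hi⟩ : ∃ i, Y i ≠ 0 := by
      rcases m.Y_ne_zero (M := frameTrans N M) hK hv.ne_zero 0 with h | h | h
      exacts [⟨_, h⟩, ⟨_, h⟩, ⟨_, h⟩]
    obtain ⟨b, s, t, hb, hst, hx⟩ := exists_veronese hi (hC i)
    -- Proportionality is not transitive when the middle vector is zero. With three cyclic indices
    -- every `j` is equal or adjacent to `i`, so the non-zero vector `Y i` is compared with each `Y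
    -- j` directly.
    have hex : ∀ j, ∃ β : F, Y j = β • veronese 2 s t := by
      have hp : ∀ j, Parallel (Y i) (Y j) := by
        intro j
        have : j % 3 = i % 3 ∨ j % 3 = (i + 1) % 3 ∨ j % 3 = (i + 2) % 3 := by omega
        rcases this with e | e | e <;>
          rw [← apply_mod_three hper j, e, apply_mod_three hper]
        · intro a b; ring
        · exact hP i
        · have := (hP (i + 2)).symm
          rwa [show i + 2 + 1 = i + 3 by ring, hper] at this
      intro j
      obtain ⟨β, hβ⟩ := (hp j).exists_smul hi
      exact ⟨β * b, by rw [hβ, hx, smul_smul]⟩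
    choose β hβ using hex
    -- Reducing the index modulo 3 makes the chosen coefficients periodic.
    have hα : ∀ j, Y j = β (j % 3) • veronese 2 s t := by
      intro j
      rw [← hβ, apply_mod_three hper]
    refine ⟨s, t, fun j => β (j % 3), hst, fun j => by simp, hα, ?_⟩
    have e0 := hinf (α := fun j => β (j % 3)) 0 (hα 0)
    have e1 := hinf (α := fun j => β (j % 3)) 1 (hα 1)
    have e2 := hinf (α := fun j => β (j % 3)) 2 (hα 2)
    refine forall_of_lt_three (fun j => by simp only [Qf_add_three hK, Nat.add_mod_right]) fun j hj => ?_
    interval_cases j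
    · rfl
    · rw [← e0, ← e1]; exact h2.1
    · rw [← e0, ← e2]; exact h2.2
  · rintro ⟨s, t, α, hst, hα3, hα, hQ⟩
    refine ⟨fun j _ => ⟨?_, ?_⟩, ?_, ?_⟩
    · rw [hα, hα]
      exact parallel_iff.mpr ⟨_, _, _, rfl, rfl⟩
    · rw [hα]
      simp only [Pi.smul_apply, smul_eq_mul]
      linear_combination (α j) ^ 2 * conic_veronese s t
    · rw [hinf 1 (hα 1), hinf 0 (hα 0), hQ]
    · rw [hinf 2 (hα 2), hinf 0 (hα 0), hQ]

/-! ### Rational curves -/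

variable (m M) in
/-- The linear map defined over `k` which, in the coordinates of `Γ`, is `w ↦ ∑ w_i p_i`. -/
def Bose.curveMap (hK : Module.finrank k K = 3) {r : ℕ} (p : Fin (r + 1) → Vec 2 K) :
    Vec r k →ₗ[k] Vec 8 k :=
  (LinearEquiv.ofBijective (m.y M) (m.y_bijective M hK)).symm.toLinearMap ∘ₗ
    ∑ i, (LinearMap.proj i : Vec r k →ₗ[k] k).smulRight (p i)

theorem Bose.y_curveMap (hK : Module.finrank k K = 3) {r : ℕ} (p : Fin (r + 1) → Vec 2 K)
    (w : Vec r k) : m.y M (m.curveMap M hK p w) = ∑ i, w i • p i := by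
  have := (LinearEquiv.ofBijective (m.y M) (m.y_bijective M hK)).apply_symm_apply
    (∑ i, w i • p i)
  rw [← this]
  simp [Bose.curveMap]

theorem Bose.Y_curveMap [IsScalarTower k K F] (hK : Module.finrank k K = 3) {r : ℕ}
    (p : Fin (r + 1) → Vec 2 K) (w : Vec r F) (j : ℕ) (b : Fin 3) :
    m.Y M F j (extLin F (m.curveMap M hK p) w) b = ∑ i, conjEmb k K F j (p i b) * w i := by
  have h1 : extLin F (m.curveMap M hK p) w =
      ∑ i, w i • coordMap (algebraMap k F) (m.curveMap M hK p (Pi.single i 1)) := by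
    ext b
    simp [extLin_apply, Finset.sum_apply, coordMap_apply, mul_comm]
  rw [h1, map_sum, Finset.sum_apply]
  refine Finset.sum_congr rfl fun i _ => ?_
  rw [map_smul, m.Y_coordMap, Bose.y_curveMap]
  simp [coordMap_apply, Pi.single_apply, mul_comm]

theorem Bose.curveMap_eq_zero (hK : Module.finrank k K = 3) {r : ℕ}
    {p : Fin (r + 1) → Vec 2 K} {w : Vec r k} (h : m.curveMap M hK p w = 0) (j : ℕ) (b : Fin 3) :
    ∑ i, conjEmb k K K j (p i b) * algebraMap k K (w i) = 0 := by
  have := m.Y_curveMap (F := K) (M := M) hK p (coordMap (algebraMap k K) w) j b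
  rw [extLin_coordMap, h, map_zero, map_zero] at this
  exact this.symm

theorem conjPt_nrc {r n : ℕ} {A : Vec r k →ₗ[k] Vec n k} {P : PG n F} {s t : F}
    (h : IsRep P (extLin F A (veronese r s t))) :
    IsRep (conjPt k P) (extLin F A (veronese r (frob k F s) (frob k F t))) := by
  have := h.ptMap (frob k F)
  rwa [coordMap_frob_extLin, coordMap_veronese] at this

/-- The rational points of the extension of a normal rational curve. -/
theorem extPt_mem_nrc {r n : ℕ} {A : Vec r k →ₗ[k] Vec n k} (hr : r ≠ 0)
    (hA : Function.Injective A) {P : PG n k} : extPt F P ∈ nrc F A ↔ P ∈ nrc k A := by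
  have hone : algebraMap k F 1 = 1 := map_one _
  constructor
  · rintro ⟨s, t, hst, hP⟩
    have hrep : IsRep (extPt F P) (coordMap (algebraMap k F) P.rep) := (isRep_rep P).ptMap _
    obtain ⟨c, hc, he⟩ := hrep.exists_smul hP
    obtain ⟨S, hS⟩ := A.exists_leftInverse_of_injective (LinearMap.ker_eq_bot.mpr hA)
    have hw : coordMap (algebraMap k F) (S P.rep) = c • veronese r s t := by
      rw [← extLin_coordMap, he, map_smul, ← LinearMap.comp_apply, ← extLin_comp, hS, extLin_id]
      rfl
    suffices ∃ s' t' : k, (s' ≠ 0 ∨ t' ≠ 0) ∧ ∃ d : F, veronese r s t =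
        d • coordMap (algebraMap k F) (veronese r s' t') by
      obtain ⟨s', t', hst', d, hd⟩ := this
      refine ⟨s', t', hst', ?_⟩
      rw [extLin_self]
      refine (isRep_extPt_iff (F' := F)).mp (hrep.of_eq_smul (c := c * d) ?_)
      rw [he, hd, map_smul, extLin_coordMap, smul_smul]
    -- The parameter `(0, t)` is the point `(0, …, 0, 1)`. Otherwise `t / s` is the quotient of the
    -- first two coordinates of a rational vector, hence lies in `k`.
    by_cases hs : s = 0
    · subst hs
      refine ⟨0, 1, by simp, t ^ r, ?_⟩
      rw [coordMap_veronese, ← veronese_smul]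
      simp
    · have e0 := congrFun hw 0
      have e1 := congrFun hw ⟨1, by omega⟩
      simp only [coordMap_apply, Pi.smul_apply, smul_eq_mul, veronese] at e0 e1
      set x := S P.rep 0
      set y := S P.rep ⟨1, by omega⟩
      refine ⟨1, y / x, by simp, s ^ r, ?_⟩
      rw [coordMap_veronese, ← veronese_smul, map_div₀, e0, e1, map_one]
      congr 1
      · ring
      · obtain ⟨r, rfl⟩ := Nat.exists_eq_succ_of_ne_zero hr
        simp only [Fin.val_zero, Nat.sub_zero, pow_zero, Nat.succ_eq_add_one, Nat.add_sub_cancel,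
          pow_succ]
        field_simp
  · rintro ⟨s, t, hst, hP⟩
    refine ⟨algebraMap k F s, algebraMap k F t, by simpa using hst, ?_⟩
    rw [← coordMap_veronese, extLin_coordMap]
    refine isRep_extPt_iff.mpr ?_
    rwa [extLin_self] at hP

end Param

/-! ### Intersections with the hyperplane at infinity -/

section Hyperplane

variable {k F : Type*} [Field k] [Field F] [Algebra k F]

theorem exists_smul_of_mul_eq_mul {s t a b : F} (hst : s ≠ 0 ∨ t ≠ 0) (hab : a ≠ 0 ∨ b ≠ 0)
    (h : s * b - t * a = 0) : ∃ d, d ≠ 0 ∧ s = d * a ∧ t = d * b := by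
  by_cases ha : a = 0
  · have hb := hab.resolve_left (not_not.mpr ha)
    have hs : s = 0 := by
      rw [ha] at h
      simpa [hb] using h
    have ht := hst.resolve_left (not_not.mpr hs)
    exact ⟨t / b, div_ne_zero ht hb, by rw [hs, ha, mul_zero], by field_simp⟩
  · have ht : t = s / a * b := by field_simp; linear_combination -h
    have hs : s ≠ 0 := by
      rintro rfl
      simp [ht] at hst
    exact ⟨s / a, div_ne_zero hs ha, by field_simp, ht⟩

/-- A curve point lies in `H` exactly when one linear factor vanishes, that is, when its parameter
is proportional to that of some `p j`. -/
theorem MeetsIn.inter_eq {r n : ℕ} {A : Vec r k →ₗ[k] Vec n k} {S H : Submodule k (Vec n k)}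
    {p : Fin r → PG n F} (h : MeetsIn F A S H p) (hS : nrc F A ⊆ pts (ext F S)) :
    nrc F A ∩ pts (ext F H) = Set.range p := by
  obtain ⟨a, b, hp, φ, hφ, c, hc, hprod⟩ := h
  have key : ∀ {P : PG n F} {s t : F}, (s ≠ 0 ∨ t ≠ 0) →
      IsRep P (extLin F A (veronese r s t)) →
      (P ∈ pts (ext F H) ↔ ∏ j, (s * b j - t * a j) = 0) := by
    intro P s t hst hP
    have hmem : extLin F A (veronese r s t) ∈ ext F S := hP.mem_pts.mp (hS ⟨s, t, hst, hP⟩)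
    rw [hP.mem_pts, ← hφ, Submodule.mem_inf, LinearMap.mem_ker, hprod, mul_eq_zero,
      or_iff_right hc]
    exact and_iff_right hmem
  ext P
  constructor
  · rintro ⟨⟨s, t, hst, hP⟩, hH⟩
    obtain ⟨j, _, hj⟩ := Finset.prod_eq_zero_iff.mp ((key hst hP).mp hH)
    obtain ⟨d, hd, rfl, rfl⟩ := exists_smul_of_mul_eq_mul hst (hp j).1 hj
    refine ⟨j, ?_⟩
    have hP' : IsRep P (extLin F A (veronese r (d * a j) (d * b j))) := hP
    rw [veronese_smul, map_smul] at hP'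
    exact IsRep.unique (hp j).2 (hP'.of_eq_smul rfl)
  · rintro ⟨j, rfl⟩
    refine ⟨⟨a j, b j, hp j⟩, (key (hp j).1 (hp j).2).mpr ?_⟩
    exact Finset.prod_eq_zero (Finset.mem_univ j) (by ring)

/-- A normal rational curve of dimension at least two contains no lines. -/
theorem not_line_subset_nrc {n : ℕ} {A : Vec 6 k →ₗ[k] Vec n k} (hA : Function.Injective A)
    {W : Submodule F (Vec n F)} (hW : 2 ≤ Module.finrank F W) : ¬ pts W ⊆ nrc F A := by
  intro hsub
  obtain ⟨u, v, hu, hv, hli⟩ : ∃ u v, u ∈ W ∧ v ∈ W ∧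
      ∀ x y : F, x • u + y • v = 0 → x = 0 ∧ y = 0 := by
    let b := Module.finBasis F W
    have h := b.linearIndependent.comp ![⟨0, by omega⟩, ⟨1, by omega⟩] (by
      intro i j hij
      fin_cases i <;> fin_cases j <;> simp_all)
    rw [Fintype.linearIndependent_iff] at h
    refine ⟨b ⟨0, by omega⟩, b ⟨1, by omega⟩, Subtype.mem _, Subtype.mem _, fun x y hxy => ?_⟩
    have := h ![x, y] (by
      rw [Fin.sum_univ_two]
      exact Subtype.ext hxy)
    exact ⟨this 0, this 1⟩
  have hpt : ∀ w ∈ W, w ≠ 0 → ∃ c s t : F, c ≠ 0 ∧ (s ≠ 0 ∨ t ≠ 0) ∧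
      w = c • extLin F A (veronese 6 s t) := by
    intro w hw hw0
    obtain ⟨s, t, hst, hP⟩ := hsub ((isRep_mk hw0).mem_pts.mpr hw)
    obtain ⟨c, hc, he⟩ := (isRep_mk hw0).exists_smul hP
    exact ⟨c, s, t, hc, hst, he⟩
  obtain ⟨c₁, s₁, t₁, hc₁, h₁, e₁⟩ := hpt u hu (by
    rintro rfl; exact one_ne_zero (hli 1 0 (by simp)).1)
  obtain ⟨c₂, s₂, t₂, hc₂, h₂, e₂⟩ := hpt v hv (by
    rintro rfl; exact one_ne_zero (hli 0 1 (by simp)).2)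
  -- A line contains a third point `u + v`; three collinear points of the curve are shown to be
  -- impossible.
  obtain ⟨c₃, s₃, t₃, hc₃, h₃, e₃⟩ := hpt (u + v) (W.add_mem hu hv) (fun h0 =>
    one_ne_zero (hli 1 1 (by simpa using h0)).1)
  have hsum : c₁ • veronese 6 s₁ t₁ + c₂ • veronese 6 s₂ t₂ = c₃ • veronese 6 s₃ t₃ := by
    apply extLin_injective F A hA
    rw [map_add, map_smul, map_smul, map_smul, ← e₁, ← e₂, ← e₃]
  have h13 : s₃ * t₁ - t₃ * s₁ ≠ 0 := by
    intro h0
    obtain ⟨d, hd, rfl, rfl⟩ := exists_smul_of_mul_eq_mul h₃ h₁ h0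
    have : (c₃ * d ^ 6 - c₁) • u + (- c₁) • v = 0 := by
      have e₃' : c₁ • (u + v) = (c₃ * d ^ 6) • u := by
        rw [e₃, veronese_smul, map_smul, e₁, smul_smul, smul_smul, smul_smul]
        congr 1; ring
      rw [sub_smul, ← e₃']
      module
    exact hc₁ (neg_eq_zero.mp (hli _ _ this).2)
  have h23 : s₃ * t₂ - t₃ * s₂ ≠ 0 := by
    intro h0
    obtain ⟨d, hd, rfl, rfl⟩ := exists_smul_of_mul_eq_mul h₃ h₂ h0
    have : (- c₂) • u + (c₃ * d ^ 6 - c₂) • v = 0 := by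
      have e₃' : c₂ • (u + v) = (c₃ * d ^ 6) • v := by
        rw [e₃, veronese_smul, map_smul, e₂, smul_smul, smul_smul, smul_smul]
        congr 1; ring
      rw [sub_smul, ← e₃']
      module
    exact hc₂ (neg_eq_zero.mp (hli _ _ this).1)
  have hcoord : ∀ i : ℕ, i < 7 → c₁ * (s₁ ^ (6 - i) * t₁ ^ i) + c₂ * (s₂ ^ (6 - i) * t₂ ^ i) =
      c₃ * (s₃ ^ (6 - i) * t₃ ^ i) := fun i hi => congrFun hsum ⟨i, hi⟩
  have k0 := hcoord 0 (by omega)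
  have k1 := hcoord 1 (by omega)
  have k2 := hcoord 2 (by omega)
  have k4 := hcoord 4 (by omega)
  have k5 := hcoord 5 (by omega)
  have k6 := hcoord 6 (by omega)
  norm_num at k0 k1 k2 k4 k5 k6
  -- Contract the coordinates with the quadratic form whose zeros are the first two parameters.
  -- Their terms vanish, and what is left is the value of that form at the third parameter, which is
  -- not zero.
  have z1 : c₃ * s₃ ^ 4 * ((s₃ * t₁ - t₃ * s₁) * (s₃ * t₂ - t₃ * s₂)) = 0 := by
    linear_combination (-(t₁ * t₂)) * k0 + (t₁ * s₂ + s₁ * t₂) * k1 - s₁ * s₂ * k2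
  have z2 : c₃ * t₃ ^ 4 * ((s₃ * t₁ - t₃ * s₁) * (s₃ * t₂ - t₃ * s₂)) = 0 := by
    linear_combination (-(t₁ * t₂)) * k4 + (t₁ * s₂ + s₁ * t₂) * k5 - s₁ * s₂ * k6
  rcases h₃ with h | h
  · exact mul_ne_zero (mul_ne_zero hc₃ (pow_ne_zero 4 h)) (mul_ne_zero h13 h23) z1
  · exact mul_ne_zero (mul_ne_zero hc₃ (pow_ne_zero 4 h)) (mul_ne_zero h13 h23) z2

end Hyperplane

/-! ### The curve of degree six -/

section Sextic

variable {k K F : Type*} [Field k] [Fintype k] [Field K] [Field F]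
  [Algebra k K] [Algebra k F] [Algebra K F]
  {m : Bose k K} {M : Vec 2 K ≃ₗ[K] Vec 2 K}
  {ℓ : Submodule K (Vec 2 K)} {S6 : Submodule k (Vec 8 k)} {a : Vec 2 K}

/-- The coefficients of the parametrisation `b(s,t) c(s,t) (s², st, t²)`. -/
def sexticCoeff (b c : Vec 2 K) (n : Fin 7) : Vec 2 K :=
  let g₀ := b 0 * c 0
  let g₁ := b 0 * c 1 + b 1 * c 0
  let g₂ := b 0 * c 2 + b 1 * c 1 + b 2 * c 0
  let g₃ := b 1 * c 2 + b 2 * c 1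
  let g₄ := b 2 * c 2
  ![![g₀, g₁, g₂, g₃, g₄, 0, 0] n, ![0, g₀, g₁, g₂, g₃, g₄, 0] n, ![0, 0, g₀, g₁, g₂, g₃, g₄] n]

variable (m M) in
/-- The curve `s, t ↦ a'(s,t) a''(s,t) (s², st, t²)`, where `a'`, `a''` are the conjugates of `a`. -/
def Bose.sexticMap (hK : Module.finrank k K = 3) (a : Vec 2 K) : Vec 6 k →ₗ[k] Vec 8 k :=
  m.curveMap M hK (sexticCoeff (conjVec k K a 1) (conjVec k K a 2))

theorem conjEmb_conjVec (a : Vec 2 K) (i j : ℕ) (b : Fin 3) :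
    conjEmb k K F i (conjVec k K a j b) = conjVec k F a (i + j) b :=
  conjEmb_frob_pow j i (a b)

theorem Bose.Y_sexticMap [IsScalarTower k K F] (hK : Module.finrank k K = 3) (s t : F) (j : ℕ) :
    m.Y M F j (extLin F (m.sexticMap M hK a) (veronese 6 s t)) =
      (Qf k a s t (j + 1) * Qf k a s t (j + 2)) • veronese 2 s t := by
  ext b
  rw [Bose.sexticMap, Bose.Y_curveMap]
  fin_cases b <;>
  · simp [Fin.sum_univ_seven, sexticCoeff, conjEmb_conjVec, Qf, binQuad, veronese]
    ring

theorem resultant_conjVec_ne_zero (hr : resultant (conjVec k K a 0) (conjVec k K a 1) ≠ 0)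
    (j : ℕ) : resultant (conjVec k F a j) (conjVec k F a (j + 1)) ≠ 0 := by
  rw [← add_zero j, add_assoc, zero_add, ← coordMap_conjEmb_conjVec, ← coordMap_conjEmb_conjVec,
    ← map_resultant]
  simpa using hr

theorem resultant_comm (b c : Vec 2 K) : resultant b c = resultant c b := by
  simp only [resultant_eq]; ring

/-- Each component of a kernel vector says that its sequence of seven entries is annihilated by a
product `Q_i Q_j` of two of the three pairwise coprime forms; `sextic_eq_zero` then applies. -/
theorem Bose.sexticMap_injective (hK : Module.finrank k K = 3)
    (hr : resultant (conjVec k K a 0) (conjVec k K a 1) ≠ 0) :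
    Function.Injective (m.sexticMap M hK a) := by
  rw [injective_iff_map_eq_zero]
  intro w hw
  let W : ℕ → K := fun n => if h : n < 7 then algebraMap k K (w ⟨n, h⟩) else 0
  have h20 : resultant (conjVec k K a 0) (conjVec k K a 2) ≠ 0 := by
    have := resultant_conjVec_ne_zero (F := K) hr 2
    rwa [show 2 + 1 = 0 + 3 by rfl, conjVec_add_three hK, resultant_comm] at this
  have hW : ∀ i : Fin 7, algebraMap k K (w i) = W i := by
    intro i
    simp [W]
  have key : ∀ n < 7, W n = 0 := by
    have e : ∀ d, ∀ n < 3, let x := conjVec k K a (d + 1); let y := conjVec k K a (d + 2)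
        x 0 * (y 0 * W n + y 1 * W (n + 1) + y 2 * W (n + 2)) +
          x 1 * (y 0 * W (n + 1) + y 1 * W (n + 2) + y 2 * W (n + 3)) +
          x 2 * (y 0 * W (n + 2) + y 1 * W (n + 3) + y 2 * W (n + 4)) = 0 := by
      intro d n hn
      have e := m.curveMap_eq_zero (M := M) hK hw d ⟨n, hn⟩
      simp only [hW] at e
      interval_cases n <;>
      · simp [Fin.sum_univ_seven, sexticCoeff, conjEmb_conjVec] at e ⊢
        linear_combination e
    refine sextic_eq_zero (a := conjVec k K a) hr (resultant_conjVec_ne_zero hr 1) h20 ?_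
    intro i j hij hj n hn
    have e0 := e 0 n hn
    have e1 := e 1 n hn
    have e2 := e 2 n hn
    have c3 : conjVec k K a (2 + 1) = conjVec k K a 0 := conjVec_add_three hK a 0
    have c3' : conjVec k K a (1 + 2) = conjVec k K a 0 := conjVec_add_three hK a 0
    have c4 : conjVec k K a (2 + 2) = conjVec k K a 1 := conjVec_add_three hK a 1
    simp only [c3, c4] at e2
    simp only [c3'] at e1
    obtain ⟨rfl, rfl⟩ | ⟨rfl, rfl⟩ | ⟨rfl, rfl⟩ :
      (i = 0 ∧ j = 1) ∨ (i = 0 ∧ j = 2) ∨ (i = 1 ∧ j = 2) := by omega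
    · exact e2
    · linear_combination e1
    · exact e0
  ext i
  have := key i i.2
  simpa [W] using this

/-- Neighbouring conjugate forms are coprime because their resultant is a conjugate of the first
one. As indices are cyclic of length three, at most one of the three forms vanishes at a given
parameter. -/
theorem Qf_ne_zero_or (hr : resultant (conjVec k K a 0) (conjVec k K a 1) ≠ 0) {s t : F}
    (hst : s ≠ 0 ∨ t ≠ 0) (j : ℕ) (h0 : Qf k a s t j = 0) : Qf k a s t (j + 1) ≠ 0 := by
  intro h1
  obtain ⟨rfl, rfl⟩ := eq_zero_of_binQuad_eq_zero (resultant_conjVec_ne_zero hr j) h0 h1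
  simp at hst

/-- A property of period three is proved at three successive places. -/
theorem forall_of_three_succ {g : ℕ → Prop} (h : ∀ j, g (j + 3) ↔ g j) (i : ℕ) (h0 : g i)
    (h1 : g (i + 1)) (h2 : g (i + 2)) (j : ℕ) : g j := by
  have hm := apply_mod_three fun j => propext (h j)
  have : j % 3 = i % 3 ∨ j % 3 = (i + 1) % 3 ∨ j % 3 = (i + 2) % 3 := by omega
  rw [← hm j]
  rcases this with e | e | e <;> rw [e, hm] <;> assumption

variable {N : Vec 2 k ≃ₗ[k] Vec 2 k} {f : MvPolynomial (Fin 3) k} {c : k}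

/-- At a parameter where `Q_{i+1}` and `Q_{i+2}` are non-zero, constancy of `α_j Q_j` expresses the
other two coefficients through `α_i`, and the solution is a multiple of `(Q_{j+1} Q_{j+2})_j`. Here
`Q_i` is allowed to vanish, so the points at infinity are covered as well. -/
theorem Bose.IsLineEq.conicVariety_eq_sextic [IsScalarTower k K F]
    (hK : Module.finrank k K = 3) (hS6 : Module.finrank k S6 = 7)
    (h : m.IsLineEq (frameTrans N M) ℓ S6 a) (hf : conicEq N.symm f =
      MvPolynomial.C c * (MvPolynomial.X 0 * MvPolynomial.X 2 - MvPolynomial.X 1 ^ 2))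
    (hc : c ≠ 0) (hr : resultant (conjVec k K a 0) (conjVec k K a 1) ≠ 0) :
    m.conicVariety S6 M f F = nrc F (m.sexticMap (frameTrans N M) hK a) := by
  ext P
  constructor
  · intro hP
    obtain ⟨s, t, α, hst, hα3, hα, hQ⟩ :=
      (h.mem_conicVariety_iff hK hS6 hf hc (isRep_rep P)).mp hP
    have hQ3 := Qf_add_three (F := F) hK a s t
    have hne := fun j => Qf_ne_zero_or (F := F) hr hst j
    set Q := Qf k a s t with hQdef
    obtain ⟨i, hi1, hi2⟩ : ∃ i, Q (i + 1) ≠ 0 ∧ Q (i + 2) ≠ 0 := by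
      have hne' : ∀ j, Q j = 0 → Q (j + 2) ≠ 0 := fun j h0 h2 => by
        have := hne (j + 2) h2
        rw [show j + 2 + 1 = j + 3 by ring, hQ3] at this
        exact this h0
      by_cases h1 : Q 1 = 0
      · exact ⟨1, hne 1 h1, hne' 1 h1⟩
      by_cases h2 : Q 2 = 0
      · refine ⟨2, hne 2 h2, hne' 2 h2⟩
      · exact ⟨0, h1, h2⟩
    have hα' : ∀ j, α j = α i / (Q (i + 1) * Q (i + 2)) * (Q (j + 1) * Q (j + 2)) := by
      refine forall_of_three_succ (fun j => ?_) i ?_ ?_ ?_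
      · rw [hα3, show j + 3 + 1 = j + 1 + 3 by ring, show j + 3 + 2 = j + 2 + 3 by ring, hQ3, hQ3]
      · field_simp
      · have := (hQ (i + 1)).trans (hQ i).symm
        rw [show i + 1 + 2 = i + 3 by ring, hQ3, show i + 1 + 1 = i + 2 by ring]
        field_simp
        linear_combination this
      · have := (hQ (i + 2)).trans (hQ i).symm
        rw [show i + 2 + 1 = i + 3 by ring, show i + 2 + 2 = i + 1 + 3 by ring, hQ3, hQ3]
        field_simp
        linear_combination this
    refine ⟨s, t, hst, (isRep_rep P).of_eq_smul (c := α i / (Q (i + 1) * Q (i + 2))) ?_⟩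
    refine m.Y_ext (M := frameTrans N M) hK fun j => ?_
    rw [hα, map_smul, m.Y_sexticMap, hα' j, smul_smul]
  · rintro ⟨s, t, hst, hP⟩
    refine (h.mem_conicVariety_iff hK hS6 hf hc hP).mpr
      ⟨s, t, fun j => Qf k a s t (j + 1) * Qf k a s t (j + 2), hst, fun j => ?_, fun j => ?_, ?_⟩
    · beta_reduce
      rw [show j + 3 + 1 = j + 1 + 3 by ring, show j + 3 + 2 = j + 2 + 3 by ring,
        Qf_add_three hK, Qf_add_three hK]
    · exact m.Y_sexticMap hK s t j
    · have hQ3 := Qf_add_three (F := F) hK a s t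
      refine forall_of_lt_three (fun j => ?_) fun j hj => ?_
      · beta_reduce
        rw [show j + 3 + 1 = j + 1 + 3 by ring, show j + 3 + 2 = j + 2 + 3 by ring, hQ3, hQ3, hQ3]
      · interval_cases j
        · rfl
        · beta_reduce
          rw [show 1 + 2 = 0 + 3 by rfl, hQ3]; ring
        · beta_reduce
          rw [show 2 + 1 = 0 + 3 by rfl, show 2 + 2 = 1 + 3 by rfl, hQ3, hQ3]; ring

end Sextic

/-! ### Points at infinity of the curve of degree six -/

section SexticInfinity

variable {k K F L : Type*} [Field k] [Fintype k] [Field K] [Field F] [Field L]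
  [Algebra k K] [Algebra k F] [Algebra K F] [Algebra k L] [Algebra K L] [IsScalarTower k K L]
  {m : Bose k K} {M : Vec 2 K ≃ₗ[K] Vec 2 K} {N : Vec 2 k ≃ₗ[k] Vec 2 k}
  {ℓ : Submodule K (Vec 2 K)} {S6 : Submodule k (Vec 8 k)} {a : Vec 2 K}
  {f : MvPolynomial (Fin 3) k} {c : k}

theorem conjEmb_eq_frob_pow (j : ℕ) (x : K) :
    conjEmb k K F j x = (frob k F ^ j) (algebraMap K F x) := by
  rw [conjEmb_apply, frob_pow_apply, frob_pow_apply, map_pow]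

theorem Bose.coordMap_frob_G (j : ℕ) (u : Vec 2 F) :
    coordMap (frob k F) (m.G M F j u) = m.G M F (j + 1) (coordMap (frob k F) u) :=
  coordMap_frob_twist _ _ _

theorem Bose.Y_G_add_three (hK : Module.finrank k K = 3) {i d : ℕ} (hd : d = 1 ∨ d = 2)
    (u : Vec 2 F) : m.Y M F (i + d) (m.G M F i u) = 0 := by
  rw [← m.G_add_three M hK]
  rcases hd with rfl | rfl
  · exact m.Y_G_add M hK (d := 2) (by simp) (i + 1) u
  · exact m.Y_G_add M hK (d := 1) (by simp) (i + 2) u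

/-- Vectors with only one component. -/
theorem Bose.eq_G_of_Y (hK : Module.finrank k K = 3) {v : Vec 8 F} {i : ℕ}
    (h1 : m.Y M F (i + 1) v = 0) (h2 : m.Y M F (i + 2) v = 0) : v = m.G M F i (m.Y M F i v) := by
  refine m.Y_ext (M := M) hK (forall_of_three_succ (fun j => ?_) i ?_ ?_ ?_)
  · rw [m.Y_add_three M hK]
  · rw [m.Y_G]
  · rw [h1, m.Y_G_add_three hK (by simp)]
  · rw [h2, m.Y_G_add_three hK (by simp)]

theorem Qf_eq_of_factor {d p₀ p₁ q₀ q₁ : L}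
    (h0 : algebraMap K L (a 0) = d * (p₁ * q₁))
    (h1 : algebraMap K L (a 1) = - (d * (p₁ * q₀ + p₀ * q₁)))
    (h2 : algebraMap K L (a 2) = d * (p₀ * q₀)) (s t : L) (j : ℕ) :
    Qf k a s t j = (frob k L ^ j) d * ((s * (frob k L ^ j) p₁ - t * (frob k L ^ j) p₀) *
      (s * (frob k L ^ j) q₁ - t * (frob k L ^ j) q₀)) := by
  simp only [Qf, binQuad, conjVec_apply, conjEmb_eq_frob_pow, h0, h1, h2, map_mul, map_neg, map_add]
  ring

/-- The components in `Γ^q` and `Γ^(q²)` carry the factor `Q_0` and vanish; the one in `Γ` carries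
`Q_1 Q_2`, which is non-zero by coprimality. -/
theorem Bose.isRep_toΓ_sextic (hK : Module.finrank k K = 3)
    (hr : resultant (conjVec k K a 0) (conjVec k K a 1) ≠ 0) {P : PG 2 L} {s t : L}
    (hst : s ≠ 0 ∨ t ≠ 0)
    (hP : IsRep P (extLin L M.toLinearMap (veronese 2 s t))) (hQ : Qf k a s t 0 = 0) :
    IsRep (m.toΓ P) (extLin L (m.sexticMap M hK a) (veronese 6 s t)) := by
  have hQ1 : Qf k a s t 1 ≠ 0 := Qf_ne_zero_or hr hst 0 hQ
  have hQ3 : Qf k a s t 3 = 0 := (Qf_add_three hK a s t 0).trans hQ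
  have hQ2 : Qf k a s t 2 ≠ 0 := fun h => Qf_ne_zero_or hr hst 2 h hQ3
  have e : extLin L (m.sexticMap M hK a) (veronese 6 s t) =
      (Qf k a s t 1 * Qf k a s t 2) • m.G M L 0 (veronese 2 s t) := by
    rw [m.eq_G_of_Y (M := M) hK (v := extLin L (m.sexticMap M hK a) (veronese 6 s t)) (i := 0),
      m.Y_sexticMap, map_smul]
    · rw [m.Y_sexticMap, show Qf k a s t (0 + 1 + 2) = 0 from hQ3, mul_zero, zero_smul]
    · rw [m.Y_sexticMap, show Qf k a s t (0 + 2 + 1) = 0 from hQ3, zero_mul, zero_smul]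
  rw [e]
  exact (m.isRep_toΓ M hP).smul (mul_ne_zero hQ1 hQ2)

/-- The value of the equation of the hyperplane at infinity on the sextic curve. -/
theorem Bose.infForm_sextic (hK : Module.finrank k K = 3) (s t : L) :
    m.infForm M a L 0 (extLin L (m.sexticMap M hK a) (veronese 6 s t)) =
      Qf k a s t 0 * Qf k a s t 1 * Qf k a s t 2 := by
  rw [Bose.infForm_apply, m.Y_sexticMap, dotProduct_smul, dotProduct_veronese, smul_eq_mul, Qf, Qf,
    Qf, conjVec, conjVec, conjVec]
  ring

/-- On the 6-space the three conjugate equations of infinity take equal values, so one of them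
suffices. -/
theorem Bose.IsLineEq.ext_space_inf_ker [IsScalarTower k K F] (hK : Module.finrank k K = 3)
    (hS6 : Module.finrank k S6 = 7) (h : m.IsLineEq M ℓ S6 a) :
    ext F S6 ⊓ LinearMap.ker (m.infForm M a F 0) = ext F (m.infinity ℓ) := by
  ext v
  rw [Submodule.mem_inf, LinearMap.mem_ker, h.mem_ext_space_iff hK hS6,
    h.mem_ext_infinity_iff hK]
  constructor
  · rintro ⟨⟨h1, h2⟩, h0⟩ j hj
    interval_cases j
    · exact h0
    · rw [h1, h0]
    · rw [h2, h0]
  · intro h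
    rw [h 0 (by omega), h 1 (by omega), h 2 (by omega)]
    simp

/-- The points of a conic on a line, given by a factorisation of the quadratic form. -/
theorem Bose.IsLineEq.conicExt_inter_line (hℓ : Module.finrank K ℓ = 2)
    (h : m.IsLineEq (frameTrans N M) ℓ S6 a) (hf : conicEq N.symm f =
      MvPolynomial.C c * (MvPolynomial.X 0 * MvPolynomial.X 2 - MvPolynomial.X 1 ^ 2))
    (hc : c ≠ 0) {d p₀ p₁ q₀ q₁ : L} (hd : d ≠ 0)
    (hp : p₀ ≠ 0 ∨ p₁ ≠ 0) (hq : q₀ ≠ 0 ∨ q₁ ≠ 0)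
    (h0 : algebraMap K L (a 0) = d * (p₁ * q₁))
    (h1 : algebraMap K L (a 1) = - (d * (p₁ * q₀ + p₀ * q₁)))
    (h2 : algebraMap K L (a 2) = d * (p₀ * q₀)) {P Q : PG 2 L}
    (hP : IsRep P (extLin L (frameTrans N M).toLinearMap (veronese 2 p₀ p₁)))
    (hQ : IsRep Q (extLin L (frameTrans N M).toLinearMap (veronese 2 q₀ q₁))) :
    conicExt L M f ∩ pts (ext L ℓ) = {P, Q} := by
  have key : ∀ s t : L, dotProduct (coordMap (algebraMap K L) a) (veronese 2 s t) =
      d * ((s * p₁ - t * p₀) * (s * q₁ - t * q₀)) := by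
    intro s t
    rw [dotProduct_veronese, binQuad, coordMap_apply, coordMap_apply, coordMap_apply, h0, h1, h2]
    ring
  have hver : ∀ {X : PG 2 L} {s t : L},
      IsRep X (extLin L (frameTrans N M).toLinearMap (veronese 2 s t)) →
      (X ∈ conicExt L M f ∩ pts (ext L ℓ) ↔ d * ((s * p₁ - t * p₀) * (s * q₁ - t * q₀)) = 0) := by
    intro X s t hX
    rw [Set.mem_inter_iff, mem_conicExt_iff hf hc hX, hX.mem_pts, h.mem_ext_line_iff hℓ, key]
    exact and_iff_right (conic_veronese s t)
  ext X
  rw [Set.mem_insert_iff, Set.mem_singleton_iff]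
  constructor
  · rintro hX
    obtain ⟨u, hu⟩ := exists_isRep_frame (frameTrans N M) X
    have hcon := (mem_conicExt_iff hf hc hu).mp hX.1
    have hu0 : u ≠ 0 := by
      rintro rfl
      exact hu.ne_zero (map_zero _)
    obtain ⟨b, s, t, hb, hst, rfl⟩ := exists_veronese hu0 hcon
    rw [map_smul] at hu
    have hX' := hu.of_eq_smul rfl
    have hz := (hver hX').mp hX
    rw [mul_eq_zero, or_iff_right hd, mul_eq_zero] at hz
    rcases hz with hz | hz
    · left
      obtain ⟨e, he, rfl, rfl⟩ := exists_smul_of_mul_eq_mul hst hp hz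
      rw [veronese_smul, map_smul] at hX'
      exact (hX'.of_eq_smul rfl).unique hP
    · right
      obtain ⟨e, he, rfl, rfl⟩ := exists_smul_of_mul_eq_mul hst hq hz
      rw [veronese_smul, map_smul] at hX'
      exact (hX'.of_eq_smul rfl).unique hQ
  · rintro (rfl | rfl)
    · exact (hver hP).mpr (by ring)
    · exact (hver hQ).mpr (by ring)

theorem extPt_of_veronese {P : PG 2 L} {x y : K} (hxy : x ≠ 0 ∨ y ≠ 0)
    (hP : IsRep P (extLin L M.toLinearMap
      (veronese 2 (algebraMap K L x) (algebraMap K L y)))) :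
    P ∈ Set.range (extPt (F := K) (n := 2) L) := by
  have h0 : M (veronese 2 x y) ≠ 0 := by simpa using veronese_ne_zero (r := 2) hxy
  refine ⟨Projectivization.mk K _ h0, ?_⟩
  have h1 : IsRep (extPt L (Projectivization.mk K _ h0))
      (coordMap (algebraMap K L) (M (veronese 2 x y))) := (isRep_mk h0).ptMap _
  have h2 := extLin_coordMap (F' := L) M.toLinearMap (veronese 2 x y)
  rw [coordMap_veronese] at h2
  refine IsRep.unique ?_ hP
  rw [h2]
  exact h1

/-- In the frame, `x` is the quotient of the last two coordinates, which lies in `K` when the point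
does. -/
theorem exists_of_extPt_veronese {P : PG 2 L} {x : L}
    (hP : IsRep P (extLin L M.toLinearMap (veronese 2 x 1)))
    (h : P ∈ Set.range (extPt (F := K) (n := 2) L)) : ∃ y, algebraMap K L y = x := by
  obtain ⟨X, rfl⟩ := h
  obtain ⟨u, hu⟩ : ∃ u, IsRep X (M u) := ⟨M.symm X.rep, by
    rw [M.apply_symm_apply]; exact isRep_rep X⟩
  have h1 : IsRep (extPt L X) (coordMap (algebraMap K L) (M u)) := hu.ptMap _
  obtain ⟨b, hb, e⟩ := h1.exists_smul hP
  have h2 := extLin_coordMap (F' := L) M.toLinearMap u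
  rw [LinearEquiv.coe_coe, e, ← map_smul] at h2
  have h3 := extLin_injective L M.toLinearMap M.injective h2
  have e1 := congrFun h3 1
  have e2 := congrFun h3 2
  simp only [coordMap_apply, Pi.smul_apply, smul_eq_mul, veronese_two] at e1 e2
  have e1 : algebraMap K L (u 1) = b * x := by simpa using e1
  have e2 : algebraMap K L (u 2) = b := by simpa using e2
  refine ⟨u 1 / u 2, ?_⟩
  rw [map_div₀, e1, e2]
  field_simp

/-- The sextic normal rational curve and its points at infinity. -/
theorem Bose.IsLineEq.sextic_infinity (hK : Module.finrank k K = 3) (hL : Module.finrank K L = 2)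
    (hℓ : Module.finrank K ℓ = 2) (hS6 : Module.finrank k S6 = 7)
    (h : m.IsLineEq (frameTrans N M) ℓ S6 a) (hf : conicEq N.symm f =
      MvPolynomial.C c * (MvPolynomial.X 0 * MvPolynomial.X 2 - MvPolynomial.X 1 ^ 2))
    (hc : c ≠ 0) (hr : resultant (conjVec k K a 0) (conjVec k K a 1) ≠ 0) :
    ∃ P Q : PG 2 L, conicExt L M f ∩ pts (ext L ℓ) = {P, Q} ∧
      ((P ∈ Set.range (extPt (F := K) (n := 2) L) ∧ Q ∈ Set.range (extPt (F := K) (n := 2) L)) ∨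
        (P ∉ Set.range (extPt (F := K) (n := 2) L) ∧ Q ∉ Set.range (extPt (F := K) (n := 2) L) ∧
          m.toΓ Q = (conjPt k)^[3] (m.toΓ P))) ∧
      MeetsIn L (m.sexticMap (frameTrans N M) hK a) S6 (m.infinity ℓ)
        ![m.toΓ P, conjPt k (m.toΓ P), conjPt k (conjPt k (m.toΓ P)),
          m.toΓ Q, conjPt k (m.toΓ Q), conjPt k (conjPt k (m.toΓ Q))] := by
  obtain ⟨d, p₀, p₁, q₀, q₁, hd, hp, hq, h0, h1, h2, hpq⟩ :=
    exists_binQuad_factor (k := k) hK hL h.ne_zero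
  have hpt : ∀ {s t : L}, (s ≠ 0 ∨ t ≠ 0) →
      ∃ P, IsRep P (extLin L (frameTrans N M).toLinearMap (veronese 2 s t)) := by
    intro s t hst
    refine ⟨_, isRep_mk fun h0 => veronese_ne_zero (r := 2) hst ?_⟩
    exact extLin_injective L _ (frameTrans N M).injective (h0.trans (map_zero _).symm)
  obtain ⟨P, hP⟩ := hpt hp
  obtain ⟨Q, hQ⟩ := hpt hq
  have hQf := Qf_eq_of_factor (k := k) h0 h1 h2
  have hP0 : Qf k a p₀ p₁ 0 = 0 := by rw [hQf]; simp; ring_nf; simp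
  have hQ0 : Qf k a q₀ q₁ 0 = 0 := by rw [hQf]; simp; ring_nf; simp
  refine ⟨P, Q, h.conicExt_inter_line hℓ hf hc hd hp hq h0 h1 h2 hP hQ, ?_, ?_⟩
  · rcases hpq with ⟨⟨x₀, rfl⟩, ⟨x₁, rfl⟩, ⟨y₀, rfl⟩, ⟨y₁, rfl⟩⟩ | ⟨rfl, rfl, rfl, hx⟩
    · exact Or.inl ⟨extPt_of_veronese (by simpa using hp) hP,
        extPt_of_veronese (by simpa using hq) hQ⟩
    · refine Or.inr ⟨fun hr => ?_, fun hr => ?_, ?_⟩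
      · obtain ⟨y, hy⟩ := exists_of_extPt_veronese hP hr
        exact hx y hy
      · obtain ⟨y, hy⟩ := exists_of_extPt_veronese hQ hr
        refine hx y ((frob k L ^ 3).injective ?_)
        rw [← hy, ← conjEmb_eq_frob_pow, ← zero_add 3, conjEmb_add_three hK]
        rfl
      -- Three applications of Frobenius lead from `Γ` back to `Γ` and send the parameter `p₀` to
      -- its conjugate over `K`, which is the other zero.
      · have e1 := (((m.isRep_toΓ (frameTrans N M) hP).ptMap (frob k L)).ptMap
          (frob k L)).ptMap (frob k L)
        rw [m.coordMap_frob_G, m.coordMap_frob_G, m.coordMap_frob_G, coordMap_veronese,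
          coordMap_veronese, coordMap_veronese, m.G_add_three _ hK 0, map_one, map_one, map_one] at e1
        exact IsRep.unique (m.isRep_toΓ (frameTrans N M) hQ) e1
  · have rP := m.isRep_toΓ_sextic hK hr hp hP hP0
    have rQ := m.isRep_toΓ_sextic hK hr hq hQ hQ0
    have nz : ∀ {x y : L}, (x ≠ 0 ∨ y ≠ 0) → (frob k L x ≠ 0 ∨ frob k L y ≠ 0) := by
      intro x y hxy
      simpa using hxy
    -- The zeros of `Q_j` are the `j`-th conjugates of those of `Q_0`, so the six zeros of `Q_0 Q_1
    -- Q_2` are the conjugates of the two parameters.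
    refine ⟨![p₀, frob k L p₀, frob k L (frob k L p₀), q₀, frob k L q₀, frob k L (frob k L q₀)],
      ![p₁, frob k L p₁, frob k L (frob k L p₁), q₁, frob k L q₁, frob k L (frob k L q₁)], ?_,
      m.infForm (frameTrans N M) a L 0, h.ext_space_inf_ker hK hS6,
      d * frob k L d * frob k L (frob k L d), by simpa using hd, ?_⟩
    · intro j
      fin_cases j
      · exact ⟨hp, rP⟩
      · exact ⟨nz hp, conjPt_nrc rP⟩
      · exact ⟨nz (nz hp), conjPt_nrc (conjPt_nrc rP)⟩
      · exact ⟨hq, rQ⟩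
      · exact ⟨nz hq, conjPt_nrc rQ⟩
      · exact ⟨nz (nz hq), conjPt_nrc (conjPt_nrc rQ)⟩
    · intro s t
      have f2 : ∀ x, (frob k L ^ 2) x = frob k L (frob k L x) := fun x => by rw [pow_two]; rfl
      rw [m.infForm_sextic, hQf, hQf, hQf, Fin.prod_univ_six, pow_zero, pow_one]
      simp only [f2]
      simp
      ring

end SexticInfinity

/-! ### The cubic case -/

section Cubic

variable {k K F : Type*} [Field k] [Fintype k] [Field K] [Field F]
  [Algebra k K] [Algebra k F] [Algebra K F] [IsScalarTower k K F]
  {m : Bose k K} {M : Vec 2 K ≃ₗ[K] Vec 2 K} {N : Vec 2 k ≃ₗ[k] Vec 2 k}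
  {ℓ : Submodule K (Vec 2 K)} {S6 : Submodule k (Vec 8 k)} {a : Vec 2 K}
  {f : MvPolynomial (Fin 3) k} {c : k}

/-- The parameter `(x, y)` of the conic gives a point on two of the conjugates of the line `a`. -/
structure IsVertex (k : Type*) {K : Type*} [Field k] [Fintype k] [Field K] [Algebra k K]
    (a : Vec 2 K) (x y : K) : Prop where
  zero : Qf k a x y 0 ≠ 0
  one : Qf k a x y 1 = 0
  two : Qf k a x y 2 = 0

/-- The linear form vanishing at the `j`-th conjugate of `(x, y)`. -/
def Lf (k : Type*) {K F : Type*} [Field k] [Fintype k] [Field K] [Field F]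
    [Algebra k K] [Algebra K F] (x y : K) (s t : F) (j : ℕ) : F :=
  s * conjEmb k K F j y - t * conjEmb k K F j x

theorem Lf_add_three (hK : Module.finrank k K = 3) (x y : K) (s t : F) (j : ℕ) :
    Lf k x y s t (j + 3) = Lf k x y s t j := by
  rw [Lf, conjEmb_add_three hK, Lf]

theorem conjEmb_Qf (x y : K) (i j : ℕ) :
    conjEmb k K F i (Qf k a x y j) =
      Qf k a (conjEmb k K F i x) (conjEmb k K F i y) (i + j) := by
  rw [Qf, map_binQuad, coordMap_conjEmb_conjVec, Qf]

theorem Qf_mul (d s t : F) (j : ℕ) : Qf k a (d * s) (d * t) j = d ^ 2 * Qf k a s t j := by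
  simp only [Qf, binQuad]; ring

theorem conjEmb_conjEmb (i j : ℕ) (x : K) :
    conjEmb k K F i (conjEmb k K K j x) = conjEmb k K F (i + j) x :=
  conjEmb_frob_pow j i x

namespace IsVertex

variable {x y : K} (hv : IsVertex k a x y)

include hv

theorem ne_zero : x ≠ 0 ∨ y ≠ 0 := by
  by_contra! h
  apply hv.zero
  simp [Qf, binQuad, h.1, h.2]

theorem conj_ne_zero (i : ℕ) : conjEmb k K F i x ≠ 0 ∨ conjEmb k K F i y ≠ 0 := by
  simpa using hv.ne_zero

theorem Qf_self (i : ℕ) : Qf k a (conjEmb k K F i x) (conjEmb k K F i y) i ≠ 0 := by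
  have := conjEmb_Qf (F := F) (k := k) (a := a) x y i 0
  rw [add_zero] at this
  rw [← this]
  simpa using hv.zero

theorem Qf_one (i : ℕ) : Qf k a (conjEmb k K F i x) (conjEmb k K F i y) (i + 1) = 0 := by
  rw [← conjEmb_Qf, hv.one, map_zero]

theorem Qf_two (i : ℕ) : Qf k a (conjEmb k K F i x) (conjEmb k K F i y) (i + 2) = 0 := by
  rw [← conjEmb_Qf, hv.two, map_zero]

theorem Qf_of_ne (hK : Module.finrank k K = 3) {i j : ℕ} (hij : i % 3 ≠ j % 3) :
    Qf k a (conjEmb k K F i x) (conjEmb k K F i y) j = 0 := by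
  have h3 := Qf_add_three (F := F) hK a (conjEmb k K F i x) (conjEmb k K F i y)
  have : j % 3 = (i + 1) % 3 ∨ j % 3 = (i + 2) % 3 := by omega
  rcases this with e | e <;> rw [← apply_mod_three h3 j, e, apply_mod_three h3]
  · exact hv.Qf_one i
  · exact hv.Qf_two i

/-- If the `i`-th and `j`-th conjugates of the parameter coincided, `Q_i` would vanish at the `i`-th
one, because it vanishes at the `j`-th. -/
theorem Lf_ne_zero (hK : Module.finrank k K = 3) {i j : ℕ} (hij : i % 3 ≠ j % 3) :
    Lf k x y (conjEmb k K F i x) (conjEmb k K F i y) j ≠ 0 := by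
  intro h0
  obtain ⟨d, hd, e1, e2⟩ := exists_smul_of_mul_eq_mul (hv.conj_ne_zero i) (hv.conj_ne_zero j) h0
  have := hv.Qf_self (F := F) i
  rw [e1, e2, Qf_mul, hv.Qf_of_ne hK (Ne.symm hij), mul_zero] at this
  exact this rfl

/-- `Q_0` vanishes at the first and second conjugates of `(x, y)`. These are distinct, so `Q_0` is a
multiple of the product of the two corresponding linear forms. -/
theorem exists_factor (hK : Module.finrank k K = 3) :
    ∃ d : K, d ≠ 0 ∧ a 0 = d * (conjEmb k K K 1 y * conjEmb k K K 2 y) ∧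
      a 1 = -(d * (conjEmb k K K 1 y * conjEmb k K K 2 x +
        conjEmb k K K 1 x * conjEmb k K K 2 y)) ∧
      a 2 = d * (conjEmb k K K 1 x * conjEmb k K K 2 x) := by
  have ha : conjVec k K a 0 = a := rfl
  have h1 : binQuad a (conjEmb k K K 1 x) (conjEmb k K K 1 y) = 0 :=
    hv.Qf_of_ne (F := K) hK (i := 1) (j := 0) (by norm_num)
  have h2 : binQuad a (conjEmb k K K 2 x) (conjEmb k K K 2 y) = 0 :=
    hv.Qf_of_ne (F := K) hK (i := 2) (j := 0) (by norm_num)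
  have hd : conjEmb k K K 1 x * conjEmb k K K 2 y - conjEmb k K K 2 x * conjEmb k K K 1 y ≠ 0 := by
    have := hv.Lf_ne_zero (F := K) hK (i := 1) (j := 2) (by norm_num)
    rwa [Lf, mul_comm (conjEmb k K K 1 y)] at this
  obtain ⟨d, e0, e1, e2⟩ := exists_binQuad_eq_of_zeros a hd h1 h2
  refine ⟨d, ?_, e0, e1, e2⟩
  rintro rfl
  apply hv.zero
  simp [Qf, ha, binQuad, e0, e1, e2]

end IsVertex

theorem Qf_eq_mul_Lf {d x y : K} (e0 : a 0 = d * (conjEmb k K K 1 y * conjEmb k K K 2 y))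
    (e1 : a 1 = -(d * (conjEmb k K K 1 y * conjEmb k K K 2 x +
      conjEmb k K K 1 x * conjEmb k K K 2 y)))
    (e2 : a 2 = d * (conjEmb k K K 1 x * conjEmb k K K 2 x)) (s t : F) (j : ℕ) :
    Qf k a s t j = conjEmb k K F j d * (Lf k x y s t (j + 1) * Lf k x y s t (j + 2)) := by
  simp only [Qf, binQuad, conjVec_apply, e0, e1, e2, map_mul, map_neg, map_add, conjEmb_conjEmb, Lf]
  ring

/-- The coefficients of the parametrisation `d (s y - t x) (s², st, t²)`. -/
def cubicCoeff (d x y : K) (n : Fin 4) : Vec 2 K :=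
  ![![d * y, -(d * x), 0, 0] n, ![0, d * y, -(d * x), 0] n, ![0, 0, d * y, -(d * x)] n]

variable (m M) in
/-- The curve `s, t ↦ d' d'' (s y - t x) (s², st, t²)`, where `d'`, `d''` are the conjugates
of `d`. -/
def Bose.cubicMap (hK : Module.finrank k K = 3) (d x y : K) : Vec 3 k →ₗ[k] Vec 8 k :=
  m.curveMap M hK (cubicCoeff (conjEmb k K K 1 d * conjEmb k K K 2 d) x y)

theorem Bose.Y_cubicMap (hK : Module.finrank k K = 3) (d x y : K) (s t : F) (j : ℕ) :
    m.Y M F j (extLin F (m.cubicMap M hK d x y) (veronese 3 s t)) =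
      (conjEmb k K F (j + 1) d * conjEmb k K F (j + 2) d * Lf k x y s t j) • veronese 2 s t := by
  ext b
  rw [Bose.cubicMap, Bose.Y_curveMap]
  fin_cases b <;>
  · simp [Fin.sum_univ_four, cubicCoeff, conjEmb_conjEmb, veronese, Lf]
    ring

/-- For a kernel vector `W`, each consecutive pair satisfies `y W_n = x W_{n+1}` and its conjugates.
Two of these relations are independent since the conjugate parameters are distinct, so both entries
vanish. -/
theorem Bose.cubicMap_injective (hK : Module.finrank k K = 3) {d x y : K} (hd : d ≠ 0)
    (hv : IsVertex k a x y) : Function.Injective (m.cubicMap M hK d x y) := by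
  rw [injective_iff_map_eq_zero]
  intro w hw
  let W : ℕ → K := fun n => if h : n < 4 then algebraMap k K (w ⟨n, h⟩) else 0
  have hW : ∀ i : Fin 4, algebraMap k K (w i) = W i := by
    intro i
    simp [W]
  have e : ∀ j, ∀ n < 3, conjEmb k K K j y * W n = conjEmb k K K j x * W (n + 1) := by
    intro j n hn
    have e := m.curveMap_eq_zero (M := M) hK hw j ⟨n, hn⟩
    simp only [hW] at e
    set d' := conjEmb k K K 1 d * conjEmb k K K 2 d with hd'
    have hne : conjEmb k K K j d' ≠ 0 := by simpa [hd'] using hd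
    apply mul_left_cancel₀ hne
    clear_value d'
    interval_cases n <;>
    · simp [Fin.sum_univ_four, cubicCoeff] at e
      simp only [zero_add, Nat.reduceAdd]
      linear_combination e
  have hD := hv.Lf_ne_zero (F := K) hK (i := 1) (j := 0) (by norm_num)
  rw [Lf] at hD
  have key : ∀ n < 3, W n = 0 ∧ W (n + 1) = 0 := by
    intro n hn
    have e0 := e 0 n hn
    have e1 := e 1 n hn
    refine ⟨(mul_eq_zero.mp ?_).resolve_left hD, (mul_eq_zero.mp ?_).resolve_left hD⟩
    · linear_combination conjEmb k K K 1 x * e0 - conjEmb k K K 0 x * e1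
    · linear_combination conjEmb k K K 1 y * e0 - conjEmb k K K 0 y * e1
  ext i
  have h0 := key 0 (by omega)
  have h1 := key 2 (by omega)
  have := hW i
  have hz : W i = 0 := by
    fin_cases i
    exacts [h0.1, h0.2, h1.1, h1.2]
  rw [hz] at this
  simpa using this

/-! ### The lines at infinity -/

/-- The line in the span of the transversal planes other than the `i`-th one, whose points have
both components equal to the `i`-th conjugate of the point of the conic with parameter `(x, y)`. -/
def Bose.vertexLine (m : Bose k K) (M : Vec 2 K ≃ₗ[K] Vec 2 K) (F : Type*) [Field F]
    [Algebra K F] (x y : K) (i : ℕ) : Submodule F (Vec 8 F) :=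
  Submodule.span F {m.G M F (i + 1) (veronese 2 (conjEmb k K F i x) (conjEmb k K F i y)),
    m.G M F (i + 2) (veronese 2 (conjEmb k K F i x) (conjEmb k K F i y))}

variable {x y : K}

theorem Bose.mem_vertexLine_iff (hK : Module.finrank k K = 3) {i : ℕ} {v : Vec 8 F} :
    v ∈ m.vertexLine M F x y i ↔ m.Y M F i v = 0 ∧
      (∃ α : F, m.Y M F (i + 1) v = α • veronese 2 (conjEmb k K F i x) (conjEmb k K F i y)) ∧
      ∃ α : F, m.Y M F (i + 2) v = α • veronese 2 (conjEmb k K F i x) (conjEmb k K F i y) := by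
  rw [Bose.vertexLine, Submodule.mem_span_pair]
  set u := veronese 2 (conjEmb k K F i x) (conjEmb k K F i y)
  have y01 : m.Y M F i (m.G M F (i + 1) u) = 0 := m.Y_G_add M hK (by simp) i u
  have y02 : m.Y M F i (m.G M F (i + 2) u) = 0 := m.Y_G_add M hK (by simp) i u
  have y12 : m.Y M F (i + 1) (m.G M F (i + 2) u) = 0 :=
    m.Y_G_add M hK (d := 1) (by simp) (i + 1) u
  have y21 : m.Y M F (i + 2) (m.G M F (i + 1) u) = 0 :=
    m.Y_G_add_three hK (i := i + 1) (d := 1) (by simp) u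
  constructor
  · rintro ⟨α, β, rfl⟩
    refine ⟨?_, ⟨α, ?_⟩, ⟨β, ?_⟩⟩ <;>
      simp only [map_add, map_smul, y01, y02, y12, y21, m.Y_G, smul_zero, add_zero, zero_add]
  · rintro ⟨h0, ⟨α, hα⟩, ⟨β, hβ⟩⟩
    refine ⟨α, β, m.Y_ext (M := M) hK (forall_of_three_succ (fun j => ?_) i ?_ ?_ ?_)⟩
    · rw [m.Y_add_three M hK]
    · simp only [map_add, map_smul, y01, y02, h0, smul_zero, add_zero]
    · simp only [map_add, map_smul, y12, m.Y_G, hα, smul_zero, add_zero]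
    · simp only [map_add, map_smul, y21, m.Y_G, hβ, smul_zero, zero_add]

theorem Bose.vertexLine_add_three (hK : Module.finrank k K = 3) (i : ℕ) :
    m.vertexLine M F x y (i + 3) = m.vertexLine M F x y i := by
  rw [Bose.vertexLine, Bose.vertexLine, show i + 3 + 1 = i + 1 + 3 by ring,
    show i + 3 + 2 = i + 2 + 3 by ring, m.G_add_three M hK, m.G_add_three M hK,
    conjEmb_add_three hK]

theorem subMap_span_pair {F F' : Type*} [Field F] [Field F'] {n : ℕ} (σ : F →+* F')
    (u v : Vec n F) : subMap σ (Submodule.span F {u, v}) =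
      Submodule.span F' {coordMap σ u, coordMap σ v} := by
  refine le_antisymm (Submodule.span_le.mpr ?_) (Submodule.span_le.mpr ?_)
  · rintro _ ⟨w, hw, rfl⟩
    obtain ⟨a, b, rfl⟩ := Submodule.mem_span_pair.mp hw
    rw [map_add, coordMap_smul, coordMap_smul]
    exact Submodule.mem_span_pair.mpr ⟨_, _, rfl⟩
  · rintro _ (rfl | rfl)
    · exact coordMap_mem_subMap σ (Submodule.subset_span (by simp))
    · exact coordMap_mem_subMap σ (Submodule.subset_span (by simp))

theorem Bose.conj_vertexLine (i : ℕ) :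
    conj k (m.vertexLine M F x y i) = m.vertexLine M F x y (i + 1) := by
  rw [conj, Bose.vertexLine, subMap_span_pair, m.coordMap_frob_G, m.coordMap_frob_G,
    coordMap_veronese, frob_conjEmb, frob_conjEmb]
  rfl

theorem Bose.coordMap_algebraMap_G (j : ℕ) (u : Vec 2 K) :
    coordMap (algebraMap K F) (m.G M K j u) = m.G M F j (coordMap (algebraMap K F) u) := by
  have h1 : m.G M F j = twist k F 0 (m.G M K j) := by
    rw [Bose.G, Bose.G, twist_twist, zero_add]
  rw [h1, twist_zero_left, extLin_coordMap]

theorem Bose.ext_vertexLine (i : ℕ) :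
    ext F (m.vertexLine M K x y i) = m.vertexLine M F x y i := by
  rw [ext, Bose.vertexLine, subMap_span_pair, m.coordMap_algebraMap_G, m.coordMap_algebraMap_G,
    coordMap_veronese]
  rfl

/-- The `i`-th line contains a point lying in the `j`-th transversal plane alone, and points of the
`j`-th line have no component there. -/
theorem Bose.vertexLine_ne (hK : Module.finrank k K = 3) (hxy : x ≠ 0 ∨ y ≠ 0) {i j : ℕ}
    (hij : j = i + 1 ∨ j = i + 2) : m.vertexLine M F x y i ≠ m.vertexLine M F x y j := by
  intro h
  have hu : veronese 2 (conjEmb k K F i x) (conjEmb k K F i y) ≠ 0 :=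
    veronese_ne_zero (by simpa using hxy)
  have hm : m.G M F j (veronese 2 (conjEmb k K F i x) (conjEmb k K F i y)) ∈
      m.vertexLine M F x y i := by
    rcases hij with rfl | rfl <;> exact Submodule.subset_span (by simp)
  rw [h] at hm
  have := ((m.mem_vertexLine_iff hK).mp hm).1
  rw [m.Y_G] at this
  exact hu this

theorem Bose.finrank_vertexLine (hK : Module.finrank k K = 3) (hxy : x ≠ 0 ∨ y ≠ 0) (i : ℕ) :
    Module.finrank F (m.vertexLine M F x y i) = 2 := by
  have hu : veronese 2 (conjEmb k K F i x) (conjEmb k K F i y) ≠ 0 :=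
    veronese_ne_zero (by simpa using hxy)
  rw [Bose.vertexLine]
  set u := veronese 2 (conjEmb k K F i x) (conjEmb k K F i y)
  have hli : LinearIndependent F ![m.G M F (i + 1) u, m.G M F (i + 2) u] := by
    rw [LinearIndependent.pair_iff]
    intro α β h
    have y12 : m.Y M F (i + 1) (m.G M F (i + 2) u) = 0 :=
      m.Y_G_add M hK (d := 1) (by simp) (i + 1) u
    have y21 : m.Y M F (i + 2) (m.G M F (i + 1) u) = 0 :=
      m.Y_G_add_three hK (i := i + 1) (d := 1) (by simp) u
    have h1 := congrArg (m.Y M F (i + 1)) h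
    have h2 := congrArg (m.Y M F (i + 2)) h
    simp only [map_add, map_smul, y12, y21, m.Y_G, smul_zero, add_zero, zero_add, map_zero,
      smul_eq_zero, hu, or_false] at h1 h2
    exact ⟨h1, h2⟩
  have := finrank_span_eq_card hli
  rwa [Matrix.range_cons, Matrix.range_cons, Matrix.range_empty, Set.union_empty,
    Set.singleton_union, Fintype.card_fin] at this

theorem Bose.mem_iterate_conj {u : Vec 2 K} (hu : M u ∈ ℓ) (j : ℕ) :
    m.G M K j (coordMap (conjEmb k K K j) u) ∈ (conj k)^[j] (ℓ.map m.toVec) := by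
  rw [m.G_coordMap, conjEmb_self]
  induction j with
  | zero => exact ⟨M u, hu, rfl⟩
  | succ j ih =>
    rw [Function.iterate_succ_apply', coordMap_frob_pow_succ]
    exact coordMap_mem_subMap _ ih

theorem Bose.IsLineEq.G_mem_transversal (hK : Module.finrank k K = 3)
    (h : m.IsLineEq M ℓ S6 a) (hv : IsVertex k a x y) {i j : ℕ} (hij : i % 3 ≠ j % 3) :
    m.G M K j (veronese 2 (conjEmb k K K i x) (conjEmb k K K i y)) ∈
      (conj k)^[j] (ℓ.map m.toVec) := by
  -- Modulo 3 the index is `i - j`, so that the `j`-th conjugate restores the parameter with index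
  -- `i`.
  have hmem : M (veronese 2 (conjEmb k K K (i + 2 * j) x) (conjEmb k K K (i + 2 * j) y)) ∈ ℓ := by
    rw [h.mem_line, dotProduct_veronese]
    exact hv.Qf_of_ne (F := K) hK (i := i + 2 * j) (j := 0) (by omega)
  have e : ∀ z : K, conjEmb k K K j (conjEmb k K K (i + 2 * j) z) = conjEmb k K K i z := by
    intro z
    rw [conjEmb_self (i + 2 * j), conjEmb_frob_pow]
    have h3 : ∀ n, conjEmb k K K (n + 3) = conjEmb k K K n := conjEmb_add_three hK
    rw [← apply_mod_three h3 (j + (i + 2 * j)), ← apply_mod_three h3 i]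
    congr 2
    omega
  have := m.mem_iterate_conj hmem j
  rwa [coordMap_veronese, e, e] at this

theorem Bose.IsLineEq.isTLine_vertexLine (hK : Module.finrank k K = 3)
    (h : m.IsLineEq M ℓ S6 a) (hv : IsVertex k a x y) (i : ℕ) :
    m.IsTLine ℓ (m.vertexLine M K x y i) := by
  have hu : veronese 2 (conjEmb k K K i x) (conjEmb k K K i y) ≠ 0 :=
    veronese_ne_zero (hv.conj_ne_zero i)
  have hG : ∀ j, m.G M K j (veronese 2 (conjEmb k K K i x) (conjEmb k K K i y)) ≠ 0 := by
    intro j h0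
    have := congrArg (m.Y M K j) h0
    rw [m.Y_G, map_zero] at this
    exact hu this
  refine ⟨m.finrank_vertexLine hK hv.ne_zero i, ?_, ⟨(i + 1) % 3, by omega⟩,
    ⟨(i + 2) % 3, by omega⟩, ?_, ?_, ?_⟩
  · intro v hvm
    obtain ⟨h0, ⟨α, hα⟩, ⟨β, hβ⟩⟩ := (m.mem_vertexLine_iff hK).mp hvm
    rw [h.mem_ext_infinity_iff hK]
    have : ∀ j, m.infForm M a K j v = 0 := by
      refine forall_of_three_succ (fun j => ?_) i ?_ ?_ ?_
      · rw [Bose.infForm, Bose.infForm, conjEmb_add_three hK, m.Y_add_three M hK]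
      · rw [Bose.infForm_apply, h0, dotProduct_zero]
      · rw [Bose.infForm_apply, hα, dotProduct_smul, dotProduct_veronese]
        exact smul_eq_zero_of_right α (hv.Qf_one i)
      · rw [Bose.infForm_apply, hβ, dotProduct_smul, dotProduct_veronese]
        exact smul_eq_zero_of_right β (hv.Qf_two i)
    exact fun j _ => this j
  · intro e
    have := congrArg Fin.val e
    simp only at this
    omega
  · intro hdis
    refine hG ((i + 1) % 3) (Submodule.disjoint_def.mp hdis _ ?_
      (h.G_mem_transversal hK hv (j := _ % 3) (by omega)))
    rw [apply_mod_three (m.G_add_three M hK)]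
    exact Submodule.subset_span (by simp)
  · intro hdis
    refine hG ((i + 2) % 3) (Submodule.disjoint_def.mp hdis _ ?_
      (h.G_mem_transversal hK hv (j := _ % 3) (by omega)))
    rw [apply_mod_three (m.G_add_three M hK)]
    exact Submodule.subset_span (by simp)

/-! ### The variety in the cubic case -/

/-- Here `Q_j = d_j L_{j+1} L_{j+2}`. Parameters with all `L_j` non-zero give one point each, on the
cubic; each of the three parameters with `L_i = 0` gives a whole line. The lines are indexed 1, 2,
3, with 3 in place of 0, so that successive ones are conjugate. -/
theorem Bose.IsLineEq.conicVariety_eq_cubic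
    (hK : Module.finrank k K = 3) (hS6 : Module.finrank k S6 = 7)
    (h : m.IsLineEq (frameTrans N M) ℓ S6 a) (hf : conicEq N.symm f =
      MvPolynomial.C c * (MvPolynomial.X 0 * MvPolynomial.X 2 - MvPolynomial.X 1 ^ 2))
    (hc : c ≠ 0) (hv : IsVertex k a x y) {d : K} (hd : d ≠ 0)
    (hQL : ∀ (s t : F) (j : ℕ),
      Qf k a s t j = conjEmb k K F j d * (Lf k x y s t (j + 1) * Lf k x y s t (j + 2))) :
    m.conicVariety S6 M f F = nrc F (m.cubicMap (frameTrans N M) hK d x y) ∪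
      (pts (m.vertexLine (frameTrans N M) F x y 1) ∪ pts (m.vertexLine (frameTrans N M) F x y 2) ∪
        pts (m.vertexLine (frameTrans N M) F x y 3)) := by
  have hlines : ∀ P : PG 8 F, (P ∈ pts (m.vertexLine (frameTrans N M) F x y 1) ∪
      pts (m.vertexLine (frameTrans N M) F x y 2) ∪ pts (m.vertexLine (frameTrans N M) F x y 3)) ↔
      ∃ i, P ∈ pts (m.vertexLine (frameTrans N M) F x y i) := by
    intro P
    have h3 := m.vertexLine_add_three (M := frameTrans N M) (F := F) (x := x) (y := y) hK
    constructor
    · rintro ((h | h) | h)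
      exacts [⟨_, h⟩, ⟨_, h⟩, ⟨_, h⟩]
    · rintro ⟨i, hi⟩
      have : i % 3 = 1 ∨ i % 3 = 2 ∨ i % 3 = 0 := by omega
      rw [← apply_mod_three h3] at hi
      rcases this with e | e | e <;> rw [e] at hi
      · exact Or.inl (Or.inl hi)
      · exact Or.inl (Or.inr hi)
      · right; rw [← h3 0] at hi; exact hi
  have hd0 : ∀ j, conjEmb k K F j d ≠ 0 := fun j => by simpa using hd
  have hd3 : ∀ j, conjEmb k K F (j + 3) d = conjEmb k K F j d := fun j => by
    rw [conjEmb_add_three hK]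
  ext P
  rw [Set.mem_union, hlines]
  constructor
  · intro hP
    obtain ⟨s, t, α, hst, hα3, hα, hQ⟩ :=
      (h.mem_conicVariety_iff hK hS6 hf hc (isRep_rep P)).mp hP
    have hL3 := Lf_add_three (F := F) hK x y s t
    by_cases hex : ∃ i, Lf k x y s t i = 0
    · right
      obtain ⟨i, hi⟩ := hex
      refine ⟨i, ?_⟩
      obtain ⟨b, hb, rfl, rfl⟩ := exists_smul_of_mul_eq_mul hst (hv.conj_ne_zero i) hi
      rw [mem_pts_iff, m.mem_vertexLine_iff hK, hα, hα, hα, veronese_smul]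
      refine ⟨?_, ⟨_, smul_smul _ _ _⟩, ⟨_, smul_smul _ _ _⟩⟩
      -- At this parameter `Q_{i+1}` and `Q_{i+2}` vanish but `Q_i` does not. So the only constraint
      -- is `α_i = 0`, and the other two coefficients are free.
      have h1 := (hQ i).trans (hQ (i + 1)).symm
      rw [Qf_mul, Qf_mul, hv.Qf_one, mul_zero, mul_zero] at h1
      have : α i = 0 := (mul_eq_zero.mp h1).resolve_right
        (mul_ne_zero (pow_ne_zero 2 hb) (hv.Qf_self i))
      rw [this, zero_smul]
    · left
      push Not at hex
      simp only [hQL] at hQ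
      set D : ℕ → F := fun j => conjEmb k K F j d with hD
      set Λ := Lf k x y s t with hΛ
      -- Multiplying `α_j d_j L_{j+1} L_{j+2} = const` by the cyclically invariant `L_0 L_1 L_2` and
      -- cancelling shows `α_j` proportional to `d_{j+1} d_{j+2} L_j`.
      have hα' : ∀ j, α j = α 0 / (D 1 * D 2 * Λ 0) * (D (j + 1) * D (j + 2) * Λ j) := by
        have x0 := hex 0
        have x1 := hex 1
        have x2 := hex 2
        have y0 : D 0 ≠ 0 := hd0 0
        have y1 : D 1 ≠ 0 := hd0 1
        have y2 : D 2 ≠ 0 := hd0 2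
        have D3 : D 3 = D 0 := hd3 0
        have D4 : D 4 = D 1 := hd3 1
        have L3 : Λ 3 = Λ 0 := hL3 0
        have L4 : Λ 4 = Λ 1 := hL3 1
        refine forall_of_lt_three (fun j => ?_) fun j hj => ?_
        · rw [hα3, show j + 3 + 1 = j + 1 + 3 by ring, show j + 3 + 2 = j + 2 + 3 by ring, hL3]
          simp only [hD, hd3]
        · interval_cases j
          · field_simp
          · have := hQ 1
            norm_num at this ⊢
            rw [D3]
            rw [L3] at this
            field_simp
            apply mul_left_cancel₀ x2
            linear_combination this
          · have := hQ 2
            norm_num at this ⊢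
            rw [D3, D4]
            rw [L3, L4] at this
            field_simp
            apply mul_left_cancel₀ x1
            linear_combination this
      refine ⟨s, t, hst, (isRep_rep P).of_eq_smul (c := α 0 / (D 1 * D 2 * Λ 0)) ?_⟩
      refine m.Y_ext (M := frameTrans N M) hK fun j => ?_
      rw [hα, map_smul, m.Y_cubicMap, hα' j, smul_smul]
  · rintro (⟨s, t, hst, hP⟩ | ⟨i, hi⟩)
    · have hL3 := Lf_add_three (F := F) hK x y s t
      refine (h.mem_conicVariety_iff hK hS6 hf hc hP).mpr
        ⟨s, t, fun j => conjEmb k K F (j + 1) d * conjEmb k K F (j + 2) d * Lf k x y s t j, hst,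
          fun j => ?_, fun j => m.Y_cubicMap hK d x y s t j, ?_⟩
      · beta_reduce
        rw [show j + 3 + 1 = j + 1 + 3 by ring, show j + 3 + 2 = j + 2 + 3 by ring, hd3, hd3, hL3]
      · simp only [hQL]
        refine forall_of_lt_three (fun j => ?_) fun j hj => ?_
        · rw [show j + 3 + 1 = j + 1 + 3 by ring, show j + 3 + 2 = j + 2 + 3 by ring, hd3, hd3, hd3,
            hL3, hL3, hL3]
        · have D3 := hd3 0
          have D4 := hd3 1
          have L3 := hL3 0
          have L4 := hL3 1
          norm_num at D3 D4 L3 L4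
          interval_cases j
          · rfl
          · norm_num; rw [D3, L3]; ring
          · norm_num; rw [D3, L3, D4, L4]; ring
    · rw [mem_pts_iff] at hi
      obtain ⟨h0, h1, h2⟩ := (m.mem_vertexLine_iff hK).mp hi
      have hu : veronese 2 (conjEmb k K F i x) (conjEmb k K F i y) ≠ 0 :=
        veronese_ne_zero (hv.conj_ne_zero i)
      have hY3 := m.Y_add_three (F := F) (frameTrans N M) hK
      have hall : ∀ j, ∃ β : F, m.Y (frameTrans N M) F j P.rep =
          β • veronese 2 (conjEmb k K F i x) (conjEmb k K F i y) := by
        refine forall_of_three_succ (fun j => by rw [hY3]) i ⟨0, by rw [h0, zero_smul]⟩ h1 h2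
      choose α hα using hall
      have hα3 : ∀ j, α (j + 3) = α j := by
        intro j
        apply smul_left_injective F hu
        change _ • _ = _ • _
        rw [← hα, ← hα, hY3]
      refine (h.mem_conicVariety_iff hK hS6 hf hc (isRep_rep P)).mpr
        ⟨_, _, α, hv.conj_ne_zero i, hα3, hα, ?_⟩
      have hz : ∀ j, α j * Qf k a (conjEmb k K F i x) (conjEmb k K F i y) j = 0 := by
        refine forall_of_three_succ (fun j => by rw [hα3, Qf_add_three hK]) i ?_ ?_ ?_
        · have : α i = 0 := by
            have := hα i
            rw [h0] at this
            exact (smul_eq_zero.mp this.symm).resolve_right hu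
          rw [this, zero_mul]
        · rw [hv.Qf_one, mul_zero]
        · rw [hv.Qf_two, mul_zero]
      intro j
      rw [hz, hz]

end Cubic

/-! ### The cubic case at infinity -/

section Subspaces

variable {F F' : Type*} [Field F] [Field F'] {n : ℕ}

theorem subMap_span_singleton (σ : F →+* F') (u : Vec n F) :
    subMap σ (Submodule.span F {u}) = Submodule.span F' {coordMap σ u} := by
  simpa using subMap_span_pair σ u u

theorem ptMap_submodule (σ : F →+* F') (P : PG n F) :
    (ptMap σ P).submodule = subMap σ P.submodule := by
  rw [isRep_rep P, subMap_span_singleton]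
  exact (isRep_rep P).ptMap σ

theorem ptMap_mem_pts (σ : F →+* F') {P : PG n F} {W : Submodule F (Vec n F)} (h : P ∈ pts W) :
    ptMap σ P ∈ pts (subMap σ W) :=
  ((isRep_rep P).ptMap σ).mem_pts.mpr (coordMap_mem_subMap σ (mem_pts_iff.mp h))

theorem ext_rat_le [Algebra F F'] (W : Submodule F' (Vec n F')) : ext F' (rat F W) ≤ W := by
  refine Submodule.span_le.mpr ?_
  rintro _ ⟨v, hv, rfl⟩
  exact hv

variable {k K : Type*} [Field k] [Fintype k] [Field K] [Algebra k K] (m : Bose k K)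

theorem Bose.toΓ_submodule (X : PG 2 K) : (m.toΓ X).submodule = X.submodule.map m.toVec := by
  have h : IsRep (m.toΓ X) (extLin K m.toVec X.rep) := (isRep_rep X).map _ _
  rw [h, isRep_rep X, Submodule.map_span, Set.image_singleton, extLin_self]

theorem Bose.plane_eq (X : PG 2 K) :
    m.plane X = rat k (X.submodule.map m.toVec ⊔ conj k (X.submodule.map m.toVec) ⊔
      conj k (conj k (X.submodule.map m.toVec))) := by
  rw [Bose.plane, conjPt, ptMap_submodule, ptMap_submodule, ptMap_submodule, m.toΓ_submodule]
  rfl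

end Subspaces

/-! ### T-lines and points at infinity of the cubic -/

section CubicInfinity

variable {k K L : Type*} [Field k] [Fintype k] [Field K] [Field L]
  [Algebra k K] [Algebra k L] [Algebra K L] [IsScalarTower k K L]
  {m : Bose k K} {M : Vec 2 K ≃ₗ[K] Vec 2 K} {N : Vec 2 k ≃ₗ[k] Vec 2 k}
  {ℓ : Submodule K (Vec 2 K)} {S6 : Submodule k (Vec 8 k)} {a : Vec 2 K}
  {f : MvPolynomial (Fin 3) k} {c : k}

/-- The common point of the first and the second conjugate of the line `a`. -/
def meetVec (k : Type*) {K : Type*} [Field k] [Fintype k] [Field K] [Algebra k K]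
    (a : Vec 2 K) : Vec 2 K :=
  crossProduct (conjVec k K a 1) (conjVec k K a 2)

theorem conjVec_meetVec (j : ℕ) :
    conjVec k K (meetVec k a) j = crossProduct (conjVec k K a (j + 1)) (conjVec k K a (j + 2)) := by
  rw [meetVec, conjVec, coordMap_crossProduct, coordMap_conjEmb_conjVec, coordMap_conjEmb_conjVec]

theorem Bose.IsLineEq.dotProduct_meetVec_ne_zero (hK : Module.finrank k K = 3)
    (h : m.IsLineEq M ℓ S6 a) :
    dotProduct (conjVec k K a 0) (meetVec k a) ≠ 0 := by
  have := h.det_ne_zero hK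
  simp only [← conjEmb_self] at this
  exact this

/-- A vanishing resultant puts the intersection of the first and second conjugate lines on the
conic, so it has a parameter over `K`. It is not on the line itself because the three conjugates are
not concurrent. -/
theorem Bose.IsLineEq.exists_isVertex (hK : Module.finrank k K = 3)
    (h : m.IsLineEq M ℓ S6 a) (hr : resultant (conjVec k K a 0) (conjVec k K a 1) = 0) :
    ∃ b x y : K, b ≠ 0 ∧ meetVec k a = b • veronese 2 x y ∧ IsVertex k a x y := by
  have h0 := h.dotProduct_meetVec_ne_zero hK
  have hne : meetVec k a ≠ 0 := by
    intro e
    rw [e, dotProduct_zero] at h0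
    exact h0 rfl
  have hr1 : resultant (conjVec k K a 1) (conjVec k K a 2) = 0 := by
    have := congrArg (conjEmb k K K 1) hr
    rwa [map_resultant, coordMap_conjEmb_conjVec, coordMap_conjEmb_conjVec, map_zero] at this
  obtain ⟨b, x, y, hb, hxy, e⟩ := exists_veronese hne (sub_eq_zero.mp hr1)
  have hQ : ∀ j, dotProduct (conjVec k K a j) (meetVec k a) = b * Qf k a x y j := by
    intro j
    rw [e, dotProduct_smul, dotProduct_veronese, smul_eq_mul]
    rfl
  refine ⟨b, x, y, hb, e, ?_, ?_, ?_⟩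
  · intro h1
    rw [hQ, h1, mul_zero] at h0
    exact h0 rfl
  · refine (mul_eq_zero.mp ((hQ 1).symm.trans ?_)).resolve_left hb
    exact dot_self_cross _ _
  · refine (mul_eq_zero.mp ((hQ 2).symm.trans ?_)).resolve_left hb
    exact dot_cross_self _ _

theorem isRep_conjVec_veronese {b x y : K} (e : meetVec k a = b • veronese 2 x y) {E : PG 2 K}
    {j : ℕ} (hE : IsRep E (M (conjVec k K (meetVec k a) j))) :
    IsRep E (M (veronese 2 (conjEmb k K K j x) (conjEmb k K K j y))) := by
  rw [e, conjVec, coordMap_smul, coordMap_veronese, map_smul] at hE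
  exact hE.of_eq_smul rfl

/-- Conjugating the second point twice turns its parameter index 2 into 4, that is 1 modulo 3. The
two points thus have the same parameter, one in `Γ` (index 3, equal to 0) and one in `Γ^(q²)`. -/
theorem Bose.joinLine_eq_vertexLine (hK : Module.finrank k K = 3) {x y : K} {E E' : PG 2 K}
    (hE : IsRep E (M (veronese 2 (conjEmb k K K 1 x) (conjEmb k K K 1 y))))
    (hE' : IsRep E' (M (veronese 2 (conjEmb k K K 2 x) (conjEmb k K K 2 y)))) :
    m.joinLine E E' = m.vertexLine M K x y 1 := by
  have h1 : IsRep (m.toΓ E) _ := m.isRep_toΓ M (F := K) (by rw [extLin_self]; exact hE)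
  have h2 : IsRep (m.toΓ E') _ := m.isRep_toΓ M (F := K) (by rw [extLin_self]; exact hE')
  have h3 := (h2.ptMap (frob k K)).ptMap (frob k K)
  rw [m.coordMap_frob_G, m.coordMap_frob_G, coordMap_veronese, coordMap_veronese, frob_conjEmb,
    frob_conjEmb, frob_conjEmb, frob_conjEmb, conjEmb_add_three hK 1] at h3
  rw [Bose.joinLine, h1, conjPt, h3, Bose.vertexLine, m.G_add_three M hK 0, sup_comm,
    ← Submodule.span_insert]

theorem Bose.infForm_cubic (hK : Module.finrank k K = 3) {d x y : K}
    (hQL : ∀ (s t : K) (j : ℕ),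
      Qf k a s t j = conjEmb k K K j d * (Lf k x y s t (j + 1) * Lf k x y s t (j + 2)))
    (s t : K) : m.infForm M a K 0 (extLin K (m.cubicMap M hK d x y) (veronese 3 s t)) =
      conjEmb k K K 0 d * conjEmb k K K 1 d * conjEmb k K K 2 d *
        (Lf k x y s t 1 * Lf k x y s t 2 * Lf k x y s t 3) := by
  rw [Bose.infForm_apply, m.Y_cubicMap, dotProduct_smul, dotProduct_veronese, smul_eq_mul,
    ← Lf_add_three hK x y s t 0]
  have := hQL s t 0
  rw [Qf, conjVec] at this
  rw [this]
  ring

theorem Bose.isRep_cubic_mem_vertexLine (hK : Module.finrank k K = 3) {d x y : K} {R : PG 8 K}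
    (hR : IsRep R (extLin K (m.cubicMap M hK d x y)
      (veronese 3 (conjEmb k K K 1 x) (conjEmb k K K 1 y)))) :
    R ∈ pts (m.vertexLine M K x y 1) := by
  rw [hR.mem_pts, m.mem_vertexLine_iff hK, m.Y_cubicMap, m.Y_cubicMap, m.Y_cubicMap]
  refine ⟨?_, ⟨_, rfl⟩, ⟨_, rfl⟩⟩
  rw [Lf, mul_comm (conjEmb k K K 1 x), sub_self, mul_zero, zero_smul]

/-- The points at infinity of the cubic curve lie on no extended spread plane. -/
theorem Bose.notMem_ext_plane (hK : Module.finrank k K = 3) {d x y : K} (hd : d ≠ 0)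
    (hv : IsVertex k a x y) {R : PG 8 K}
    (hR : IsRep R (extLin K (m.cubicMap M hK d x y)
      (veronese 3 (conjEmb k K K 1 x) (conjEmb k K K 1 y)))) (X : PG 2 K) :
    R ∉ pts (ext K (m.plane X)) := by
  intro hmem
  rw [hR.mem_pts, m.plane_eq] at hmem
  have h := (m.mem_sup_conj_iff M hK X.submodule _).mp (ext_rat_le _ hmem)
  -- Let `w` represent `X`. In an extended spread plane the components 0 and 2 are multiples of `w`
  -- and `w^(q²)`, while for `R` both are non-zero multiples of one conic point. That point is on
  -- the line `a`, so component 2 conjugated once gives `a^q · w = 0`; it is not on `a^q`, so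
  -- component 0 gives a contradiction.
  obtain ⟨u₀, hu₀, e₀⟩ := h 0 (by norm_num)
  obtain ⟨u₂, hu₂, e₂⟩ := h 2 (by norm_num)
  rw [m.Y_cubicMap] at e₀ e₂
  obtain ⟨w, hw⟩ : ∃ w, IsRep X (M w) := ⟨M.symm X.rep, by
    rw [M.apply_symm_apply]; exact isRep_rep X⟩
  rw [hw, Submodule.mem_span_singleton] at hu₀ hu₂
  obtain ⟨α, hα⟩ := hu₀
  obtain ⟨β, hβ⟩ := hu₂
  rw [← map_smul] at hα hβ
  obtain rfl := M.injective hα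
  obtain rfl := M.injective hβ
  have hd' : ∀ j, conjEmb k K K j d ≠ 0 := fun j => by simpa using hd
  have hL : ∀ j, 1 % 3 ≠ j % 3 → Lf k x y (conjEmb k K K 1 x) (conjEmb k K K 1 y) j ≠ 0 :=
    fun j hj => hv.Lf_ne_zero (F := K) hK hj
  have hu : veronese 2 (conjEmb k K K 1 x) (conjEmb k K K 1 y) ≠ 0 :=
    veronese_ne_zero (hv.conj_ne_zero 1)
  have hβ0 : β ≠ 0 := by
    rintro rfl
    rw [zero_smul, map_zero] at e₂
    exact smul_ne_zero (mul_ne_zero (mul_ne_zero (hd' _) (hd' _)) (hL 2 (by norm_num))) hu e₂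
  have q0 := congrArg (dotProduct (conjVec k K a 1)) e₀
  have q2 := congrArg (dotProduct (conjVec k K a 0)) e₂
  rw [dotProduct_smul, dotProduct_veronese, smul_eq_mul] at q0
  have z : binQuad (conjVec k K a 0) (conjEmb k K K 1 x) (conjEmb k K K 1 y) = 0 :=
    hv.Qf_of_ne (F := K) hK (i := 1) (j := 0) (by norm_num)
  rw [dotProduct_smul, dotProduct_veronese, z, smul_zero] at q2
  have q2' := congrArg (frob k K) q2.symm
  have h3 : coordMap (frob k K ^ (2 + 1)) (β • w) = β • w :=
    funext fun i => frob_pow_three hK _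
  rw [map_dotProduct, coordMap_frob_conjVec, ← coordMap_frob_pow_succ, h3, map_zero, zero_add,
    dotProduct_smul] at q2'
  have zw := (smul_eq_zero.mp q2').resolve_left hβ0
  rw [pow_zero] at q0
  have q0' : _ = dotProduct (conjVec k K a 1) (α • w) := q0
  rw [dotProduct_smul, zw, smul_zero] at q0'
  exact mul_ne_zero (mul_ne_zero (mul_ne_zero (hd' _) (hd' _)) (hL 0 (by norm_num)))
    (hv.Qf_self (F := K) 1) q0'

/-- On such a line one component vanishes, but the components of a rational point are conjugate, so
all would vanish. -/
theorem Bose.extPt_notMem_vertexLine (hK : Module.finrank k K = 3) {x y : K} (i : ℕ)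
    (P : PG 8 k) : extPt K P ∉ pts (m.vertexLine M K x y i) := by
  intro h
  have hP := isRep_rep P
  rw [((isRep_extPt_iff (F' := K)).mpr hP).mem_pts, m.mem_vertexLine_iff hK, m.Y_coordMap] at h
  have h0 : m.y M P.rep = 0 :=
    coordMap_injective (conjEmb k K K i) (h.1.trans (map_zero _).symm)
  exact hP.ne_zero ((m.y_bijective M hK).1 (h0.trans (map_zero _).symm))

/-- The cubic case. -/
theorem Bose.IsLineEq.cubic_case (hK : Module.finrank k K = 3) (hS6 : Module.finrank k S6 = 7)
    (h : m.IsLineEq (frameTrans N M) ℓ S6 a) (hf : conicEq N.symm f =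
      MvPolynomial.C c * (MvPolynomial.X 0 * MvPolynomial.X 2 - MvPolynomial.X 1 ^ 2))
    (hc : c ≠ 0) (hr : resultant (conjVec k K a 0) (conjVec k K a 1) = 0) {E E' : PG 2 K}
    (hE : IsRep E (frameTrans N M (conjVec k K (meetVec k a) 1)))
    (hE' : IsRep E' (frameTrans N M (conjVec k K (meetVec k a) 2))) :
    ∃ (A : Vec 3 k →ₗ[k] Vec 8 k) (h : Submodule K (Vec 8 K)),
      h = m.joinLine E E' ∧
      m.IsTLine ℓ h ∧ m.IsTLine ℓ (conj k h) ∧ m.IsTLine ℓ (conj k (conj k h)) ∧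
      m.IsNRCWithLines L S6 M f A h (conj k h) (conj k (conj k h)) ∧
      m.conicVariety S6 M f K ∩ pts (ext K (m.infinity ℓ)) =
        pts h ∪ pts (conj k h) ∪ pts (conj k (conj k h)) ∧
      ∃ R ∈ pts h,
        nrc K A ∩ pts (ext K (m.infinity ℓ)) = {R, conjPt k R, conjPt k (conjPt k R)} ∧
        MeetsIn K A S6 (m.infinity ℓ) ![R, conjPt k R, conjPt k (conjPt k R)] ∧
        ∀ X ∈ pts ℓ, R ∉ pts (ext K (m.plane X)) := by
  obtain ⟨b, x, y, hb, e, hv⟩ := h.exists_isVertex hK hr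
  obtain ⟨d, hd, e0, e1, e2⟩ := hv.exists_factor hK
  have hlK := h.conicVariety_eq_cubic (F := K) hK hS6 hf hc hv hd (Qf_eq_mul_Lf e0 e1 e2)
  have hlL := h.conicVariety_eq_cubic (F := L) hK hS6 hf hc hv hd (Qf_eq_mul_Lf e0 e1 e2)
  have hA : Function.Injective (m.cubicMap (frameTrans N M) hK d x y) :=
    m.cubicMap_injective hK hd hv
  have hT := h.isTLine_vertexLine hK hv
  have hne := fun i j => m.vertexLine_ne (M := frameTrans N M) (F := K) hK hv.ne_zero (i := i) (j := j)
  -- `R` is the curve point at the parameter where `L_1` vanishes; it lies on the line with index 1.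
  have hR0 : extLin K (m.cubicMap (frameTrans N M) hK d x y)
      (veronese 3 (conjEmb k K K 1 x) (conjEmb k K K 1 y)) ≠ 0 := fun h0 =>
    veronese_ne_zero (r := 3) (hv.conj_ne_zero 1) (extLin_injective K _ hA (h0.trans (map_zero _).symm))
  have hR := isRep_mk hR0
  set R := Projectivization.mk K _ hR0
  have hRl := m.isRep_cubic_mem_vertexLine hK hR
  have hR1l : conjPt k R ∈ pts (m.vertexLine (frameTrans N M) K x y 2) := by
    rw [← m.conj_vertexLine 1]
    exact ptMap_mem_pts _ hRl
  have hR2l : conjPt k (conjPt k R) ∈ pts (m.vertexLine (frameTrans N M) K x y 3) := by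
    rw [← m.conj_vertexLine 2]
    exact ptMap_mem_pts _ hR1l
  have hM : MeetsIn K (m.cubicMap (frameTrans N M) hK d x y) S6 (m.infinity ℓ)
      ![R, conjPt k R, conjPt k (conjPt k R)] := by
    refine ⟨![conjEmb k K K 1 x, frob k K (conjEmb k K K 1 x),
        frob k K (frob k K (conjEmb k K K 1 x))],
      ![conjEmb k K K 1 y, frob k K (conjEmb k K K 1 y),
        frob k K (frob k K (conjEmb k K K 1 y))], ?_,
      m.infForm (frameTrans N M) a K 0, h.ext_space_inf_ker hK hS6,
      conjEmb k K K 0 d * conjEmb k K K 1 d * conjEmb k K K 2 d, by simpa using hd, ?_⟩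
    · have n1 := hv.conj_ne_zero (F := K) 1
      intro j
      fin_cases j
      · exact ⟨n1, hR⟩
      · exact ⟨by simpa using n1, conjPt_nrc hR⟩
      · exact ⟨by simpa using n1, conjPt_nrc (conjPt_nrc hR)⟩
    · intro s t
      rw [m.infForm_cubic hK (Qf_eq_mul_Lf e0 e1 e2), Fin.prod_univ_three]
      simp only [frob_conjEmb]
      rfl
  have hnS : nrc K (m.cubicMap (frameTrans N M) hK d x y) ⊆ pts (ext K S6) := by
    intro P hP
    have : P ∈ m.conicVariety S6 M f K := by rw [hlK]; exact Or.inl hP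
    exact this.2
  have hin := hM.inter_eq hnS
  have hrange : Set.range ![R, conjPt k R, conjPt k (conjPt k R)] =
      {R, conjPt k R, conjPt k (conjPt k R)} := by
    rw [Matrix.range_cons, Matrix.range_cons, Matrix.range_cons, Matrix.range_empty,
      Set.union_empty, Set.singleton_union, Set.singleton_union]
  rw [hrange] at hin
  refine ⟨m.cubicMap (frameTrans N M) hK d x y, m.vertexLine (frameTrans N M) K x y 1,
    (m.joinLine_eq_vertexLine hK (isRep_conjVec_veronese e hE)
      (isRep_conjVec_veronese e hE')).symm, ?_⟩
  rw [m.conj_vertexLine, m.conj_vertexLine]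
  refine ⟨hT 1, hT 2, hT 3, ⟨hA, hne 1 2 (by simp), hne 2 3 (by simp), hne 1 3 (by simp), ?_, hlK,
    ?_⟩, ?_, R, hRl, hin, hM, fun X _ => m.notMem_ext_plane hK hd hv hR X⟩
  -- Over `k` the lines contribute no points, so only the rational points of the cubic remain.
  · ext P
    rw [← m.extPt_mem_conicVariety hK hf hc, hlK, ← extPt_mem_nrc (F := K) (by norm_num) hA]
    have hno := fun i => m.extPt_notMem_vertexLine (M := frameTrans N M) hK (x := x) (y := y) i P
    constructor
    · rintro (h1 | (h1 | h1) | h1)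
      exacts [h1, absurd h1 (hno _), absurd h1 (hno _), absurd h1 (hno _)]
    · exact Or.inl
  · rw [hlL, m.ext_vertexLine, m.ext_vertexLine, m.ext_vertexLine]
  · rw [hlK, Set.union_inter_distrib_right, hin]
    have hsub : pts (m.vertexLine (frameTrans N M) K x y 1) ∪
        pts (m.vertexLine (frameTrans N M) K x y 2) ∪
        pts (m.vertexLine (frameTrans N M) K x y 3) ⊆ pts (ext K (m.infinity ℓ)) := by
      rintro P ((h1 | h1) | h1)
      exacts [le_trans h1 (hT 1).2.1, le_trans h1 (hT 2).2.1, le_trans h1 (hT 3).2.1]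
    rw [Set.inter_eq_left.mpr hsub, Set.union_eq_right]
    rintro P (rfl | rfl | rfl)
    exacts [Or.inl (Or.inl hRl), Or.inl (Or.inr hR1l), Or.inr hR2l]

end CubicInfinity

/-! ### Carriers -/

section Carriers

variable {k K : Type*} [Field k] [Fintype k] [Field K] [Algebra k K]
  {m : Bose k K} {M : Vec 2 K ≃ₗ[K] Vec 2 K} {N : Vec 2 k ≃ₗ[k] Vec 2 k}
  {ℓ : Submodule K (Vec 2 K)} {S6 : Submodule k (Vec 8 k)} {a : Vec 2 K}

theorem conjVec_meetVec_one (hK : Module.finrank k K = 3) :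
    conjVec k K (meetVec k a) 1 = crossProduct (conjVec k K a 2) (conjVec k K a 0) := by
  rw [conjVec_meetVec, ← conjVec_add_three hK a 0]

theorem conjVec_meetVec_two (hK : Module.finrank k K = 3) :
    conjVec k K (meetVec k a) 2 = crossProduct (conjVec k K a 0) (conjVec k K a 1) := by
  rw [conjVec_meetVec, ← conjVec_add_three hK a 0, ← conjVec_add_three hK a 1]

theorem det_smul_eq {F : Type*} [Field F] (a b c v : Vec 2 F) :
    dotProduct a (crossProduct b c) • v = dotProduct a v • crossProduct b c +
      dotProduct b v • crossProduct c a + dotProduct c v • crossProduct a b := by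
  ext i
  fin_cases i <;>
  · simp [cross_apply, dotProduct, Fin.sum_univ_three]
    ring

/-- The determinant of the three conjugates of the line `a`. -/
def lineDet (k : Type*) {K : Type*} [Field k] [Fintype k] [Field K] [Algebra k K]
    (a : Vec 2 K) : K := dotProduct (conjVec k K a 0) (meetVec k a)

theorem lineDet_smul (hK : Module.finrank k K = 3) (v : Vec 2 K) :
    lineDet k a • v = ∑ j : Fin 3, dotProduct (conjVec k K a j) v • conjVec k K (meetVec k a) j := by
  rw [Fin.sum_univ_three]
  change _ = _ • conjVec k K (meetVec k a) 0 + _ • conjVec k K (meetVec k a) 1 +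
    _ • conjVec k K (meetVec k a) 2
  rw [conjVec_meetVec_one hK, conjVec_meetVec_two hK]
  exact det_smul_eq _ _ _ v

theorem dotProduct_conjVec_meetVec (hK : Module.finrank k K = 3) (i j : Fin 3) :
    dotProduct (conjVec k K a i) (conjVec k K (meetVec k a) j) = if i = j then lineDet k a else 0 := by
  have h1 := conjVec_meetVec_one (a := a) hK
  have h2 := conjVec_meetVec_two (a := a) hK
  have h0 : conjVec k K (meetVec k a) 0 = crossProduct (conjVec k K a 1) (conjVec k K a 2) := rfl
  have hd : lineDet k a =
    dotProduct (conjVec k K a 0) (crossProduct (conjVec k K a 1) (conjVec k K a 2)) := rfl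
  have t1 := triple_product_permutation (conjVec k K a 0) (conjVec k K a 1) (conjVec k K a 2)
  have t2 := triple_product_permutation (conjVec k K a 1) (conjVec k K a 2) (conjVec k K a 0)
  fin_cases i <;> fin_cases j <;> simp [h0, h1, h2, hd, t1, t2]

theorem dotProduct_ext (hK : Module.finrank k K = 3) (hδ : lineDet k a ≠ 0) {v w : Vec 2 K}
    (h : ∀ j : Fin 3, dotProduct (conjVec k K a j) v = dotProduct (conjVec k K a j) w) : v = w := by
  apply smul_right_injective (Vec 2 K) hδ
  change lineDet k a • v = lineDet k a • w
  rw [lineDet_smul hK, lineDet_smul hK]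
  simp only [h]

variable (k a) in
/-- The linear map multiplying the `j`-th conjugate of the point `meetVec k a` by the `j`-th
conjugate of `x`. -/
def diagMap (x : K) : Vec 2 K →ₗ[K] Vec 2 K where
  toFun v := (lineDet k a)⁻¹ • ∑ j : Fin 3, (conjEmb k K K j x * dotProduct (conjVec k K a j) v) •
    conjVec k K (meetVec k a) j
  map_add' v w := by
    simp only [dotProduct_add, mul_add, add_smul, Finset.sum_add_distrib, smul_add]
  map_smul' c v := by
    simp only [dotProduct_smul, smul_eq_mul, RingHom.id_apply, Finset.smul_sum, smul_smul]
    refine Finset.sum_congr rfl fun j _ => ?_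
    congr 1
    ring

theorem dotProduct_diagMap (hK : Module.finrank k K = 3) (hδ : lineDet k a ≠ 0) (x : K)
    (v : Vec 2 K) (i : Fin 3) : dotProduct (conjVec k K a i) (diagMap k a x v) =
      conjEmb k K K i x * dotProduct (conjVec k K a i) v := by
  change dotProduct _ ((lineDet k a)⁻¹ • ∑ j : Fin 3, _) = _
  rw [dotProduct_smul, dotProduct_sum]
  simp only [dotProduct_smul, dotProduct_conjVec_meetVec hK, smul_eq_mul, mul_ite, mul_zero,
    Finset.sum_ite_eq, Finset.mem_univ, if_true]
  field_simp

/-- `diagMap` as an equivalence. -/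
def diagEquiv (hK : Module.finrank k K = 3) (hδ : lineDet k a ≠ 0) {x : K} (hx : x ≠ 0) :
    Vec 2 K ≃ₗ[K] Vec 2 K :=
  have key : ∀ {x : K}, x ≠ 0 → diagMap k a x ∘ₗ diagMap k a x⁻¹ = LinearMap.id := fun {x} hx =>
    LinearMap.ext fun v => dotProduct_ext (k := k) (a := a) hK hδ fun j => by
      rw [LinearMap.comp_apply, dotProduct_diagMap hK hδ, dotProduct_diagMap hK hδ, ← mul_assoc,
        ← map_mul, mul_inv_cancel₀ hx, map_one, one_mul, LinearMap.id_apply]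
  LinearEquiv.ofLinearMap (diagMap k a x) (diagMap k a x⁻¹) (key hx) (by
    have := key (inv_ne_zero hx)
    rwa [inv_inv] at this)

/-- Frobenius permutes the vertices of the triangle and the eigenvalues by the same cycle. The check
is made on the three dual coordinates `a^(q^j) ·`. -/
theorem coordMap_frob_diagMap (hK : Module.finrank k K = 3) (hδ : lineDet k a ≠ 0) (x : K)
    (v : Vec 2 K) :
    coordMap (frob k K) (diagMap k a x v) = diagMap k a x (coordMap (frob k K) v) := by
  have key : ∀ (j : ℕ) (hj : j < 3) (w : Vec 2 K),
      dotProduct (conjVec k K a (j + 1)) (diagMap k a x w) =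
        conjEmb k K K (j + 1) x * dotProduct (conjVec k K a (j + 1)) w := by
    intro j hj w
    have h := dotProduct_diagMap hK hδ x w
    interval_cases j
    · exact h 1
    · exact h 2
    · have c3 : conjVec k K a (2 + 1) = conjVec k K a 0 := conjVec_add_three hK a 0
      have e3 : conjEmb k K K (2 + 1) = conjEmb k K K 0 := conjEmb_add_three hK 0
      rw [c3, e3]
      exact h 0
  have step : ∀ j < 3, dotProduct (conjVec k K a (j + 1)) (coordMap (frob k K) (diagMap k a x v)) =
      dotProduct (conjVec k K a (j + 1)) (diagMap k a x (coordMap (frob k K) v)) := by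
    intro j hj
    rw [key j hj, ← coordMap_frob_conjVec, ← map_dotProduct, ← map_dotProduct,
      dotProduct_diagMap hK hδ x v ⟨j, hj⟩, map_mul, frob_conjEmb]
  refine dotProduct_ext (k := k) (a := a) hK hδ fun j => ?_
  fin_cases j
  · have := step 2 (by norm_num)
    have c3 : conjVec k K a (2 + 1) = conjVec k K a 0 := conjVec_add_three hK a 0
    rwa [c3] at this
  · exact step 0 (by norm_num)
  · exact step 1 (by norm_num)

theorem exists_coordMap_of_frob (hK : Module.finrank k K = 3) {n : ℕ} {v : Vec n K}
    (h : coordMap (frob k K) v = v) : ∃ x : Vec n k, coordMap (algebraMap k K) x = v := by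
  have := finite_of_finrank (by norm_num) hK
  choose x hx using fun i => exists_algebraMap_of_frob (k := k) (congrFun h i)
  exact ⟨x, funext hx⟩

theorem coordMap_frob_algebraMap {n : ℕ} (x : Vec n k) :
    coordMap (frob k K) (coordMap (algebraMap k K) x) = coordMap (algebraMap k K) x :=
  funext fun i => frob_algebraMap (x i)

theorem exists_frob_ne (hK : Module.finrank k K = 3) : ∃ x : K, frob k K x ≠ x := by
  have := finite_of_finrank (by norm_num) hK
  by_contra! h
  have hs : Function.Surjective (algebraMap k K) := fun x => exists_algebraMap_of_frob (h x)
  have := LinearMap.finrank_le_finrank_of_surjective (f := Algebra.linearMap k K) hs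
  rw [hK, Module.finrank_self] at this
  omega

/-- The collineation acting as `S` in the frame `M`. -/
def frameConj (M S : Vec 2 K ≃ₗ[K] Vec 2 K) : Vec 2 K ≃ₗ[K] Vec 2 K := M.symm ≪≫ₗ S ≪≫ₗ M

theorem frameConj_apply (S : Vec 2 K ≃ₗ[K] Vec 2 K) (u : Vec 2 K) :
    frameConj M S (M u) = M (S u) := by
  simp [frameConj]

/-- A map commuting with Frobenius sends rational vectors to Frobenius-fixed, hence rational,
vectors. -/
theorem ptLin_frameConj_subset {S : Vec 2 K ≃ₗ[K] Vec 2 K} (hK : Module.finrank k K = 3)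
    (hS : ∀ v, coordMap (frob k K) (S v) = S (coordMap (frob k K) v)) {P : PG 2 K}
    (hP : P ∈ subplane k M) : ptLin (frameConj (frameTrans N M) S) P ∈ subplane k M := by
  obtain ⟨x, hx⟩ := (mem_subplane_iff (N := N)).mp hP
  have h1 := hx.ptLin (frameConj (frameTrans N M) S)
  rw [frameConj_apply] at h1
  obtain ⟨z, hz⟩ := exists_coordMap_of_frob hK (v := S (coordMap (algebraMap k K) x)) (by
    rw [hS, coordMap_frob_algebraMap])
  rw [← hz] at h1
  exact (mem_subplane_iff (N := N)).mpr ⟨z, h1⟩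

theorem isRep_meetVec_of_forall (hK : Module.finrank k K = 3)
    (hδ : lineDet k a ≠ 0) {u : Vec 2 K} {P : PG 2 K} (hP : IsRep P (M u)) {j : Fin 3}
    (h : ∀ i, i ≠ j → dotProduct (conjVec k K a i) u = 0) :
    IsRep P (M (conjVec k K (meetVec k a) j)) := by
  have h1 := lineDet_smul (a := a) hK u
  rw [Finset.sum_eq_single j (fun i _ hi => by rw [h i hi, zero_smul]) (by simp)] at h1
  have h2 := hP.smul hδ
  rw [← map_smul, h1, map_smul] at h2
  exact h2.of_eq_smul rfl

/-- If both coordinates were non-zero, the eigenvalues `x^q` and `x^(q²)` would coincide, giving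
`x^q = x`. -/
theorem diagMap_ne_zero_or (hK : Module.finrank k K = 3) (hδ : lineDet k a ≠ 0) {x : K}
    (hx : frob k K x ≠ x) {u : Vec 2 K} {c : K} (h : diagMap k a x u = c • u) :
    dotProduct (conjVec k K a 1) u = 0 ∨ dotProduct (conjVec k K a 2) u = 0 := by
  by_contra! hne
  have h1 := congrArg (dotProduct (conjVec k K a 1)) h
  have h2 := congrArg (dotProduct (conjVec k K a 2)) h
  have d1 := dotProduct_diagMap hK hδ x u 1
  have d2 := dotProduct_diagMap hK hδ x u 2
  have e1 : conjEmb k K K 1 x = c := by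
    apply mul_right_cancel₀ hne.1
    refine (d1.symm.trans h1).trans ?_
    rw [dotProduct_smul, smul_eq_mul]
  have e2 : conjEmb k K K 2 x = c := by
    apply mul_right_cancel₀ hne.2
    refine (d2.symm.trans h2).trans ?_
    rw [dotProduct_smul, smul_eq_mul]
  have e : frob k K (conjEmb k K K 1 x) = conjEmb k K K 1 x := by
    rw [frob_conjEmb]
    exact e2.trans e1.symm
  apply hx
  apply (conjEmb k K K 1).injective
  rw [conjEmb_frob, ← frob_conjEmb, e]

theorem Bose.IsLineEq.map_frameConj_le (h : m.IsLineEq M ℓ S6 a) {S : Vec 2 K ≃ₗ[K] Vec 2 K}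
    (hS : ∀ u, dotProduct a u = 0 → dotProduct a (S u) = 0) :
    ℓ.map (frameConj M S).toLinearMap ≤ ℓ := by
  rintro _ ⟨v, hv, rfl⟩
  obtain ⟨u, rfl⟩ := M.surjective v
  change frameConj M S (M u) ∈ ℓ
  rw [frameConj_apply, h.mem_line]
  exact hS u ((h.mem_line u).mp hv)

/-- A carrier on `ℓ` is a common point of two conjugates of `ℓ`. -/
theorem Bose.IsLineEq.isRep_of_isCarrier (hK : Module.finrank k K = 3)
    (h : m.IsLineEq (frameTrans N M) ℓ S6 a) {P : PG 2 K}
    (hP : IsCarrier (subplane k M) ℓ P) (hPl : P ∈ pts ℓ) :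
    IsRep P (frameTrans N M (conjVec k K (meetVec k a) 1)) ∨
      IsRep P (frameTrans N M (conjVec k K (meetVec k a) 2)) := by
  have hδ : lineDet k a ≠ 0 := h.dotProduct_meetVec_ne_zero hK
  -- Any `x` outside `k` gives a diagonal map with distinct conjugate eigenvalues. It preserves the
  -- subplane and the line, and its only fixed points on the line are the two vertices there.
  obtain ⟨x, hx⟩ := exists_frob_ne (k := k) hK
  have hx0 : x ≠ 0 := by
    rintro rfl
    exact hx (map_zero _)
  set S := diagEquiv hK hδ hx0 with hSdef
  have hS : ∀ u, S u = diagMap k a x u := fun u => rfl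
  have hS' : ∀ u, S.symm u = diagMap k a x⁻¹ u := fun u => rfl
  set T := frameConj (frameTrans N M) S with hT
  have hTsymm : ∀ v, frameConj (frameTrans N M) S.symm v = T.symm v := fun v => rfl
  have h1 : ∀ Q ∈ subplane k M, ptLin T Q ∈ subplane k M := fun Q hQ =>
    ptLin_frameConj_subset hK (fun v => coordMap_frob_diagMap hK hδ x v) hQ
  have h2 : ∀ Q ∈ subplane k M, ptLin T.symm Q ∈ subplane k M := fun Q hQ =>
    ptLin_frameConj_subset (S := S.symm) hK (fun v => coordMap_frob_diagMap hK hδ x⁻¹ v) hQ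
  have hT1 : ptLin T '' subplane k M = subplane k M := by
    refine Set.Subset.antisymm (Set.image_subset_iff.mpr h1) fun Q hQ => ⟨_, h2 Q hQ, ?_⟩
    have := ((isRep_rep Q).ptLin T.symm).ptLin T
    rw [T.apply_symm_apply] at this
    exact this.unique (isRep_rep Q)
  have hT2 : ℓ.map T.toLinearMap = ℓ := by
    refine Submodule.eq_of_le_of_finrank_eq (h.map_frameConj_le fun u hu => ?_)
      (LinearEquiv.finrank_map_eq T ℓ)
    have := dotProduct_diagMap hK hδ x u 0
    rw [hS]
    refine this.trans ?_
    change _ * dotProduct a u = 0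
    rw [hu, mul_zero]
  have hfix := hP T hT1 hT2
  obtain ⟨u, hu⟩ : ∃ u, IsRep P (frameTrans N M u) := ⟨(frameTrans N M).symm P.rep, by
    rw [LinearEquiv.apply_symm_apply]; exact isRep_rep P⟩
  have hu' := hu.ptLin T
  rw [hfix, frameConj_apply] at hu'
  obtain ⟨c, hc, e⟩ := hu'.exists_smul hu
  rw [← map_smul] at e
  have e' := (frameTrans N M).injective e
  have h0 : dotProduct (conjVec k K a 0) u = 0 := (h.mem_line u).mp (hu.mem_pts.mp hPl)
  rcases diagMap_ne_zero_or hK hδ hx e' with h3 | h3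
  · right
    refine isRep_meetVec_of_forall hK hδ hu (j := 2) fun i hi => ?_
    fin_cases i
    exacts [h0, h3, absurd rfl hi]
  · left
    refine isRep_meetVec_of_forall hK hδ hu (j := 1) fun i hi => ?_
    fin_cases i
    exacts [h0, absurd rfl hi, h3]

/-- A linear bijection preserving a subplane commutes with conjugation up to a scalar. -/
theorem exists_frob_smul_of_image_subplane {S : Vec 2 K ≃ₗ[K] Vec 2 K}
    (hS : ∀ x : Vec 2 k, x ≠ 0 → ∃ (z : Vec 2 k) (c : K),
      c ≠ 0 ∧ S (coordMap (algebraMap k K) x) = c • coordMap (algebraMap k K) z) :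
    ∃ μ : K, μ ≠ 0 ∧ ∀ u, coordMap (frob k K) (S u) = μ • S (coordMap (frob k K) u) := by
  have key : ∀ x : Vec 2 k, x ≠ 0 → ∃ μ : K, μ ≠ 0 ∧
      coordMap (frob k K) (S (coordMap (algebraMap k K) x)) =
        μ • S (coordMap (algebraMap k K) x) := by
    intro x hx
    obtain ⟨z, c, hc, e⟩ := hS x hx
    refine ⟨frob k K c / c, div_ne_zero (by simpa using hc) hc, ?_⟩
    rw [e, coordMap_smul, coordMap_frob_algebraMap, smul_smul, div_mul_cancel₀ _ hc]
  -- The unit vectors together with their sum form a projective frame: comparing the factor of the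
  -- sum with those of the unit vectors shows that all factors agree.
  have hone : (fun _ => 1 : Vec 2 k) ≠ 0 := fun h => one_ne_zero (congrFun h 0)
  obtain ⟨μ, hμ, hsum⟩ := key _ hone
  choose ν hν0 hν using fun i : Fin 3 => key (Pi.single i 1) (by simp)
  simp only [coordMap_single] at hν
  have h1 : coordMap (algebraMap k K) (fun _ => 1 : Vec 2 k) =
      ∑ i : Fin 3, (Pi.single i 1 : Vec 2 K) := by
    ext j
    simp [coordMap_apply, Pi.single_apply]
  rw [h1, map_sum, map_sum, Finset.smul_sum] at hsum
  simp only [hν] at hsum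
  have hνμ : ∀ i, ν i = μ := by
    intro i
    have h2 : S (∑ j : Fin 3, ν j • (Pi.single j 1 : Vec 2 K)) =
        S (∑ j : Fin 3, μ • (Pi.single j 1 : Vec 2 K)) := by
      simpa only [map_sum, map_smul] using hsum
    have h3 := congrFun (S.injective h2) i
    simpa [Finset.sum_apply, Pi.single_apply] using h3
  refine ⟨μ, hμ, fun u => ?_⟩
  have hu : ∀ w : Vec 2 K, w = ∑ j : Fin 3, w j • (Pi.single j 1 : Vec 2 K) := fun w => by
    ext j
    simp [Finset.sum_apply, Pi.single_apply]
  conv_lhs => rw [hu u]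
  conv_rhs => rw [hu (coordMap (frob k K) u)]
  simp only [map_sum, map_smul, coordMap_smul, hν, hνμ, Finset.smul_sum, coordMap_apply]
  exact Finset.sum_congr rfl fun j _ => smul_comm _ _ _

/-- A collineation preserving the subplane commutes with Frobenius up to a scalar. Preserving the
line, it therefore preserves every conjugate of the line, and so fixes the vertices of the triangle.
-/
theorem Bose.IsLineEq.isCarrier (hK : Module.finrank k K = 3)
    (h : m.IsLineEq (frameTrans N M) ℓ S6 a) {P : PG 2 K} {j : Fin 3}
    (hP : IsRep P (frameTrans N M (conjVec k K (meetVec k a) j))) :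
    IsCarrier (subplane k M) ℓ P := by
  have hδ : lineDet k a ≠ 0 := h.dotProduct_meetVec_ne_zero hK
  intro T hTπ hTℓ
  set S : Vec 2 K ≃ₗ[K] Vec 2 K := frameTrans N M ≪≫ₗ T ≪≫ₗ (frameTrans N M).symm with hSdef
  have hMS : ∀ u, frameTrans N M (S u) = T (frameTrans N M u) := by
    intro u
    simp [S]
  obtain ⟨μ, hμ, hfr⟩ := exists_frob_smul_of_image_subplane (k := k) (S := S) (by
    intro x hx
    have h0 : frameTrans N M (coordMap (algebraMap k K) x) ≠ 0 := by
      simpa using coordMap_ne_zero (algebraMap k K) hx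
    have hmem : Projectivization.mk K _ h0 ∈ subplane k M :=
      (mem_subplane_iff (N := N)).mpr ⟨x, isRep_mk h0⟩
    have h1 : ptLin T (Projectivization.mk K _ h0) ∈ subplane k M := by
      rw [← hTπ]
      exact ⟨_, hmem, rfl⟩
    obtain ⟨z, hz⟩ := (mem_subplane_iff (N := N)).mp h1
    obtain ⟨c, hc, e⟩ := ((isRep_mk h0).ptLin T).exists_smul hz
    refine ⟨z, c, hc, (frameTrans N M).injective ?_⟩
    rw [hMS, e, map_smul])
  have hker : ∀ i : ℕ, ∀ u, dotProduct (conjVec k K a i) u = 0 →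
      dotProduct (conjVec k K a i) (S u) = 0 := by
    intro i
    induction i with
    | zero =>
      intro u hu
      have h1 : T (frameTrans N M u) ∈ ℓ := by
        rw [← hTℓ]
        exact ⟨_, (h.mem_line u).mpr hu, rfl⟩
      rw [← hMS] at h1
      exact (h.mem_line _).mp h1
    | succ i ih =>
      intro u hu
      have := finite_of_finrank (by norm_num) hK
      obtain ⟨w, rfl⟩ : ∃ w, coordMap (frob k K) w = u := by
        choose w hw using fun b => (frob_bijective (k := k) (F := K)).2 (u b)
        exact ⟨w, funext hw⟩
      rw [← coordMap_frob_conjVec, ← map_dotProduct, map_eq_zero] at hu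
      have h1 := congrArg (frob k K) (ih w hu)
      rw [map_dotProduct, coordMap_frob_conjVec, hfr, dotProduct_smul, map_zero] at h1
      exact (smul_eq_zero.mp h1).resolve_left hμ
  have h2 := hP.ptLin T
  rw [← hMS] at h2
  refine IsRep.unique (isRep_meetVec_of_forall hK hδ h2 (j := j) fun i hi => ?_) hP
  refine hker i _ ?_
  rw [dotProduct_conjVec_meetVec hK, if_neg hi]

theorem Bose.IsLineEq.mem_pts_of_isRep_meetVec (hK : Module.finrank k K = 3)
    (h : m.IsLineEq M ℓ S6 a) {P : PG 2 K} {j : Fin 3} (hj : j ≠ 0)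
    (hP : IsRep P (M (conjVec k K (meetVec k a) j))) : P ∈ pts ℓ := by
  rw [hP.mem_pts, h.mem_line]
  exact (dotProduct_conjVec_meetVec hK 0 j).trans (if_neg hj.symm)

/-- The carriers of a subplane and an exterior line on the line. -/
theorem Bose.IsLineEq.exists_carriers (hK : Module.finrank k K = 3)
    (h : m.IsLineEq (frameTrans N M) ℓ S6 a) :
    ∃ E E' : PG 2 K, IsRep E (frameTrans N M (conjVec k K (meetVec k a) 1)) ∧
      IsRep E' (frameTrans N M (conjVec k K (meetVec k a) 2)) ∧ E' = planeConj k M E ∧ E ≠ E' ∧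
      {P | IsCarrier (subplane k M) ℓ P ∧ P ∈ pts ℓ} = {E, E'} := by
  have hδ : lineDet k a ≠ 0 := h.dotProduct_meetVec_ne_zero hK
  have h0 : frameTrans N M (conjVec k K (meetVec k a) 1) ≠ 0 := by
    intro h0
    have h1 := dotProduct_conjVec_meetVec (a := a) hK 1 1
    have h2 : conjVec k K (meetVec k a) (1 : Fin 3) = 0 :=
      (map_eq_zero_iff _ (frameTrans N M).injective).mp h0
    rw [h2, dotProduct_zero, if_pos rfl] at h1
    exact hδ h1.symm
  have hE := isRep_mk h0
  have hE' := isRep_planeConj hE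
  rw [coordMap_frob_conjVec] at hE'
  refine ⟨_, _, hE, hE', rfl, fun e => ?_, ?_⟩
  · rw [← e] at hE'
    obtain ⟨c, hc, e⟩ := hE.exists_smul hE'
    rw [← map_smul] at e
    have h1 := dotProduct_conjVec_meetVec (a := a) hK 1 1
    have h2 := dotProduct_conjVec_meetVec (a := a) hK 1 2
    have e1 : conjVec k K (meetVec k a) (1 : Fin 3) = c • conjVec k K (meetVec k a) (2 : Fin 3) :=
      (frameTrans N M).injective e
    rw [e1, dotProduct_smul, h2, if_pos rfl, if_neg (by decide), smul_zero] at h1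
    exact hδ h1.symm
  · ext P
    constructor
    · rintro ⟨h1, h2⟩
      rcases h.isRep_of_isCarrier hK h1 h2 with h3 | h3
      · exact Or.inl (h3.unique hE)
      · exact Or.inr (h3.unique hE')
    · rintro (rfl | rfl)
      · exact ⟨h.isCarrier hK (j := 1) hE, h.mem_pts_of_isRep_meetVec hK (j := 1) (by decide) hE⟩
      · exact ⟨h.isCarrier hK (j := 2) hE', h.mem_pts_of_isRep_meetVec hK (j := 2) (by decide) hE'⟩

end Carriers

/-! ### The dichotomy -/

section Main

variable {k K L : Type*} [Field k] [Fintype k] [Field K] [Field L]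
  [Algebra k K] [Algebra k L] [Algebra K L] [IsScalarTower k K L]
  {m : Bose k K} {M : Vec 2 K ≃ₗ[K] Vec 2 K} {N : Vec 2 k ≃ₗ[k] Vec 2 k}
  {ℓ : Submodule K (Vec 2 K)} {S6 : Submodule k (Vec 8 k)} {a : Vec 2 K}
  {f : MvPolynomial (Fin 3) k} {c : k}

/-- Dividing by a non-zero coordinate makes the vector equal to its Frobenius image. -/
theorem Parallel.exists_coordMap (hK : Module.finrank k K = 3) {n : ℕ} {y : Vec n K} (hy : y ≠ 0)
    (h : Parallel y (coordMap (frob k K) y)) :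
    ∃ (x : Vec n k) (c : K), c ≠ 0 ∧ y = c • coordMap (algebraMap k K) x := by
  obtain ⟨i, hi⟩ := Function.ne_iff.mp hy
  have hi : y i ≠ 0 := hi
  have hi' : frob k K (y i) ≠ 0 := by simpa using hi
  obtain ⟨x, hx⟩ := exists_coordMap_of_frob (k := k) hK (v := (y i)⁻¹ • y) (by
    ext b
    have hb : y i * frob k K (y b) = y b * frob k K (y i) := h i b
    rw [coordMap_apply, Pi.smul_apply, smul_eq_mul, map_mul, map_inv₀]
    field_simp
    linear_combination hb)
  exact ⟨x, y i, hi, by rw [hx, smul_inv_smul₀ hi]⟩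

/-- The rational points of the variety of the conic are the points on the spread planes. -/
theorem Bose.conicVariety_eq_bruckBose (hK : Module.finrank k K = 3) (hf : conicEq N.symm f =
      MvPolynomial.C c * (MvPolynomial.X 0 * MvPolynomial.X 2 - MvPolynomial.X 1 ^ 2))
    (hc : c ≠ 0) : m.conicVariety S6 M f k = m.bruckBose S6 (fqConic M f) := by
  ext P
  have hP := isRep_rep P
  rw [← m.extPt_mem_conicVariety hK hf hc,
    m.mem_conicVariety_iff hK hf hc ((isRep_extPt_iff (F' := K)).mpr hP), coordMap_mem_ext_iff]
  simp only [m.Y_coordMap]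
  set y := m.y (frameTrans N M) P.rep with hy
  have hplane : ∀ X : PG 2 K, P ∈ pts (m.plane X ⊓ S6) ↔
      frameTrans N M y ∈ X.submodule ∧ P.rep ∈ S6 := by
    intro X
    rw [hP.mem_pts, Submodule.mem_inf, m.plane_eq]
    refine and_congr_left fun _ => ?_
    refine (m.mem_sup_conj_iff (frameTrans N M) hK X.submodule _).trans ?_
    simp only [m.Y_coordMap, ← hy, conjEmb_self]
    constructor
    · intro h
      obtain ⟨u, hu, e⟩ := h 0 (by norm_num)
      have e : y = u := e
      rwa [e]
    · exact fun h j _ => ⟨y, h, rfl⟩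
  constructor
  · rintro ⟨h, hS⟩
    have hy0 : y ≠ 0 := fun h0 =>
      hP.ne_zero ((m.y_bijective (frameTrans N M) hK).1 (h0.trans (map_zero _).symm))
    obtain ⟨hpar, hcon⟩ := h 0 (by norm_num)
    have hpar : Parallel y (coordMap (frob k K) y) := by
      rwa [conjEmb_self, conjEmb_self, zero_add, pow_one] at hpar
    have hcon : y 0 * y 2 = y 1 ^ 2 := hcon
    obtain ⟨x, b, hb, e⟩ := hpar.exists_coordMap hK hy0
    have h0 : frameTrans N M y ≠ 0 := by simpa using hy0
    have hX := isRep_mk h0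
    refine ⟨Projectivization.mk K _ h0, (mem_fqConic_iff hf hc).mpr ⟨x, ?_, ?_⟩,
      (hplane _).mpr ⟨?_, hS⟩⟩
    · apply (algebraMap k K).injective
      rw [e] at hcon
      simp only [Pi.smul_apply, coordMap_apply, smul_eq_mul] at hcon
      rw [map_mul, map_pow]
      apply mul_left_cancel₀ (pow_ne_zero 2 hb)
      linear_combination hcon
    · refine hX.of_eq_smul (c := b) ?_
      rw [← map_smul, ← e]
    · rw [hX]
      exact Submodule.mem_span_singleton_self _
  · rintro ⟨X, hX, hPX⟩
    obtain ⟨x, hx, hXx⟩ := (mem_fqConic_iff hf hc).mp hX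
    obtain ⟨h1, hS⟩ := (hplane X).mp hPX
    rw [hXx, Submodule.mem_span_singleton] at h1
    obtain ⟨b, hb⟩ := h1
    rw [← map_smul] at hb
    obtain hb := (frameTrans N M).injective hb
    have hconj : ∀ j, coordMap (conjEmb k K K j) y =
        conjEmb k K K j b • coordMap (algebraMap k K) x := by
      intro j
      rw [← hb, coordMap_smul]
      congr 1
      exact funext fun i => conjEmb_algebraMap (k := k) (K := K) (F := K) j (x i)
    refine ⟨fun j _ => ⟨?_, ?_⟩, hS⟩
    · rw [hconj, hconj]
      exact Parallel.smul (fun _ _ => mul_comm _ _) _ _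
    · have hx' := congrArg (algebraMap k K) hx
      rw [map_mul, map_pow] at hx'
      rw [hconj]
      simp only [Pi.smul_apply, coordMap_apply, smul_eq_mul]
      linear_combination (conjEmb k K K j b) ^ 2 * hx'

theorem extPt_mem_conicExt_iff (hf : conicEq N.symm f =
      MvPolynomial.C c * (MvPolynomial.X 0 * MvPolynomial.X 2 - MvPolynomial.X 1 ^ 2))
    (hc : c ≠ 0) {P : PG 2 K} {u : Vec 2 K} (hP : IsRep P (frameTrans N M u)) :
    extPt L P ∈ conicExt L M f ↔ u 0 * u 2 = u 1 ^ 2 := by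
  have h1 : IsRep (extPt L P) (coordMap (algebraMap K L) (frameTrans N M u)) := hP.ptMap _
  have h2 := extLin_coordMap (F' := L) (frameTrans N M).toLinearMap u
  rw [LinearEquiv.coe_coe] at h2
  rw [← h2] at h1
  rw [mem_conicExt_iff hf hc h1]
  simp only [coordMap_apply, ← map_mul, ← map_pow]
  exact (algebraMap K L).injective.eq_iff

/-- The resultant of two neighbouring conjugates is by definition the conic equation at their
intersection. In the coprime case no vertex, hence neither carrier, lies on the conic. -/
theorem conjVec_meetVec_not_conic (hr : resultant (conjVec k K a 0) (conjVec k K a 1) ≠ 0)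
    (j : ℕ) : conjVec k K (meetVec k a) j 0 * conjVec k K (meetVec k a) j 2 ≠
      conjVec k K (meetVec k a) j 1 ^ 2 := by
  intro h
  rw [conjVec_meetVec] at h
  exact resultant_conjVec_ne_zero hr (j + 1) (sub_eq_zero.mpr h)

/-- The conic meets the line in the two carriers if and only if two conjugates of the line meet
on the conic. -/
theorem Bose.IsLineEq.conicExt_inter_eq_iff (hK : Module.finrank k K = 3)
    (hℓ : Module.finrank K ℓ = 2)
    (h : m.IsLineEq (frameTrans N M) ℓ S6 a) (hf : conicEq N.symm f =
      MvPolynomial.C c * (MvPolynomial.X 0 * MvPolynomial.X 2 - MvPolynomial.X 1 ^ 2))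
    (hc : c ≠ 0) {E E' : PG 2 K}
    (hE : IsRep E (frameTrans N M (conjVec k K (meetVec k a) 1)))
    (hE' : IsRep E' (frameTrans N M (conjVec k K (meetVec k a) 2))) :
    conicExt K M f ∩ pts ℓ = {E, E'} ↔ resultant (conjVec k K a 0) (conjVec k K a 1) = 0 := by
  constructor
  · intro hEE
    by_contra hr
    have hmem : E ∈ conicExt K M f := (hEE.ge (Or.inl rfl)).1
    refine conjVec_meetVec_not_conic hr 1 ((mem_conicExt_iff hf hc ?_).mp hmem)
    rw [extLin_self]
    exact hE
  · intro hr
    obtain ⟨b, x, y, hb, e, hv⟩ := h.exists_isVertex hK hr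
    obtain ⟨d, hd, e0, e1, e2⟩ := hv.exists_factor hK
    rw [← ext_self ℓ]
    refine h.conicExt_inter_line (L := K) hℓ hf hc hd (hv.conj_ne_zero 1) (hv.conj_ne_zero 2)
      e0 e1 e2 ?_ ?_
    · rw [extLin_self]
      exact isRep_conjVec_veronese e hE
    · rw [extLin_self]
      exact isRep_conjVec_veronese e hE'

theorem Bose.IsLineEq.isNRC_sextic (hK : Module.finrank k K = 3) (hS6 : Module.finrank k S6 = 7)
    (h : m.IsLineEq (frameTrans N M) ℓ S6 a) (hf : conicEq N.symm f =
      MvPolynomial.C c * (MvPolynomial.X 0 * MvPolynomial.X 2 - MvPolynomial.X 1 ^ 2))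
    (hc : c ≠ 0) (hr : resultant (conjVec k K a 0) (conjVec k K a 1) ≠ 0) :
    m.IsNRC L S6 M f (m.sexticMap (frameTrans N M) hK a) := by
  have hA := m.sexticMap_injective (M := frameTrans N M) hK hr
  have hVK := h.conicVariety_eq_sextic (F := K) hK hS6 hf hc hr
  refine ⟨hA, ?_, hVK, h.conicVariety_eq_sextic (F := L) hK hS6 hf hc hr⟩
  ext P
  rw [← m.extPt_mem_conicVariety hK hf hc, hVK, extPt_mem_nrc (by norm_num) hA]

/-- The sextic case. -/
theorem Bose.IsLineEq.sextic_case (hK : Module.finrank k K = 3) (hL : Module.finrank K L = 2)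
    (hℓ : Module.finrank K ℓ = 2) (hS6 : Module.finrank k S6 = 7)
    (h : m.IsLineEq (frameTrans N M) ℓ S6 a) (hf : conicEq N.symm f =
      MvPolynomial.C c * (MvPolynomial.X 0 * MvPolynomial.X 2 - MvPolynomial.X 1 ^ 2))
    (hc : c ≠ 0) (hr : resultant (conjVec k K a 0) (conjVec k K a 1) ≠ 0) {E E' : PG 2 K}
    (hE : IsRep E (frameTrans N M (conjVec k K (meetVec k a) 1)))
    (hE' : IsRep E' (frameTrans N M (conjVec k K (meetVec k a) 2))) :
    ∃ A : Vec 6 k →ₗ[k] Vec 8 k, m.IsNRC L S6 M f A ∧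
      ∃ P Q : PG 2 L,
        conicExt L M f ∩ pts (ext L ℓ) = {P, Q} ∧
        P ∉ ({extPt L E, extPt L E'} : Set (PG 2 L)) ∧
        Q ∉ ({extPt L E, extPt L E'} : Set (PG 2 L)) ∧
        ((P ∈ Set.range (extPt (F := K) (n := 2) L) ∧
            Q ∈ Set.range (extPt (F := K) (n := 2) L)) ∨
          (P ∉ Set.range (extPt (F := K) (n := 2) L) ∧
            Q ∉ Set.range (extPt (F := K) (n := 2) L) ∧
            m.toΓ Q = (conjPt k)^[3] (m.toΓ P))) ∧
        nrc L A ∩ pts (ext L (m.infinity ℓ)) =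
          {m.toΓ P, conjPt k (m.toΓ P), conjPt k (conjPt k (m.toΓ P)),
            m.toΓ Q, conjPt k (m.toΓ Q), conjPt k (conjPt k (m.toΓ Q))} ∧
        MeetsIn L A S6 (m.infinity ℓ)
          ![m.toΓ P, conjPt k (m.toΓ P), conjPt k (conjPt k (m.toΓ P)),
            m.toΓ Q, conjPt k (m.toΓ Q), conjPt k (conjPt k (m.toΓ Q))] := by
  have hN := h.isNRC_sextic (L := L) hK hS6 hf hc hr
  obtain ⟨P, Q, hPQ, hrat, hM⟩ := h.sextic_infinity (L := L) hK hL hℓ hS6 hf hc hr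
  have hnot : ∀ X ∈ conicExt L M f, X ∉ ({extPt L E, extPt L E'} : Set (PG 2 L)) := by
    rintro X hX (rfl | rfl)
    · exact conjVec_meetVec_not_conic hr 1 ((extPt_mem_conicExt_iff hf hc hE).mp hX)
    · exact conjVec_meetVec_not_conic hr 2 ((extPt_mem_conicExt_iff hf hc hE').mp hX)
  have hin := hM.inter_eq fun X hX => (hN.2.2.2.ge hX).2
  simp only [Matrix.range_cons, Matrix.range_empty, Set.union_empty, Set.singleton_union] at hin
  exact ⟨_, hN, P, Q, hPQ, hnot P (hPQ.ge (Or.inl rfl)).1, hnot Q (hPQ.ge (Or.inr rfl)).1, hrat,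
    hin, hM⟩

end Main

end

end BruckBose

/-! ### Assembly of the two cases -/

theorem mainTheorem5 {k K L : Type*} [Field k] [Fintype k] [Field K] [Field L]
    [Algebra k K] [Algebra k L] [Algebra K L] [IsScalarTower k K L]
    (hK : Module.finrank k K = 3) (hL : Module.finrank K L = 2)
    -- the Bose representation of PG(2,K)
    (m : BruckBose.Bose k K)
    -- the line at infinity, and the 6-space of the Bruck-Bose representation
    (ℓ : Submodule K (BruckBose.Vec 2 K)) (hℓ : Module.finrank K ℓ = 2)
    (S6 : Submodule k (BruckBose.Vec 8 k)) (hS6 : Module.finrank k S6 = 7)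
    (hinf : m.infinity ℓ ≤ S6)
    -- the subplane, exterior to the line at infinity, and the conic in it
    (M : BruckBose.Vec 2 K ≃ₗ[K] BruckBose.Vec 2 K)
    (hext : Disjoint (BruckBose.subplane k M) (BruckBose.pts ℓ))
    (f : MvPolynomial (Fin 3) k) (hf : BruckBose.IsNondegenerateConic f) :
    -- the variety has point set [C]
    m.conicVariety S6 M f k = m.bruckBose S6 (BruckBose.fqConic M f) ∧
    -- the carriers on the line at infinity
    ∃ E E' : BruckBose.PG 2 K, E' = BruckBose.planeConj k M E ∧ E ≠ E' ∧
      {P | BruckBose.IsCarrier (BruckBose.subplane k M) ℓ P ∧ P ∈ BruckBose.pts ℓ} = {E, E'} ∧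
      -- the dichotomy
      ((∃ A : BruckBose.Vec 6 k →ₗ[k] BruckBose.Vec 8 k, m.IsNRC L S6 M f A) ∨
        (∃ (A : BruckBose.Vec 3 k →ₗ[k] BruckBose.Vec 8 k)
          (h₁ h₂ h₃ : Submodule K (BruckBose.Vec 8 K)),
          m.IsTLine ℓ h₁ ∧ m.IsTLine ℓ h₂ ∧ m.IsTLine ℓ h₃ ∧
          m.IsNRCWithLines L S6 M f A h₁ h₂ h₃)) ∧
      -- when the two cases occur
      ((∃ A : BruckBose.Vec 6 k →ₗ[k] BruckBose.Vec 8 k, m.IsNRC L S6 M f A) ↔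
        BruckBose.conicExt K M f ∩ BruckBose.pts ℓ ≠ {E, E'}) ∧
      ((∃ (A : BruckBose.Vec 3 k →ₗ[k] BruckBose.Vec 8 k)
          (h₁ h₂ h₃ : Submodule K (BruckBose.Vec 8 K)),
          m.IsTLine ℓ h₁ ∧ m.IsTLine ℓ h₂ ∧ m.IsTLine ℓ h₃ ∧
          m.IsNRCWithLines L S6 M f A h₁ h₂ h₃) ↔
        BruckBose.conicExt K M f ∩ BruckBose.pts ℓ = {E, E'}) ∧
      -- details of the 3-dimensional case
      (BruckBose.conicExt K M f ∩ BruckBose.pts ℓ = {E, E'} →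
        ∃ (A : BruckBose.Vec 3 k →ₗ[k] BruckBose.Vec 8 k) (h : Submodule K (BruckBose.Vec 8 K)),
          h = m.joinLine E E' ∧
          m.IsTLine ℓ h ∧ m.IsTLine ℓ (BruckBose.conj k h) ∧
          m.IsTLine ℓ (BruckBose.conj k (BruckBose.conj k h)) ∧
          m.IsNRCWithLines L S6 M f A h (BruckBose.conj k h)
            (BruckBose.conj k (BruckBose.conj k h)) ∧
          m.conicVariety S6 M f K ∩ BruckBose.pts (BruckBose.ext K (m.infinity ℓ)) =
            BruckBose.pts h ∪ BruckBose.pts (BruckBose.conj k h) ∪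
              BruckBose.pts (BruckBose.conj k (BruckBose.conj k h)) ∧
          ∃ R ∈ BruckBose.pts h,
            BruckBose.nrc K A ∩ BruckBose.pts (BruckBose.ext K (m.infinity ℓ)) =
              {R, BruckBose.conjPt k R, BruckBose.conjPt k (BruckBose.conjPt k R)} ∧
            BruckBose.MeetsIn K A S6 (m.infinity ℓ)
              ![R, BruckBose.conjPt k R, BruckBose.conjPt k (BruckBose.conjPt k R)] ∧
            ∀ X ∈ BruckBose.pts ℓ, R ∉ BruckBose.pts (BruckBose.ext K (m.plane X))) ∧
      -- details of the 6-dimensional case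
      (BruckBose.conicExt K M f ∩ BruckBose.pts ℓ ≠ {E, E'} →
        ∃ A : BruckBose.Vec 6 k →ₗ[k] BruckBose.Vec 8 k, m.IsNRC L S6 M f A ∧
          ∃ P Q : BruckBose.PG 2 L,
            BruckBose.conicExt L M f ∩ BruckBose.pts (BruckBose.ext L ℓ) = {P, Q} ∧
            P ∉ ({BruckBose.extPt L E, BruckBose.extPt L E'} : Set (BruckBose.PG 2 L)) ∧
            Q ∉ ({BruckBose.extPt L E, BruckBose.extPt L E'} : Set (BruckBose.PG 2 L)) ∧
            ((P ∈ Set.range (BruckBose.extPt (F := K) (n := 2) L) ∧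
                Q ∈ Set.range (BruckBose.extPt (F := K) (n := 2) L)) ∨
              (P ∉ Set.range (BruckBose.extPt (F := K) (n := 2) L) ∧
                Q ∉ Set.range (BruckBose.extPt (F := K) (n := 2) L) ∧
                m.toΓ Q = (BruckBose.conjPt k)^[3] (m.toΓ P))) ∧
            BruckBose.nrc L A ∩ BruckBose.pts (BruckBose.ext L (m.infinity ℓ)) =
              {m.toΓ P, BruckBose.conjPt k (m.toΓ P),
                BruckBose.conjPt k (BruckBose.conjPt k (m.toΓ P)),
                m.toΓ Q, BruckBose.conjPt k (m.toΓ Q),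
                BruckBose.conjPt k (BruckBose.conjPt k (m.toΓ Q))} ∧
            BruckBose.MeetsIn L A S6 (m.infinity ℓ)
              ![m.toΓ P, BruckBose.conjPt k (m.toΓ P),
                BruckBose.conjPt k (BruckBose.conjPt k (m.toΓ P)),
                m.toΓ Q, BruckBose.conjPt k (m.toΓ Q),
                BruckBose.conjPt k (BruckBose.conjPt k (m.toΓ Q))]) := by
  obtain ⟨N, c, hc, hf'⟩ := BruckBose.exists_conic_normal_form hf
  obtain ⟨a, h⟩ := m.exists_isLineEq (M := BruckBose.frameTrans N M) hK hℓ hS6 hinf (by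
    intro x hx
    by_contra hx0
    have h0 : BruckBose.frameTrans N M (BruckBose.coordMap (algebraMap k K) x) ≠ 0 := by
      simpa using BruckBose.coordMap_ne_zero (algebraMap k K) hx0
    have hX := BruckBose.isRep_mk h0
    exact Set.disjoint_left.mp hext ((BruckBose.mem_subplane_iff (N := N)).mpr ⟨x, hX⟩)
      (hX.mem_pts.mpr hx))
  obtain ⟨E, E', hE, hE', hEE, hne, hcar⟩ := h.exists_carriers hK
  have hiff := h.conicExt_inter_eq_iff hK hℓ hf' hc hE hE'
  have hcub := fun hr => h.cubic_case (L := L) hK hS6 hf' hc hr hE hE'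
  have hsex := fun hr => h.sextic_case hK hL hℓ hS6 hf' hc hr hE hE' (L := L)
  refine ⟨m.conicVariety_eq_bruckBose hK hf' hc, E, E', hEE, hne, hcar, ?_, ?_, ?_,
    fun hr => hcub (hiff.mp hr), fun hr => hsex (hr ∘ hiff.mpr)⟩
  · by_cases hr : BruckBose.resultant (BruckBose.conjVec k K a 0) (BruckBose.conjVec k K a 1) = 0
    · obtain ⟨A, h₁, -, t₁, t₂, t₃, hA, -⟩ := hcub hr
      exact Or.inr ⟨A, _, _, _, t₁, t₂, t₃, hA⟩
    · exact Or.inl ⟨_, h.isNRC_sextic hK hS6 hf' hc hr⟩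
  · rw [ne_eq, hiff]
    refine ⟨?_, fun hr => ⟨_, h.isNRC_sextic hK hS6 hf' hc hr⟩⟩
    -- With zero resultant the variety over `K` contains a line, which no 6-dimensional normal
    -- rational curve does; so the existence of any such curve, not only the constructed one, forces
    -- the coprime case.
    rintro ⟨A, hA, -, hAK, -⟩ hr
    obtain ⟨_, h₁, -, t₁, -, -, ⟨-, -, -, -, -, hV, -⟩, -⟩ := hcub hr
    refine BruckBose.not_line_subset_nrc hA t₁.1.ge (F := K) ?_
    rw [← hAK, hV]
    exact fun P hP => Or.inr (Or.inl (Or.inl hP))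
  · rw [hiff]
    constructor
    · rintro ⟨_, h₁, _, _, t₁, -, -, ⟨-, -, -, -, -, hV, -⟩⟩
      by_contra hr
      obtain ⟨hA, -, hAK, -⟩ := h.isNRC_sextic (L := L) hK hS6 hf' hc hr
      refine BruckBose.not_line_subset_nrc hA t₁.1.ge (F := K) ?_
      rw [← hAK, hV]
      exact fun P hP => Or.inr (Or.inl (Or.inl hP))
    · intro hr
      obtain ⟨A, h₁, -, t₁, t₂, t₃, hA, -⟩ := hcub hr
      exact ⟨A, _, _, _, t₁, t₂, t₃, hA⟩
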